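/- **Theorem (Blow-up of mild solutions).** Let $N\ge 1$ be an integer, $0<\gamma_1,\gamma_2<1$, $p,q\ge 1$ real, and let $u_0,v_0\in C_0(\mathbb R^N)$ (continuous functions vanishing at infinity, with the sup norm) satisfy $u_0,v_0\ge 0$, $u_0\not\equiv 0$, $v_0\not\equiv 0$. Consider the system $$ {}^{C}D^{\gamma_1}_{0|t}u-\Delta u=|v|^p,\qquad {}^{C}D^{\gamma_2}_{0|t}v-\Delta v=|u|^q,\qquad t>0,\ x\in\mathbb R^N,\qquad u(0)=u_0,\ v(0)=v_0, $$ where ${}^{C}D^{\gamma}_{0|t}$ is the Caputo derivative. For $0<\alpha<1$ let $$\phi_\alpha(\theta)=\sum_{k\ge 0}\frac{(-\theta)^k}{k!\,\Gamma(-\alpha k+1-\alpha)},\quad P_\alpha(t)w=\int_0^\infty\phi_\alpha(\theta)\,e^{t^\alpha\theta\Delta}w\,d\theta,\quad S_\alpha(t)w=\alpha\int_0^\infty\theta\,\phi_\alpha(\theta)\,e^{t^\alpha\theta\Delta}w\,d\theta ,$$ where $(e^{t\Delta})_{t\ge 0}$ is the heat semigroup. A mild solution on $[0,T]$, $T>0$,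 is a pair $(u,v)\in C([0,T];C_0(\mathbb R^N)\times C_0(\mathbb R^N))$ such that for all $t\in[0,T]$ $$u(t)=P_{\gamma_1}(t)u_0+\int_0^t(t-\tau)^{\gamma_1-1}S_{\gamma_1}(t-\tau)|v(\tau)|^p\,d\tau,\qquad v(t)=P_{\gamma_2}(t)v_0+\int_0^t(t-\tau)^{\gamma_2-1}S_{\gamma_2}(t-\tau)|u(\tau)|^q\,d\tau .$$ Assume that one of the following holds: 1. $p>1$, $q>1$ and $$\frac N2<\min\Big\{\frac{p\gamma_2+\gamma_1}{\gamma_1(pq-1)},\ \frac{q\gamma_1+\gamma_2}{\gamma_1(pq-1)},\ \frac{pq(\gamma_1-\gamma_2)+q\gamma_1+\gamma_2}{\gamma_1(pq-1)},\ \frac{p+1}{pq-1}\Big\};$$ 2. $p>1$, $q>1$ and $$\frac N2<\min\Big\{\frac{q\gamma_1+\gamma_2}{\gamma_2(pq-1)},\ \frac{p\gamma_2+\gamma_1}{\gamma_2(pq-1)},\ \frac{pq(\gamma_2-\gamma_1)+p\gamma_2+\gamma_1}{\gamma_2(pq-1)},\ \frac{q+1}{pq-1}\Big\};$$ 3. $p=1$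 and $1<q<1+\frac2N$; 4. $q=1$ and $1<p<1+\frac2N$. Then the mild solution blows up in finite time: there are $T_{\max}\in(0,\infty)$ and a pair $(u,v)$ of functions $[0,T_{\max})\to C_0(\mathbb R^N)$ that is a mild solution on $[0,T]$ for every $T\in(0,T_{\max})$, such that every mild solution on an interval $[0,T]$, $T>0$, satisfies $T<T_{\max}$ and coincides with $(u,v)$ on $[0,T]$, and $$\lim_{t\uparrow T_{\max}}\big(\|u(t)\|_\infty+\|v(t)\|_\infty\big)=\infty .$$ -/

import Mathlib

open Set Filter Topology MeasureTheory
open scoped ZeroAtInfty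

noncomputable section

namespace FracDiffusion

/-- The Wright type function
`φ_α(z) = ∑_k (-z)^k / (k! Γ(-α k + 1 - α))`, for `0 < α < 1`.
At the poles of `Γ` the Mathlib value is `Γ = 0`, hence the corresponding term is `0`, which is
the value of the entire function `1 / Γ` there. -/
def wright (α z : ℝ) : ℝ :=
  ∑' k : ℕ, (-z) ^ k / ((k.factorial : ℝ) * Real.Gamma (-α * k + 1 - α))

/-- The Gauss kernel `G(t, x) = (4 π t)^(-N/2) exp(-|x|² / (4 t))` (used for `t > 0`). -/
def heatKernel {N : ℕ} (t : ℝ) (x : EuclideanSpace ℝ (Fin N)) : ℝ :=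
  1 / (4 * Real.pi * t) ^ ((N : ℝ) / 2) * Real.exp (-‖x‖ ^ 2 / (4 * t))

/-- The heat semigroup: convolution with the Gauss kernel for `t > 0`, the identity at `t = 0`. -/
def heat {N : ℕ} (t : ℝ) (w : EuclideanSpace ℝ (Fin N) → ℝ) (x : EuclideanSpace ℝ (Fin N)) : ℝ :=
  if 0 < t then ∫ y, heatKernel t (x - y) * w y else w x

/-- `P_α(t) w = ∫_0^∞ φ_α(θ) T(t^α θ) w dθ`. -/
def opP {N : ℕ} (α t : ℝ) (w : EuclideanSpace ℝ (Fin N) → ℝ) (x : EuclideanSpace ℝ (Fin N)) : ℝ :=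
  ∫ θ in Ioi (0 : ℝ), wright α θ * heat (t ^ α * θ) w x

/-- `S_α(t) w = α ∫_0^∞ θ φ_α(θ) T(t^α θ) w dθ`. -/
def opS {N : ℕ} (α t : ℝ) (w : EuclideanSpace ℝ (Fin N) → ℝ) (x : EuclideanSpace ℝ (Fin N)) : ℝ :=
  α * ∫ θ in Ioi (0 : ℝ), θ * wright α θ * heat (t ^ α * θ) w x

/-- `(u, v) ∈ C([0, T]; C₀(ℝ^N) × C₀(ℝ^N))` is a mild solution on `[0, T]` of
`ᶜD^γ₁ u - Δ u = f(v)`, `ᶜD^γ₂ v - Δ v = g(u)` with initial data `(u₀, v₀)`. -/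
structure IsMildSolution {N : ℕ} (γ₁ γ₂ : ℝ) (f g : ℝ → ℝ)
    (u₀ v₀ : C₀(EuclideanSpace ℝ (Fin N), ℝ)) (T : ℝ)
    (u v : ℝ → C₀(EuclideanSpace ℝ (Fin N), ℝ)) : Prop where
  continuousOn_u : ContinuousOn u (Icc 0 T)
  continuousOn_v : ContinuousOn v (Icc 0 T)
  eq_u : ∀ t ∈ Icc 0 T, ∀ x, u t x = opP γ₁ t u₀ x +
    ∫ τ in (0 : ℝ)..t, (t - τ) ^ (γ₁ - 1) * opS γ₁ (t - τ) (fun y => f (v τ y)) x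
  eq_v : ∀ t ∈ Icc 0 T, ∀ x, v t x = opP γ₂ t v₀ x +
    ∫ τ in (0 : ℝ)..t, (t - τ) ^ (γ₂ - 1) * opS γ₂ (t - τ) (fun y => g (u τ y)) x

/-- The mild solution blows up in finite time: there are a finite `Tmax > 0` and a mild solution
`(u, v)` on `[0, Tmax)` which is maximal and unique (every mild solution on some `[0, T]` has
`T < Tmax` and is the restriction of `(u, v)`), and
`‖u(t)‖_∞ + ‖v(t)‖_∞ → ∞` as `t → Tmax`, `t < Tmax`. -/
def MildSolutionBlowsUp {N : ℕ} (γ₁ γ₂ : ℝ) (f g : ℝ → ℝ)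
    (u₀ v₀ : C₀(EuclideanSpace ℝ (Fin N), ℝ)) : Prop :=
  ∃ Tmax : ℝ, 0 < Tmax ∧ ∃ u v : ℝ → C₀(EuclideanSpace ℝ (Fin N), ℝ),
    (∀ T : ℝ, 0 < T → T < Tmax → IsMildSolution γ₁ γ₂ f g u₀ v₀ T u v) ∧
    (∀ T : ℝ, 0 < T → ∀ u' v' : ℝ → C₀(EuclideanSpace ℝ (Fin N), ℝ),
      IsMildSolution γ₁ γ₂ f g u₀ v₀ T u' v' →
        T < Tmax ∧ EqOn u' u (Icc 0 T) ∧ EqOn v' v (Icc 0 T)) ∧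
    Tendsto (fun t => ‖u t‖ + ‖v t‖) (𝓝[<] Tmax) atTop

end FracDiffusion

end

/-! Nonexistence for large `T`. Put `a = T ^ γ₁` and measure a solution by the Gaussian averages
`U(t) = (e^{aΔ} u(t))(0)` and `V(t) = (e^{aΔ} v(t))(0)`. Heat kernels satisfy `G_b ≥ (a/b)^{N/2}
G_a` for `b ≥ a`, and the Wright function is nonnegative with positive mass on `(0, 1]`. Hence on
nonnegative data `e^{aΔ} P_γ(t)` and `e^{aΔ} S_γ(t)` dominate a fixed multiple of `e^{aΔ}` as long
as `t ^ γ ≤ a` (`exists_heatOp_frac_ge`). With Jensen, a lower bound for `V` on a time window yields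
one for `U` at its end, and conversely (`heatOp_volterra_ge`). The linear part gives the start `U ≥
M`, with `M` of order `T ^ (-γ₁ N / 2)`. Iterating over geometrically shrinking windows multiplies
the bound by `D ≥ 2` each time, which is absurd, as soon as a constant times `T ^ E` is large, where
`E = γ₁ + p min(γ₁, γ₂) - (N/2) γ₁ (pq - 1)` (`false_of_volterra_iteration`,
`eventually_not_isMildSolution`). Each of the four cases gives `E > 0`, possibly after exchanging
the two equations.

From nonexistence to blow-up of the full limit. Truncating the powers makes the system a globally
Lipschitz Volterra equation with weakly singular kernel, solved by a contraction in an exponentially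
weighted norm; this yields local existence, uniqueness and continuation of bounded solutions. What
remains is to exclude that the norms stay bounded along some sequence of times tending to `Tmax`
while being unbounded. The equation has memory, so one cannot restart at such a time `t₀`. Instead
the contribution of the past to `u(t)` is compared with its contribution to `u(t₀)`: the kernel at
time `s + δ` is at most `C δ ^ (-ε)` times the kernel at time `s` plus a heat average of it
(`exists_fracK_add_le`), and heat averages do not raise sup norms by more than a constant. So the
past contributes at most a constant times `(t - t₀) ^ (-ε)`, and a continuity argument bounds the
solution on `(t₀, t₀ + d]` with `d` independent of `t₀` (`exists_singular_bootstrap`). Taking `t₀`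
within `d` of `Tmax` gives boundedness, hence continuation past `Tmax`, a contradiction.

All this rests on the Wright function, given only by its power series, being nonnegative with finite
moments. It is a scaling limit of the Taylor coefficients of `(1 - z)^{α-1} exp(-c (1 - z)^α)`,
whose signs and moments are found by algebra and an ODE in `c`. -/

noncomputable section

namespace FracDiffusion

/-! ### Coefficients of binomial series -/

/-- The coefficient of `z ^ n` in the binomial series of `(1 - z) ^ x`. -/
def binCoef (n : ℕ) (x : ℝ) : ℝ := ∏ j ∈ Finset.range n, ((j : ℝ) - x) / (j + 1)

lemma binCoef_zero_left (x : ℝ) : binCoef 0 x = 1 := by simp [binCoef]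

lemma binCoef_succ (n : ℕ) (x : ℝ) :
    binCoef (n + 1) x = binCoef n x * (((n : ℝ) - x) / (n + 1)) :=
  Finset.prod_range_succ _ _

lemma succ_mul_binCoef_succ (n : ℕ) (x : ℝ) :
    ((n : ℝ) + 1) * binCoef (n + 1) x = (n - x) * binCoef n x := by
  rw [binCoef_succ]
  have : (n : ℝ) + 1 ≠ 0 := by positivity
  field_simp

/-- Coefficient form of `d/dz (1 - z)^x = -x (1 - z)^{x-1}`; the preceding recursion is `(1 - z) f'
= -x f`. -/
lemma succ_mul_binCoef_succ' (n : ℕ) (x : ℝ) :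
    ((n : ℝ) + 1) * binCoef (n + 1) x = -x * binCoef n (x - 1) := by
  induction n with
  | zero => simp [binCoef]
  | succ n ih =>
    have h1 := succ_mul_binCoef_succ (n + 1) x
    have h2 := succ_mul_binCoef_succ n (x - 1)
    have h3 : (n : ℝ) + 1 ≠ 0 := by positivity
    push_cast at *
    rw [h1]
    apply mul_left_cancel₀ h3
    linear_combination ((n : ℝ) + 1 - x) * ih + x * h2

lemma binCoef_zero_right (n : ℕ) : binCoef n 0 = if n = 0 then 1 else 0 := by
  cases n with
  | zero => simp [binCoef]
  | succ n =>
    have := succ_mul_binCoef_succ' n 0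
    have h3 : (n : ℝ) + 1 ≠ 0 := by positivity
    simpa [h3] using this

/-- The Chu-Vandermonde identity. -/
lemma binCoef_add (n : ℕ) (x y : ℝ) : binCoef n (x + y) =
    ∑ ij ∈ Finset.HasAntidiagonal.antidiagonal n, binCoef ij.1 x * binCoef ij.2 y := by
  induction n with
  | zero => simp [binCoef]
  | succ n ih =>
    have h3 : (n : ℝ) + 1 ≠ 0 := by positivity
    apply mul_left_cancel₀ h3
    rw [succ_mul_binCoef_succ, ih]
    have e : ((n : ℝ) + 1) * ∑ ij ∈ Finset.HasAntidiagonal.antidiagonal (n + 1),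
        binCoef ij.1 x * binCoef ij.2 y =
        (∑ ij ∈ Finset.HasAntidiagonal.antidiagonal (n + 1), ((ij.1 : ℝ) * binCoef ij.1 x) * binCoef ij.2 y) +
        ∑ ij ∈ Finset.HasAntidiagonal.antidiagonal (n + 1), binCoef ij.1 x * ((ij.2 : ℝ) * binCoef ij.2 y) := by
      rw [Finset.mul_sum, ← Finset.sum_add_distrib]
      refine Finset.sum_congr rfl fun ij hij => ?_
      have : (ij.1 : ℝ) + ij.2 = n + 1 := by exact_mod_cast Finset.HasAntidiagonal.mem_antidiagonal.1 hij
      rw [← this]; ring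
    rw [e, Finset.Nat.sum_antidiagonal_succ, Finset.Nat.sum_antidiagonal_succ', Finset.mul_sum]
    simp only [Nat.cast_zero, zero_mul, mul_zero, zero_add, Nat.cast_add, Nat.cast_one,
      succ_mul_binCoef_succ]
    rw [← Finset.sum_add_distrib]
    refine Finset.sum_congr rfl fun ij hij => ?_
    have : (ij.1 : ℝ) + ij.2 = n := by exact_mod_cast Finset.HasAntidiagonal.mem_antidiagonal.1 hij
    rw [← this]; ring

lemma binCoef_nonneg (n : ℕ) {x : ℝ} (hx : x ≤ 0) : 0 ≤ binCoef n x :=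
  Finset.prod_nonneg fun j _ => div_nonneg (by have : (0 : ℝ) ≤ j := j.cast_nonneg; linarith)
    (by positivity)

lemma binCoef_succ_nonpos (n : ℕ) {x : ℝ} (hx : 0 ≤ x) (hx1 : x ≤ 1) :
    binCoef (n + 1) x ≤ 0 := by
  have h1 := succ_mul_binCoef_succ' n x
  have h2 := binCoef_nonneg n (x := x - 1) (by linarith)
  have h3 : 0 < (n : ℝ) + 1 := by positivity
  have h4 : -x * binCoef n (x - 1) ≤ 0 := mul_nonpos_of_nonpos_of_nonneg (by linarith) h2
  by_contra h
  push Not at h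
  have := mul_pos h3 h
  linarith

/-- Each factor is at most `1 + |x|`. The crude exponential in `|x|` serves to make `k ↦ binCoef n
(α k + b)` geometrically bounded, so that its exponential generating series is entire. -/
lemma abs_binCoef_le (n : ℕ) (x : ℝ) :
    |binCoef n x| ≤ n.factorial * Real.exp (1 + |x|) := by
  have h : |binCoef n x| ≤ (1 + |x|) ^ n := by
    rw [binCoef, Finset.abs_prod]
    refine (Finset.prod_le_prod (fun _ _ => abs_nonneg _)
      (g := fun _ => 1 + |x|) fun j _ => ?_).trans (by simp)
    have hj : (0 : ℝ) ≤ j := j.cast_nonneg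
    rw [abs_div, abs_of_pos (by positivity : (0 : ℝ) < j + 1), div_le_iff₀ (by positivity)]
    have := abs_sub (j : ℝ) x
    rw [abs_of_nonneg hj] at this
    nlinarith [abs_nonneg x, mul_nonneg (abs_nonneg x) hj]
  have h2 := Real.pow_div_factorial_le_exp (1 + |x|) (by positivity) n
  rw [div_le_iff₀ (by positivity)] at h2
  linarith

/-! ### Exponential generating series -/

/-- The exponential generating series `∑ k, β k * (-c) ^ k / k!`. -/
def expGen (β : ℕ → ℝ) (c : ℝ) : ℝ := ∑' k : ℕ, β k * ((-c) ^ k / k.factorial)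

/-- Sequences of at most geometric growth. -/
def GeomBdd (β : ℕ → ℝ) : Prop := ∃ C R : ℝ, 0 ≤ C ∧ 0 ≤ R ∧ ∀ k, |β k| ≤ C * R ^ k

lemma GeomBdd.shift {β : ℕ → ℝ} (h : GeomBdd β) : GeomBdd fun k => β (k + 1) := by
  obtain ⟨C, R, hC, hR, h⟩ := h
  refine ⟨C * R, R, by positivity, hR, fun k => (h _).trans (le_of_eq ?_)⟩
  ring

lemma GeomBdd.summable {β : ℕ → ℝ} (h : GeomBdd β) (c : ℝ) :
    Summable fun k : ℕ => β k * ((-c) ^ k / k.factorial) := by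
  obtain ⟨C, R, hC, hR, h⟩ := h
  refine Summable.of_norm_bounded ((Real.summable_pow_div_factorial (R * |c|)).mul_left C)
    fun k => ?_
  rw [Real.norm_eq_abs, abs_mul, abs_div, abs_pow, abs_neg, Nat.abs_cast, mul_pow]
  have := mul_le_mul_of_nonneg_right (h k) (by positivity : 0 ≤ |c| ^ k / (k.factorial : ℝ))
  refine this.trans (le_of_eq ?_)
  ring

lemma expGen_zero (β : ℕ → ℝ) : expGen β 0 = β 0 := by
  rw [expGen, tsum_eq_single 0]
  · simp
  · intro k hk; simp [hk]

lemma GeomBdd.hasDerivAt {β : ℕ → ℝ} (h : GeomBdd β) (c : ℝ) :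
    HasDerivAt (expGen β) (-expGen (fun k => β (k + 1)) c) c := by
  have hs := h.shift.summable c
  obtain ⟨C, R, hC, hR, hb⟩ := id h
  set K := |c| + 1 with hK
  have hK0 : 0 ≤ K := by positivity
  have key := hasDerivAt_tsum_of_isPreconnected (𝕜 := ℝ)
    (g := fun (k : ℕ) (c : ℝ) => β k * ((-c) ^ k / k.factorial))
    (g' := fun (k : ℕ) (c : ℝ) => β k * ((k * (-c) ^ (k - 1) * (-1)) / k.factorial))
    (u := fun k : ℕ => C * R ^ k * (k * K ^ (k - 1) / k.factorial))
    (t := Metric.ball (0 : ℝ) K) (y₀ := c) (y := c) ?_ Metric.isOpen_ball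
    (convex_ball _ _).isPreconnected ?_ ?_ ?_ (h.summable c) ?_
  · convert! key using 1
    rw [tsum_eq_zero_add', expGen, ← tsum_neg]
    · simp only [Nat.cast_zero, zero_mul, zero_div, mul_zero, zero_add]
      refine tsum_congr fun k => ?_
      rw [Nat.factorial_succ]
      push_cast
      have : (k : ℝ) + 1 ≠ 0 := by positivity
      have : (k.factorial : ℝ) ≠ 0 := by positivity
      try simp only [Nat.add_sub_cancel]
      field_simp
    · convert! hs.neg using 1
      ext k
      rw [Nat.factorial_succ]
      push_cast
      have : (k : ℝ) + 1 ≠ 0 := by positivity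
      have : (k.factorial : ℝ) ≠ 0 := by positivity
      try simp only [Nat.add_sub_cancel]
      field_simp
  · rw [← summable_nat_add_iff 1]
    convert! (Real.summable_pow_div_factorial (R * K)).mul_left (C * R) using 1
    ext k
    rw [Nat.factorial_succ]
    push_cast
    have : (k : ℝ) + 1 ≠ 0 := by positivity
    have : (k.factorial : ℝ) ≠ 0 := by positivity
    try simp only [Nat.add_sub_cancel]
    field_simp
    ring_nf
  · intro k y _
    have := (((hasDerivAt_id y).neg.pow k).div_const (k.factorial : ℝ)).const_mul (β k)
    simpa using this
  · intro k y hy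
    rw [Real.norm_eq_abs, abs_mul, abs_div, abs_mul, abs_mul, abs_pow, abs_neg, abs_neg, abs_one,
      mul_one, Nat.abs_cast, Nat.abs_cast]
    have hy' : |y| ≤ K := by simpa using (mem_ball_zero_iff.1 hy).le
    have := hb k
    gcongr
  · rw [mem_ball_zero_iff, Real.norm_eq_abs, hK]; linarith
  · rw [mem_ball_zero_iff, Real.norm_eq_abs, hK]; linarith

lemma expGen_sum {ι : Type*} (s : Finset ι) (a : ι → ℝ) (β : ι → ℕ → ℝ)
    (h : ∀ i ∈ s, GeomBdd (β i)) (c : ℝ) :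
    expGen (fun k => ∑ i ∈ s, a i * β i k) c = ∑ i ∈ s, a i * expGen (β i) c := by
  simp only [expGen, Finset.sum_mul, mul_assoc]
  rw [Summable.tsum_finsetSum fun i hi => ((h i hi).summable c).mul_left (a i)]
  simp only [tsum_mul_left]

lemma geomBdd_binCoef (n : ℕ) (α b : ℝ) : GeomBdd fun k => binCoef n (α * k + b) := by
  refine ⟨n.factorial * Real.exp (1 + |b|), Real.exp |α|, by positivity, by positivity,
    fun k => (abs_binCoef_le _ _).trans ?_⟩
  rw [mul_assoc, ← Real.exp_nat_mul, ← Real.exp_add]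
  refine mul_le_mul_of_nonneg_left (Real.exp_le_exp.2 ?_) (by positivity)
  have : |α * k + b| ≤ |α| * k + |b| := by
    simpa [abs_mul] using abs_add_le (α * k) b
  linarith

/-! ### Coefficients of `(1 - z)^b exp(-c (1 - z)^α)`: recursions, signs, moments -/

/-- The coefficient of `z ^ n` in `(1 - z) ^ b * exp (-c * (1 - z) ^ α)`. -/
def stabCoef (α b : ℝ) (n : ℕ) (c : ℝ) : ℝ := expGen (fun k => binCoef n (α * k + b)) c

/-- Differentiating the exponential in `c` multiplies the generating function by `-(1 - z)^α`. -/
lemma hasDerivAt_stabCoef (α b : ℝ) (n : ℕ) (c : ℝ) :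
    HasDerivAt (stabCoef α b n) (-stabCoef α (b + α) n c) c := by
  have := (geomBdd_binCoef n α b).hasDerivAt c
  convert! this using 2
  rw [stabCoef]
  congr 1
  ext k
  push_cast; ring_nf

lemma stabCoef_add (α b b' : ℝ) (n : ℕ) (c : ℝ) : stabCoef α (b' + b) n c =
    ∑ ij ∈ Finset.HasAntidiagonal.antidiagonal n, binCoef ij.1 b' * stabCoef α b ij.2 c := by
  simp only [stabCoef]
  refine Eq.trans ?_ (expGen_sum _ (fun ij => binCoef ij.1 b')
    (fun (ij : ℕ × ℕ) (k : ℕ) => binCoef ij.2 (α * k + b)) (fun i _ => geomBdd_binCoef _ _ _) c)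
  congr 1
  ext k
  rw [← binCoef_add]
  congr 1; ring

lemma continuous_stabCoef (α b : ℝ) (n : ℕ) : Continuous (stabCoef α b n) :=
  continuous_iff_continuousAt.2 fun c => (hasDerivAt_stabCoef α b n c).continuousAt

lemma stabCoef_zero (α : ℝ) (n : ℕ) : stabCoef α 0 n 0 = if n = 0 then 1 else 0 := by
  rw [stabCoef, expGen_zero]
  simp [binCoef_zero_right]

/-- Splitting off the leading term of the derivative formula. -/
lemma stabCoef_add_eq (α : ℝ) (n : ℕ) (c : ℝ) : stabCoef α (0 + α) n c =
    stabCoef α 0 n c + ∑ ij ∈ (Finset.HasAntidiagonal.antidiagonal n).erase (0, n),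
      binCoef ij.1 α * stabCoef α 0 ij.2 c := by
  rw [zero_add, ← add_zero α, stabCoef_add, add_zero, ← Finset.add_sum_erase _ _ (a := (0, n)),
    binCoef_zero_left, one_mul]
  simp

/-- Since `(1 - z)^α = 1 - (nonnegative coefficients)`, the `c`-derivative of the `n`-th coefficient
is minus itself plus nonnegative multiples of earlier ones. By strong induction `e^c` times the
coefficient is nondecreasing in `c`, starting from `0` or `1`. -/
lemma stabCoef_nonneg {α : ℝ} (hα : 0 < α) (hα1 : α < 1) (n : ℕ) {c : ℝ} (hc : 0 ≤ c) :
    0 ≤ stabCoef α 0 n c := by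
  induction n using Nat.strong_induction_on generalizing c with
  | _ n ih =>
  have hd : ∀ x, HasDerivAt (fun x => Real.exp x * stabCoef α 0 n x)
      (Real.exp x * stabCoef α 0 n x + Real.exp x * -stabCoef α (0 + α) n x) x := fun x =>
    (Real.hasDerivAt_exp x).mul (hasDerivAt_stabCoef α 0 n x)
  have hm : MonotoneOn (fun x => Real.exp x * stabCoef α 0 n x) (Ici 0) := by
    apply monotoneOn_of_deriv_nonneg (convex_Ici 0)
    · exact (Real.continuous_exp.mul (continuous_stabCoef α 0 n)).continuousOn
    · exact fun x _ => (hd x).differentiableAt.differentiableWithinAt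
    · intro x hx
      rw [interior_Ici] at hx
      rw [(hd x).deriv, stabCoef_add_eq, ← mul_add]
      apply mul_nonneg (Real.exp_pos _).le
      have : ∑ ij ∈ (Finset.HasAntidiagonal.antidiagonal n).erase (0, n),
          binCoef ij.1 α * stabCoef α 0 ij.2 x ≤ 0 := by
        apply Finset.sum_nonpos
        rintro ⟨i, j⟩ hij
        simp only [Finset.mem_erase, Finset.HasAntidiagonal.mem_antidiagonal, ne_eq, Prod.mk.injEq] at hij
        obtain ⟨i, rfl⟩ : ∃ k, i = k + 1 := Nat.exists_eq_succ_of_ne_zero (by omega)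
        exact mul_nonpos_of_nonpos_of_nonneg (binCoef_succ_nonpos i hα.le hα1.le)
          (ih j (by omega) (le_of_lt hx))
      linarith
  have h0 := hm (a := 0) (b := c) (by simp) hc hc
  simp only [Real.exp_zero, one_mul, stabCoef_zero] at h0
  have : 0 ≤ Real.exp c * stabCoef α 0 n c := le_trans (by split_ifs <;> norm_num) h0
  exact nonneg_of_mul_nonneg_right this (Real.exp_pos c)

lemma stabCoef_sub_one_nonneg {α : ℝ} (hα : 0 < α) (hα1 : α < 1) (n : ℕ) {c : ℝ} (hc : 0 ≤ c) :
    0 ≤ stabCoef α (α - 1) n c := by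
  rw [← add_zero (α - 1), stabCoef_add]
  exact Finset.sum_nonneg fun ij _ => mul_nonneg (binCoef_nonneg _ (by linarith))
    (stabCoef_nonneg hα hα1 _ hc)

/-- The `z`-derivative of `exp(-c (1 - z)^α)`. It trades the coefficients with exponent `α - 1`,
which approximate the Wright function, for those with exponent `0`, whose moments are accessible. -/
lemma succ_mul_stabCoef_succ (α : ℝ) (n : ℕ) (c : ℝ) :
    ((n : ℝ) + 1) * stabCoef α 0 (n + 1) c = α * c * stabCoef α (α - 1) n c := by
  simp only [stabCoef, expGen]
  rw [← tsum_mul_left, ← tsum_mul_left, tsum_eq_zero_add']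
  · have h0 : binCoef (n + 1) 0 = 0 := by simp [binCoef_zero_right]
    simp only [Nat.cast_zero, mul_zero, zero_add, h0, zero_mul]
    refine tsum_congr fun k => ?_
    have h1 := succ_mul_binCoef_succ' n (α * ((k + 1 : ℕ) : ℝ) + 0)
    rw [← mul_assoc, h1, Nat.factorial_succ]
    push_cast
    have : (k : ℝ) + 1 ≠ 0 := by positivity
    have : (k.factorial : ℝ) ≠ 0 := by positivity
    rw [show α * ((k : ℝ) + 1) + 0 - 1 = α * k + (α - 1) by ring]
    field_simp
    ring
  · rw [summable_nat_add_iff 1 (f := fun k : ℕ => ((n : ℝ) + 1) *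
      (binCoef (n + 1) (α * k + 0) * ((-c) ^ k / k.factorial)))]
    exact ((geomBdd_binCoef (n + 1) α 0).summable c).mul_left _

/-- If `(1 - z)^α D(z)` has nonnegative coefficients, so has `D`: solving for `D n`, all other terms
have the favourable sign. -/
lemma nonneg_of_binCoef_conv {α : ℝ} (hα : 0 < α) (hα1 : α < 1) {D : ℕ → ℝ}
    (hD : ∀ n, 0 ≤ ∑ ij ∈ Finset.HasAntidiagonal.antidiagonal n, binCoef ij.1 α * D ij.2) (n : ℕ) :
    0 ≤ D n := by
  induction n using Nat.strong_induction_on with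
  | _ n ih =>
  have h := hD n
  rw [← Finset.add_sum_erase _ _ (a := (0, n)) (by simp), binCoef_zero_left, one_mul] at h
  have : ∑ ij ∈ (Finset.HasAntidiagonal.antidiagonal n).erase (0, n),
      binCoef ij.1 α * D ij.2 ≤ 0 := by
    apply Finset.sum_nonpos
    rintro ⟨i, j⟩ hij
    simp only [Finset.mem_erase, Finset.HasAntidiagonal.mem_antidiagonal, ne_eq, Prod.mk.injEq] at hij
    obtain ⟨i, rfl⟩ : ∃ k, i = k + 1 := Nat.exists_eq_succ_of_ne_zero (by omega)
    exact mul_nonpos_of_nonpos_of_nonneg (binCoef_succ_nonpos i hα.le hα1.le) (ih j (by omega))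
  linarith

/-- Truncated form of `∫_0^∞ c^m exp(-c (1 - z)^α) dc = m! (1 - z)^{-(m+1)α}`, coefficient by
coefficient. Integration by parts lowers `m` at the cost of a factor `(1 - z)^α`, which
`nonneg_of_binCoef_conv` removes. -/
lemma integral_pow_mul_stabCoef_le {α : ℝ} (hα : 0 < α) (hα1 : α < 1) (m n : ℕ) {K : ℝ}
    (hK : 0 ≤ K) : ∫ c in (0 : ℝ)..K, c ^ m * stabCoef α 0 n c ≤
      m.factorial * binCoef n (-((m + 1) * α)) := by
  have hcont : ∀ m b n, Continuous fun c : ℝ => c ^ m * stabCoef α b n c := fun m b n =>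
    (continuous_pow m).mul (continuous_stabCoef α b n)
  have hint : ∀ m b n, IntervalIntegrable (fun c : ℝ => c ^ m * stabCoef α b n c) volume 0 K :=
    fun m b n => (hcont m b n).intervalIntegrable _ _
  -- Integrate the derivative of `c^m` times the coefficient over `[0, K]`. The boundary term at `K`
  -- is nonnegative and is dropped; the one at `0` survives only for `m = 0`.
  have step : ∀ (m n : ℕ), ∑ ij ∈ Finset.HasAntidiagonal.antidiagonal n,
      binCoef ij.1 α * ∫ c in (0 : ℝ)..K, c ^ m * stabCoef α 0 ij.2 c ≤
      (∫ c in (0 : ℝ)..K, (m * c ^ (m - 1)) * stabCoef α 0 n c) +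
        0 ^ m * stabCoef α 0 n 0 := by
    intro m n
    have hd : ∀ x, HasDerivAt (fun x : ℝ => x ^ m * stabCoef α 0 n x)
        (m * x ^ (m - 1) * stabCoef α 0 n x + x ^ m * -stabCoef α (0 + α) n x) x := fun x =>
      (hasDerivAt_pow m x).mul (hasDerivAt_stabCoef α 0 n x)
    have hi1 : IntervalIntegrable (fun x : ℝ => m * x ^ (m - 1) * stabCoef α 0 n x) volume 0 K := by
      apply Continuous.intervalIntegrable
      exact (continuous_const.mul (continuous_pow _)).mul (continuous_stabCoef α 0 n)
    have hi2 : IntervalIntegrable (fun x : ℝ => x ^ m * -stabCoef α (0 + α) n x) volume 0 K := by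
      apply Continuous.intervalIntegrable
      exact (continuous_pow _).mul (continuous_stabCoef α _ n).neg
    have := intervalIntegral.integral_eq_sub_of_hasDerivAt (fun x _ => hd x) (hi1.add hi2)
    rw [intervalIntegral.integral_add hi1 hi2] at this
    simp only [mul_neg, intervalIntegral.integral_neg] at this
    have e : ∫ c in (0 : ℝ)..K, c ^ m * stabCoef α (0 + α) n c =
        ∑ ij ∈ Finset.HasAntidiagonal.antidiagonal n,
          binCoef ij.1 α * ∫ c in (0 : ℝ)..K, c ^ m * stabCoef α 0 ij.2 c := by
      simp only [zero_add, ← intervalIntegral.integral_const_mul]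
      rw [← intervalIntegral.integral_finsetSum fun ij _ => (hint m 0 ij.2).const_mul _]
      refine intervalIntegral.integral_congr fun c _ => ?_
      rw [← add_zero α, stabCoef_add, add_zero, Finset.mul_sum]
      exact Finset.sum_congr rfl fun _ _ => by ring
    have h3 : 0 ≤ K ^ m * stabCoef α 0 n K :=
      mul_nonneg (pow_nonneg hK _) (stabCoef_nonneg hα hα1 n hK)
    linarith
  suffices ∀ n, 0 ≤ m.factorial * binCoef n (-((m + 1) * α)) -
      ∫ c in (0 : ℝ)..K, c ^ m * stabCoef α 0 n c by linarith [this n]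
  induction m with
  | zero =>
    apply nonneg_of_binCoef_conv hα hα1
    intro n
    have h := step 0 n
    simp only [mul_sub, Finset.sum_sub_distrib, Nat.factorial_zero, Nat.cast_one, one_mul,
      ← binCoef_add]
    simp only [Nat.cast_zero, zero_mul, intervalIntegral.integral_zero, zero_add, stabCoef_zero,
      pow_zero, one_mul] at h ⊢
    rw [add_neg_cancel, binCoef_zero_right]
    linarith
  | succ m ihm =>
    apply nonneg_of_binCoef_conv hα hα1
    intro n
    have h := step (m + 1) n
    have h2 := ihm n
    simp only [Nat.add_sub_cancel, mul_assoc, intervalIntegral.integral_const_mul, ne_eq,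
      Nat.add_eq_zero_iff, one_ne_zero, and_false, not_false_eq_true, zero_pow, zero_mul,
      add_zero] at h
    simp only [mul_sub, Finset.sum_sub_distrib, mul_left_comm _ (((m + 1).factorial : ℕ) : ℝ) _,
      ← Finset.mul_sum, ← binCoef_add]
    rw [show α + -((((m + 1 : ℕ) : ℝ) + 1) * α) = -((m + 1) * α) by push_cast; ring]
    rw [Nat.factorial_succ]
    push_cast at h ⊢
    have : 0 ≤ (m : ℝ) + 1 := by positivity
    nlinarith [mul_nonneg this h2]

/-! ### The Wright function as a limit of binomial generating coefficients -/

/-- A bound uniform in `n`, needed to pass to the limit under the Wright series. The factors are `1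
- y/(j+1)`; for `j ≥ m` they are at most `exp(-y/(j+1))`, and the harmonic sum in the exponent
compensates `n ^ y`. -/
lemma rpow_mul_abs_binCoef_le {y : ℝ} (hy : 0 < y) {m : ℕ} (hm : 1 ≤ m) (hym : y ≤ m) (n : ℕ) :
    (n : ℝ) ^ y * |binCoef n (y - 1)| ≤ Real.exp (2 * m) * (m : ℝ) ^ y := by
  have hm0 : (0 : ℝ) < m := by exact_mod_cast hm
  set h : ℕ → ℝ := fun n => ∑ j ∈ Finset.range n, ((j : ℝ) + 1)⁻¹ with hh
  have hharm : ∀ n, ((harmonic n : ℚ) : ℝ) = h n := fun n => by simp [harmonic, hh]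
  -- The first `m` factors may be negative and are only bounded by `m/(j+1)`; `β j` is the
  -- logarithmic excess of this over `exp(-y/(j+1))`. The excesses add up to at most `2 m + y log
  -- m`.
  set β : ℕ → ℝ := fun j => y * ((j : ℝ) + 1)⁻¹ + Real.log (m / (j + 1)) with hβ
  have hβ0 : ∀ j < m, 0 ≤ β j := by
    intro j hj
    have : (1 : ℝ) ≤ m / (j + 1) := by
      rw [one_le_div (by positivity)]; exact_mod_cast hj
    have := Real.log_nonneg this
    positivity
  have hfac : ∀ j : ℕ, |((j : ℝ) - (y - 1)) / (j + 1)| ≤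
      Real.exp (-(y * ((j : ℝ) + 1)⁻¹) + if j < m then β j else 0) := by
    intro j
    have hj : (0 : ℝ) < j + 1 := by positivity
    have e : ((j : ℝ) - (y - 1)) / (j + 1) = 1 - y * ((j : ℝ) + 1)⁻¹ := by field_simp; ring
    have hu : 0 < y * ((j : ℝ) + 1)⁻¹ := by positivity
    rw [e]
    split_ifs with hjm
    · have h1 : (1 : ℝ) ≤ m / (j + 1) := by
        rw [one_le_div (by positivity)]; exact_mod_cast hjm
      have h2 : y * ((j : ℝ) + 1)⁻¹ ≤ m / (j + 1) := by
        rw [div_eq_mul_inv]; gcongr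
      rw [hβ]
      simp only [neg_add_cancel_left]
      rw [Real.exp_log (by linarith), abs_le]
      constructor <;> linarith
    · have h1 : y * ((j : ℝ) + 1)⁻¹ ≤ 1 := by
        rw [← div_eq_mul_inv, div_le_one hj]
        push Not at hjm
        have : (m : ℝ) ≤ j := by exact_mod_cast hjm
        linarith
      rw [abs_of_nonneg (by linarith), add_zero]
      linarith [Real.add_one_le_exp (-(y * ((j : ℝ) + 1)⁻¹))]
  have hprod : |binCoef n (y - 1)| ≤
      Real.exp (-(y * h n) + ∑ j ∈ Finset.range m, β j) := by
    rw [binCoef, Finset.abs_prod]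
    refine (Finset.prod_le_prod (fun _ _ => abs_nonneg _) fun j _ => hfac j).trans ?_
    rw [← Real.exp_sum, Finset.sum_add_distrib, Finset.sum_neg_distrib, ← Finset.mul_sum]
    refine Real.exp_le_exp.2 (add_le_add_right ?_ _)
    rw [← Finset.sum_filter]
    refine Finset.sum_le_sum_of_subset_of_nonneg ?_ ?_
    · intro j hj; simpa using (Finset.mem_filter.1 hj).2
    · intro j hj _; exact hβ0 j (by simpa using hj)
  have hsum : Real.exp (∑ j ∈ Finset.range m, β j) ≤ Real.exp (2 * m) * (m : ℝ) ^ y := by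
    rw [hβ, Finset.sum_add_distrib, ← Finset.mul_sum, Real.exp_add, Real.exp_sum]
    have h1 : ∏ j ∈ Finset.range m, Real.exp (Real.log (m / ((j : ℝ) + 1))) ≤ Real.exp m := by
      have : ∏ j ∈ Finset.range m, Real.exp (Real.log (m / ((j : ℝ) + 1))) =
          (m : ℝ) ^ m / m.factorial := by
        rw [Finset.prod_congr rfl fun j _ => Real.exp_log (by positivity), Finset.prod_div_distrib]
        simp only [Finset.prod_const, Finset.card_range]
        congr 1
        rw [← Finset.prod_range_add_one_eq_factorial]
        push_cast; rfl
      rw [this]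
      exact Real.pow_div_factorial_le_exp _ hm0.le _
    have h2 : Real.exp (y * h m) ≤ Real.exp m * (m : ℝ) ^ y := by
      have h3 := harmonic_le_one_add_log m
      rw [hharm] at h3
      rw [Real.rpow_def_of_pos hm0, ← Real.exp_add]
      refine Real.exp_le_exp.2 ?_
      nlinarith
    calc _ ≤ (Real.exp m * (m : ℝ) ^ y) * Real.exp m := by gcongr
      _ = _ := by rw [two_mul, Real.exp_add]; ring
  have hn : (n : ℝ) ^ y ≤ Real.exp (y * h n) := by
    have h3 := log_add_one_le_harmonic n
    rw [hharm] at h3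
    calc (n : ℝ) ^ y ≤ ((n + 1 : ℕ) : ℝ) ^ y := by gcongr; simp
      _ = Real.exp (y * Real.log ((n + 1 : ℕ) : ℝ)) := by
          rw [Real.rpow_def_of_pos (by positivity), mul_comm]
      _ ≤ _ := by gcongr
  calc (n : ℝ) ^ y * |binCoef n (y - 1)| ≤
      Real.exp (y * h n) * Real.exp (-(y * h n) + ∑ j ∈ Finset.range m, β j) := by gcongr
    _ = Real.exp (∑ j ∈ Finset.range m, β j) := by rw [← Real.exp_add]; ring_nf
    _ ≤ _ := hsum

/-- Euler's limit for `Γ(1 - y)`, whose finite product is `(n+1)! binCoef (n+1) (y-1)`. At a pole of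
`Γ` the coefficients eventually vanish, in agreement with the convention that both `Γ` and its
inverse are `0` there. -/
lemma tendsto_rpow_mul_binCoef (y : ℝ) :
    Tendsto (fun n : ℕ => (n : ℝ) ^ y * binCoef n (y - 1)) atTop (𝓝 (Real.Gamma (1 - y))⁻¹) := by
  by_cases hΓ : Real.Gamma (1 - y) = 0
  · obtain ⟨k, hk⟩ := (Real.Gamma_eq_zero_iff _).1 hΓ
    rw [hΓ, inv_zero]
    refine tendsto_const_nhds.congr' ?_
    filter_upwards [eventually_gt_atTop k] with n hn
    have : binCoef n (y - 1) = 0 := by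
      rw [binCoef]
      apply Finset.prod_eq_zero (Finset.mem_range.2 hn)
      rw [show (k : ℝ) - (y - 1) = 0 by linarith, zero_div]
    rw [this, mul_zero]
  · have h1 := (Real.GammaSeq_tendsto_Gamma (1 - y)).inv₀ hΓ
    have h2 : Tendsto (fun n : ℕ => 1 + (1 - y) * (n : ℝ)⁻¹) atTop (𝓝 (1 + (1 - y) * 0)) :=
      (tendsto_inv_atTop_nhds_zero_nat.const_mul _).const_add _
    rw [mul_zero, add_zero] at h2
    have h3 := h1.div h2 one_ne_zero
    rw [div_one] at h3
    refine h3.congr' ?_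
    have h4 : ∀ᶠ n : ℕ in atTop, (0 : ℝ) < 1 + (1 - y) * (n : ℝ)⁻¹ :=
      h2.eventually (lt_mem_nhds one_pos)
    filter_upwards [h4, eventually_gt_atTop 0] with n hn hn0
    have hn0' : (0 : ℝ) < n := by exact_mod_cast hn0
    have e1 : ∏ j ∈ Finset.range (n + 1), (1 - y + j) =
        (n + 1).factorial * binCoef (n + 1) (y - 1) := by
      rw [binCoef, Finset.prod_div_distrib, ← Finset.prod_range_add_one_eq_factorial]
      push_cast
      rw [mul_div_cancel₀]
      · exact Finset.prod_congr rfl fun j _ => by ring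
      · exact Finset.prod_ne_zero_iff.2 fun j _ => by positivity
    have e2 := succ_mul_binCoef_succ n (y - 1)
    have hf : (n.factorial : ℝ) ≠ 0 := by positivity
    have e3 : (n : ℝ) ^ (1 - y) = n / (n : ℝ) ^ y := by rw [Real.rpow_sub hn0', Real.rpow_one]
    have e4 : (n : ℝ) ^ y ≠ 0 := (Real.rpow_pos_of_pos hn0' y).ne'
    simp only [Pi.div_apply]
    rw [Real.GammaSeq, e1, Nat.factorial_succ, inv_div, e3, div_eq_iff hn.ne']
    push_cast
    rw [show ((n : ℝ) + 1) * n.factorial * binCoef (n + 1) (y - 1) =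
      n.factorial * ((n - (y - 1)) * binCoef n (y - 1)) by rw [← e2]; ring]
    field_simp
    ring

/-- By `(k+1)! ≥ ((k+1)/e)^{k+1}` the terms are at most `(k+1) (e³ K' (k+1)^{α-1})^{k+1}`, and the
base tends to `0` because `α < 1`. -/
lemma summable_wright_bound {α : ℝ} (hα1 : α < 1) {K : ℝ} (hK : 0 ≤ K) :
    Summable fun k : ℕ => Real.exp (2 * ((k + 1 : ℕ) : ℝ)) *
      ((k + 1 : ℕ) : ℝ) ^ (α * ((k : ℝ) + 1)) * (K ^ k / k.factorial) := by
  set K' := max K 1 with hK'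
  have hK'1 : 1 ≤ K' := le_max_right _ _
  have hlim : Tendsto (fun k : ℕ => Real.exp 3 * K' * ((k + 1 : ℕ) : ℝ) ^ (α - 1)) atTop
      (𝓝 (Real.exp 3 * K' * 0)) := by
    apply Tendsto.const_mul
    have := (tendsto_rpow_neg_atTop (by linarith : 0 < 1 - α)).comp
      (tendsto_natCast_atTop_atTop.comp (tendsto_add_atTop_nat 1))
    simpa [Function.comp_def] using this
  rw [mul_zero] at hlim
  have hev := hlim.eventually (ge_mem_nhds (by norm_num : (0 : ℝ) < 1 / 2))
  have hsum : Summable fun k : ℕ => ((k + 1 : ℕ) : ℝ) ^ 1 * (1 / 2 : ℝ) ^ (k + 1) :=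
    (summable_nat_add_iff 1).2 (summable_pow_mul_geometric_of_norm_lt_one 1 (r := (1 / 2 : ℝ))
      (by norm_num))
  refine hsum.of_norm_bounded_eventually_nat ?_
  filter_upwards [hev] with k hk
  have hk0 : (0 : ℝ) < ((k + 1 : ℕ) : ℝ) := by positivity
  rw [Real.norm_of_nonneg (by positivity)]
  have h1 := Real.pow_div_factorial_le_exp ((k + 1 : ℕ) : ℝ) hk0.le (k + 1)
  have h2 : 1 / (k.factorial : ℝ) ≤ ((k + 1 : ℕ) : ℝ) *
      (Real.exp ((k + 1 : ℕ) : ℝ) / ((k + 1 : ℕ) : ℝ) ^ (k + 1)) := by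
    rw [Nat.factorial_succ, div_le_iff₀ (by positivity)] at h1
    rw [← mul_div_assoc, div_le_div_iff₀ (by positivity) (by positivity)]
    push_cast at h1 ⊢
    linarith
  have h3 : K ^ k ≤ K' ^ (k + 1) := by
    calc K ^ k ≤ K' ^ k := by gcongr; exact le_max_left _ _
      _ ≤ K' ^ (k + 1) := pow_le_pow_right₀ hK'1 (by omega)
  calc Real.exp (2 * ((k + 1 : ℕ) : ℝ)) * ((k + 1 : ℕ) : ℝ) ^ (α * ((k : ℝ) + 1)) *
        (K ^ k / k.factorial)
      = Real.exp (2 * ((k + 1 : ℕ) : ℝ)) * ((k + 1 : ℕ) : ℝ) ^ (α * ((k : ℝ) + 1)) *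
        K ^ k * (1 / k.factorial) := by ring
    _ ≤ Real.exp (2 * ((k + 1 : ℕ) : ℝ)) * ((k + 1 : ℕ) : ℝ) ^ (α * ((k : ℝ) + 1)) *
        K' ^ (k + 1) * (((k + 1 : ℕ) : ℝ) *
      (Real.exp ((k + 1 : ℕ) : ℝ) / ((k + 1 : ℕ) : ℝ) ^ (k + 1))) := by gcongr
    _ = ((k + 1 : ℕ) : ℝ) * (Real.exp 3 * K' * ((k + 1 : ℕ) : ℝ) ^ (α - 1)) ^ (k + 1) := by
        rw [mul_pow, mul_pow, ← Real.rpow_mul_natCast hk0.le, ← Real.exp_nat_mul]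
        rw [show (α - 1) * ((k + 1 : ℕ) : ℝ) = α * ((k : ℝ) + 1) - ((k + 1 : ℕ) : ℝ) by
          push_cast; ring, Real.rpow_sub hk0, Real.rpow_natCast,
          show ((k + 1 : ℕ) : ℝ) * 3 = 2 * ((k + 1 : ℕ) : ℝ) + ((k + 1 : ℕ) : ℝ) by ring,
          Real.exp_add]
        ring
    _ ≤ ((k + 1 : ℕ) : ℝ) ^ 1 * (1 / 2 : ℝ) ^ (k + 1) := by rw [pow_one]; gcongr

/-- The summable majorant in the series for the Wright function on `[-K, K]`. -/
def wrightBound (α K : ℝ) (k : ℕ) : ℝ := Real.exp (2 * ((k + 1 : ℕ) : ℝ)) *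
      ((k + 1 : ℕ) : ℝ) ^ (α * ((k : ℝ) + 1)) * (K ^ k / k.factorial)

lemma rpow_mul_stabCoef_eq (α : ℝ) {n : ℕ} (hn : 0 < n) (θ : ℝ) :
    (n : ℝ) ^ α * stabCoef α (α - 1) n (θ * (n : ℝ) ^ α) =
      ∑' k : ℕ, (n : ℝ) ^ (α * ((k : ℝ) + 1)) * binCoef n (α * ((k : ℝ) + 1) - 1) *
        ((-θ) ^ k / k.factorial) := by
  rw [stabCoef, expGen, ← tsum_mul_left]
  refine tsum_congr fun k => ?_
  have hn' : (0 : ℝ) < n := by exact_mod_cast hn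
  rw [mul_add α, mul_one, Real.rpow_add hn', Real.rpow_mul_natCast hn'.le, neg_mul_eq_neg_mul,
    mul_pow, add_sub_assoc]
  ring

lemma wright_term_le {α : ℝ} (hα : 0 < α) (hα1 : α < 1) {θ K : ℝ} (hθ : |θ| ≤ K) (n k : ℕ) :
    ‖(n : ℝ) ^ (α * ((k : ℝ) + 1)) * binCoef n (α * ((k : ℝ) + 1) - 1) *
        ((-θ) ^ k / k.factorial)‖ ≤ wrightBound α K k := by
  rw [norm_mul, norm_mul, norm_div, norm_pow, norm_neg, Real.norm_eq_abs, Real.norm_eq_abs,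
    Real.norm_eq_abs, Real.norm_natCast, abs_of_nonneg (Real.rpow_nonneg n.cast_nonneg _)]
  have h := rpow_mul_abs_binCoef_le (y := α * ((k : ℝ) + 1)) (by positivity) (m := k + 1)
    (by omega) (by push_cast; nlinarith [(by positivity : (0 : ℝ) < k + 1)]) n
  rw [wrightBound]
  gcongr

/-- The `n`-th approximation of the Wright function. -/
def wrightSeq (α : ℝ) (n : ℕ) (θ : ℝ) : ℝ :=
  (n : ℝ) ^ α * stabCoef α (α - 1) n (θ * (n : ℝ) ^ α)

lemma continuous_wrightSeq (α : ℝ) (n : ℕ) : Continuous (wrightSeq α n) :=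
  continuous_const.mul ((continuous_stabCoef α _ n).comp (continuous_id.mul continuous_const))

lemma norm_wrightSeq_le {α : ℝ} (hα : 0 < α) (hα1 : α < 1) {θ K : ℝ} (hθ : |θ| ≤ K) {n : ℕ}
    (hn : 0 < n) : ‖wrightSeq α n θ‖ ≤ ∑' k, wrightBound α K k := by
  rw [wrightSeq, rpow_mul_stabCoef_eq α hn]
  exact tsum_of_norm_bounded (summable_wright_bound hα1 ((abs_nonneg θ).trans hθ)).hasSum
    fun k => wright_term_le hα hα1 hθ n k

lemma tendsto_wright_term (α θ : ℝ) (k : ℕ) :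
    Tendsto (fun n : ℕ => (n : ℝ) ^ (α * ((k : ℝ) + 1)) * binCoef n (α * ((k : ℝ) + 1) - 1) *
        ((-θ) ^ k / k.factorial)) atTop
      (𝓝 ((-θ) ^ k / ((k.factorial : ℝ) * Real.Gamma (-α * k + 1 - α)))) := by
  have := (tendsto_rpow_mul_binCoef (α * ((k : ℝ) + 1))).mul_const ((-θ) ^ k / k.factorial)
  convert! this using 2
  rw [show 1 - α * ((k : ℝ) + 1) = -α * k + 1 - α by ring, div_mul_eq_div_div,
    div_eq_inv_mul _ (Real.Gamma _)]

/-- In the scaling `c = θ n^α` the `k`-th term carries `n^{α(k+1)} binCoef n (α(k+1) - 1)`, which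
tends to `1/Γ(1 - α - αk)`; `wrightBound` dominates. -/
lemma tendsto_wrightSeq {α : ℝ} (hα : 0 < α) (hα1 : α < 1) (θ : ℝ) :
    Tendsto (fun n => wrightSeq α n θ) atTop (𝓝 (wright α θ)) := by
  have h := tendsto_tsum_of_dominated_convergence (𝓕 := (atTop : Filter ℕ))
    (f := fun (n k : ℕ) => (n : ℝ) ^ (α * ((k : ℝ) + 1)) * binCoef n (α * ((k : ℝ) + 1) - 1) *
        ((-θ) ^ k / k.factorial))
    (g := fun k : ℕ => (-θ) ^ k / ((k.factorial : ℝ) * Real.Gamma (-α * k + 1 - α)))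
    (summable_wright_bound hα1 (abs_nonneg θ)) (fun k => tendsto_wright_term α θ k)
    (Eventually.of_forall fun n k => wright_term_le hα hα1 le_rfl n k)
  refine h.congr' ?_
  filter_upwards [eventually_gt_atTop 0] with n hn
  rw [wrightSeq, rpow_mul_stabCoef_eq α hn]

/-! ### Sign, continuity and moments of the Wright function -/

lemma wright_nonneg {α : ℝ} (hα : 0 < α) (hα1 : α < 1) {θ : ℝ} (hθ : 0 ≤ θ) :
    0 ≤ wright α θ :=
  ge_of_tendsto' (tendsto_wrightSeq hα hα1 θ) fun n => mul_nonneg (by positivity)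
    (stabCoef_sub_one_nonneg hα hα1 n (by positivity))

lemma continuous_wright {α : ℝ} (hα : 0 < α) (hα1 : α < 1) : Continuous (wright α) := by
  have hb : ∀ (K θ : ℝ), |θ| ≤ K → ∀ k : ℕ,
      ‖(-θ) ^ k / ((k.factorial : ℝ) * Real.Gamma (-α * k + 1 - α))‖ ≤ wrightBound α K k := by
    intro K θ hθ k
    exact le_of_tendsto' (tendsto_wright_term α θ k).norm
      fun n => wright_term_le hα hα1 hθ n k
  rw [continuous_iff_continuousAt]
  intro θ₀
  have : ContinuousOn (wright α) (Metric.ball 0 (|θ₀| + 1)) := by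
    refine continuousOn_tsum (u := wrightBound α (|θ₀| + 1)) (fun k => ?_)
      (summable_wright_bound hα1 (by positivity)) fun k θ hθ => ?_
    · exact ((continuous_neg.pow k).div_const _).continuousOn
    · exact hb _ _ (by simpa using (mem_ball_zero_iff.1 hθ).le) k
  refine this.continuousAt (Metric.isOpen_ball.mem_nhds ?_)
  rw [mem_ball_zero_iff, Real.norm_eq_abs]; linarith

lemma wright_zero_pos {α : ℝ} (hα1 : α < 1) : 0 < wright α 0 := by
  rw [wright, tsum_eq_single 0]
  · simp only [neg_zero, pow_zero, Nat.factorial_zero, Nat.cast_one, one_mul, Nat.cast_zero,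
      mul_zero, zero_add]
    have := Real.Gamma_pos_of_pos (by linarith : 0 < 1 - α)
    positivity
  · intro k hk; simp [hk]

lemma exists_wright_lower {α : ℝ} (hα : 0 < α) (hα1 : α < 1) :
    ∃ θ₀ c : ℝ, 0 < θ₀ ∧ 0 < c ∧ ∀ θ ∈ Icc 0 θ₀, c ≤ wright α θ := by
  have h := (continuous_wright hα hα1).continuousAt.eventually
    (lt_mem_nhds (half_lt_self (wright_zero_pos hα1)))
  obtain ⟨ε, hε, h⟩ := Metric.eventually_nhds_iff.1 h
  refine ⟨ε / 2, wright α 0 / 2, by positivity, half_pos (wright_zero_pos hα1), fun θ hθ => ?_⟩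
  refine (h ?_).le
  rw [Real.dist_0_eq_abs, abs_of_nonneg hθ.1]
  linarith [hθ.2]

/-- The moment bound for the coefficients passes to the limit after the substitution `c = θ n^α`. It
does not depend on `K`, so it yields integrability of `θ^{m+1} φ_α` on the half-line. -/
lemma integral_pow_mul_wright_le {α : ℝ} (hα : 0 < α) (hα1 : α < 1) (m : ℕ) {K : ℝ}
    (hK : 0 ≤ K) : ∫ θ in (0 : ℝ)..K, α * (θ ^ (m + 1) * wright α θ) ≤
      m.factorial * (Real.Gamma ((m + 1) * α))⁻¹ := by
  set y := ((m : ℝ) + 1) * α with hy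
  have hlim : Tendsto (fun n : ℕ => ∫ θ in (0 : ℝ)..K, α * (θ ^ (m + 1) * wrightSeq α n θ)) atTop
      (𝓝 (∫ θ in (0 : ℝ)..K, α * (θ ^ (m + 1) * wright α θ))) := by
    refine intervalIntegral.tendsto_integral_filter_of_dominated_convergence
      (fun _ => α * (K ^ (m + 1) * ∑' k, wrightBound α K k)) ?_ ?_ (by simp) ?_
    · exact Eventually.of_forall fun n => (continuous_const.mul ((continuous_pow _).mul
        (continuous_wrightSeq α n))).aestronglyMeasurable
    · filter_upwards [eventually_gt_atTop 0] with n hn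
      refine Eventually.of_forall fun θ hθ => ?_
      rw [uIoc_of_le hK] at hθ
      rw [norm_mul, norm_mul, Real.norm_of_nonneg hα.le, norm_pow, Real.norm_of_nonneg hθ.1.le]
      have h1 := norm_wrightSeq_le hα hα1 (K := K)
        (by rw [abs_of_nonneg hθ.1.le]; exact hθ.2) hn
      have := hθ.1.le
      have := hθ.2
      gcongr
    · exact Eventually.of_forall fun θ _ =>
        ((tendsto_wrightSeq hα hα1 θ).const_mul _).const_mul _
  -- The recursion raises the index to `n + 1` while the scaling stays at `n`; the factor `(1 +
  -- 1/n)^y → 1` accounts for the mismatch.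
  have hseq : Tendsto (fun n : ℕ => m.factorial * (((n + 1 : ℕ) : ℝ) ^ (1 - y) *
      binCoef (n + 1) (1 - y - 1)) * ((1 + (n : ℝ)⁻¹) ^ y)) atTop
      (𝓝 (m.factorial * (Real.Gamma (1 - (1 - y)))⁻¹ * (1 + 0) ^ y)) := by
    refine Tendsto.mul (Tendsto.const_mul _ ?_) ?_
    · exact (tendsto_rpow_mul_binCoef (1 - y)).comp (tendsto_add_atTop_nat 1)
    · exact (tendsto_inv_atTop_nhds_zero_nat.const_add 1).rpow_const (Or.inl (by norm_num))
  rw [add_zero, Real.one_rpow, mul_one, sub_sub_cancel] at hseq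
  refine le_of_tendsto_of_tendsto hlim hseq ?_
  filter_upwards [eventually_gt_atTop 0] with n hn
  have hn' : (0 : ℝ) < n := by exact_mod_cast hn
  have hna : (0 : ℝ) < (n : ℝ) ^ α := Real.rpow_pos_of_pos hn' α
  have e1 : ∀ θ : ℝ, α * (θ ^ (m + 1) * wrightSeq α n θ) =
      ((n : ℝ) + 1) / ((n : ℝ) ^ α) ^ m *
        ((θ * (n : ℝ) ^ α) ^ m * stabCoef α 0 (n + 1) (θ * (n : ℝ) ^ α)) := by
    intro θ
    have := succ_mul_stabCoef_succ α n (θ * (n : ℝ) ^ α)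
    rw [wrightSeq, mul_pow]
    generalize stabCoef α 0 (n + 1) (θ * (n : ℝ) ^ α) = A at this ⊢
    generalize stabCoef α (α - 1) n (θ * (n : ℝ) ^ α) = B at this ⊢
    field_simp
    linear_combination (-(θ ^ m)) * this
  simp only [e1]
  rw [intervalIntegral.integral_const_mul, intervalIntegral.integral_comp_mul_right
    (fun c => c ^ m * stabCoef α 0 (n + 1) c) hna.ne', zero_mul, smul_eq_mul]
  have h2 := integral_pow_mul_stabCoef_le hα hα1 m (n + 1) (K := K * (n : ℝ) ^ α) (by positivity)
  calc ((n : ℝ) + 1) / ((n : ℝ) ^ α) ^ m * (((n : ℝ) ^ α)⁻¹ *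
        ∫ c in (0 : ℝ)..K * (n : ℝ) ^ α, c ^ m * stabCoef α 0 (n + 1) c)
      ≤ ((n : ℝ) + 1) / ((n : ℝ) ^ α) ^ m * (((n : ℝ) ^ α)⁻¹ *
        (m.factorial * binCoef (n + 1) (-((m + 1) * α)))) := by gcongr
    _ = m.factorial * (((n + 1 : ℕ) : ℝ) ^ (1 - y) * binCoef (n + 1) (1 - y - 1)) *
        ((1 + (n : ℝ)⁻¹) ^ y) := by
      rw [show 1 - y - 1 = -((m + 1) * α) by rw [hy]; ring,
        show (1 : ℝ) + (n : ℝ)⁻¹ = ((n + 1 : ℕ) : ℝ) / n by push_cast; field_simp,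
        Real.div_rpow (by positivity) hn'.le, Real.rpow_sub (by positivity), Real.rpow_one]
      have e3 : (n : ℝ) ^ y = ((n : ℝ) ^ α) ^ m * (n : ℝ) ^ α := by
        rw [← pow_succ, ← Real.rpow_mul_natCast hn'.le, hy]
        push_cast; ring_nf
      have : ((n + 1 : ℕ) : ℝ) ^ y ≠ 0 := (Real.rpow_pos_of_pos (by positivity) _).ne'
      rw [e3]
      push_cast at this ⊢
      field_simp

lemma integrableOn_pow_mul_wright {α : ℝ} (hα : 0 < α) (hα1 : α < 1) (m : ℕ) :
    IntegrableOn (fun θ => θ ^ m * wright α θ) (Ioi 0) := by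
  have hpos : ∀ m, IntegrableOn (fun θ => θ ^ (m + 1) * wright α θ) (Ioi 0) := by
    intro m
    have hc : Continuous fun θ => θ ^ (m + 1) * wright α θ :=
      (continuous_pow _).mul (continuous_wright hα hα1)
    refine integrableOn_Ioi_of_intervalIntegral_norm_bounded
      (m.factorial * (Real.Gamma ((m + 1) * α))⁻¹ / α) 0 (l := atTop) (b := fun n : ℕ => (n : ℝ))
      (fun n => (hc.integrableOn_Icc).mono_set Ioc_subset_Icc_self)
      tendsto_natCast_atTop_atTop (Eventually.of_forall fun n => ?_)
    have h := integral_pow_mul_wright_le hα hα1 m (K := n) (by positivity)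
    rw [intervalIntegral.integral_const_mul] at h
    rw [le_div_iff₀ hα, mul_comm]
    refine le_trans (le_of_eq ?_) h
    congr 1
    refine intervalIntegral.integral_congr fun θ hθ => ?_
    rw [uIcc_of_le (by positivity)] at hθ
    exact Real.norm_of_nonneg (mul_nonneg (pow_nonneg hθ.1 _) (wright_nonneg hα hα1 hθ.1))
  cases m with
  | succ m => exact hpos m
  | zero =>
    have hc : Continuous fun θ => θ ^ 0 * wright α θ :=
      (continuous_pow _).mul (continuous_wright hα hα1)
    -- The moment bounds start at exponent one; for exponent zero use continuity on `(0, 1]` and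
    -- `φ_α ≤ θ φ_α` beyond.
    rw [← Ioc_union_Ioi_eq_Ioi zero_le_one]
    refine ((hc.integrableOn_Icc).mono_set Ioc_subset_Icc_self).union ?_
    refine Integrable.mono' ((hpos 0).mono_set (Ioi_subset_Ioi zero_le_one))
      hc.aestronglyMeasurable ?_
    refine (ae_restrict_iff' measurableSet_Ioi).2 (Eventually.of_forall fun θ hθ => ?_)
    have hθ' : (1 : ℝ) < θ := hθ
    have := wright_nonneg hα hα1 (by linarith : 0 ≤ θ)
    rw [Real.norm_of_nonneg (by positivity), pow_zero, one_mul, zero_add, pow_one]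
    nlinarith

section

/-! ### The heat semigroup on `C₀` -/

variable {N : ℕ}

lemma abs_apply_le_norm (w : C₀(EuclideanSpace ℝ (Fin N), ℝ)) (x : EuclideanSpace ℝ (Fin N)) :
    |w x| ≤ ‖w‖ :=
  BoundedContinuousFunction.norm_coe_le_norm w.toBCF x

lemma norm_le_of_forall_abs_le {w : C₀(EuclideanSpace ℝ (Fin N), ℝ)} {C : ℝ} (hC : 0 ≤ C)
    (h : ∀ x, |w x| ≤ C) : ‖w‖ ≤ C :=
  (BoundedContinuousFunction.norm_le (f := w.toBCF) hC).2 h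

/-- Evaluation at a point, as a continuous linear functional on `C₀`. -/
def evalCLM (x : EuclideanSpace ℝ (Fin N)) : C₀(EuclideanSpace ℝ (Fin N), ℝ) →L[ℝ] ℝ :=
  LinearMap.mkContinuous
    { toFun := fun w => w x
      map_add' := fun _ _ => rfl
      map_smul' := fun _ _ => rfl } 1 fun w => by simpa using abs_apply_le_norm w x

@[simp] lemma evalCLM_apply (x : EuclideanSpace ℝ (Fin N))
    (w : C₀(EuclideanSpace ℝ (Fin N), ℝ)) : evalCLM x w = w x := rfl

lemma integral_apply_eq {Ω : Type*} [MeasurableSpace Ω] {μ : Measure Ω}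
    {F : Ω → C₀(EuclideanSpace ℝ (Fin N), ℝ)} (hF : Integrable F μ)
    (x : EuclideanSpace ℝ (Fin N)) : (∫ ω, F ω ∂μ) x = ∫ ω, F ω x ∂μ :=
  ((evalCLM x).integral_comp_comm hF).symm

lemma heatKernel_nonneg {t : ℝ} (ht : 0 < t) (x : EuclideanSpace ℝ (Fin N)) :
    0 ≤ heatKernel t x := by
  unfold heatKernel; positivity

lemma heatKernel_pos {t : ℝ} (ht : 0 < t) (x : EuclideanSpace ℝ (Fin N)) :
    0 < heatKernel t x := by
  unfold heatKernel; positivity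

lemma continuous_heatKernel (t : ℝ) :
    Continuous (heatKernel t : EuclideanSpace ℝ (Fin N) → ℝ) := by
  unfold heatKernel; fun_prop

lemma integral_heatKernel {t : ℝ} (ht : 0 < t) :
    ∫ x : EuclideanSpace ℝ (Fin N), heatKernel t x = 1 := by
  unfold heatKernel
  rw [integral_const_mul]
  have := GaussianFourier.integral_rexp_neg_mul_sq_norm (V := EuclideanSpace ℝ (Fin N))
    (b := (4 * t)⁻¹) (by positivity)
  have e : ∀ x : EuclideanSpace ℝ (Fin N), -‖x‖ ^ 2 / (4 * t) = -(4 * t)⁻¹ * ‖x‖ ^ 2 :=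
    fun x => by ring
  simp only [e, this, finrank_euclideanSpace, Fintype.card_fin]
  rw [show Real.pi / (4 * t)⁻¹ = 4 * Real.pi * t by field_simp, one_div, inv_mul_cancel₀]
  positivity

lemma integrable_heatKernel {t : ℝ} (ht : 0 < t) :
    Integrable (heatKernel t : EuclideanSpace ℝ (Fin N) → ℝ) := by
  -- A nonintegrable function would have integral `0` by convention, not `1`.
  by_contra h
  have := integral_heatKernel (N := N) ht
  rw [integral_undef h] at this
  exact zero_ne_one this

lemma heatKernel_smul_sqrt {t : ℝ} (ht : 0 < t) (z : EuclideanSpace ℝ (Fin N)) :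
    heatKernel t (√t • z) = (√t ^ N)⁻¹ * heatKernel 1 z := by
  unfold heatKernel
  have h1 : (4 * Real.pi * t) ^ ((N : ℝ) / 2) = (4 * Real.pi * 1) ^ ((N : ℝ) / 2) * √t ^ N := by
    rw [Real.mul_rpow (by positivity) ht.le, mul_one, Real.sqrt_eq_rpow,
      ← Real.rpow_mul_natCast ht.le]
    ring_nf
  have h2 : ‖√t • z‖ ^ 2 = t * ‖z‖ ^ 2 := by
    rw [norm_smul, mul_pow, Real.norm_of_nonneg (Real.sqrt_nonneg t), Real.sq_sqrt ht.le]
  rw [h1, h2, show -(t * ‖z‖ ^ 2) / (4 * t) = -‖z‖ ^ 2 / (4 * 1) by field_simp]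
  field_simp

/-- The Gaussian measure with density the heat kernel at time `1`. -/
def gaussMeasure (N : ℕ) : Measure (EuclideanSpace ℝ (Fin N)) :=
  volume.withDensity fun z => ENNReal.ofReal (heatKernel 1 z)

lemma integral_gaussMeasure {F : Type*} [NormedAddCommGroup F] [NormedSpace ℝ F]
    (f : EuclideanSpace ℝ (Fin N) → F) :
    ∫ z, f z ∂gaussMeasure N = ∫ z, heatKernel 1 z • f z := by
  rw [gaussMeasure, integral_withDensity_eq_integral_toReal_smul
    (continuous_heatKernel 1).measurable.ennreal_ofReal (by simp)]
  simp only [ENNReal.toReal_ofReal (heatKernel_nonneg one_pos _)]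

instance : IsProbabilityMeasure (gaussMeasure N) where
  measure_univ := by
    rw [gaussMeasure, withDensity_apply _ MeasurableSet.univ, Measure.restrict_univ,
      ← ofReal_integral_eq_lintegral_ofReal (integrable_heatKernel one_pos)
        (Eventually.of_forall fun z => heatKernel_nonneg one_pos z),
      integral_heatKernel one_pos, ENNReal.ofReal_one]

/-- Rescaling turns the convolution into an average of translates against one fixed probability
measure. Contractivity, continuity in `t`, positivity and Jensen can be read off, and `t ≤ 0` is
included because then `√t = 0`. -/
lemma heat_eq_integral_gaussMeasure (t : ℝ) (w : EuclideanSpace ℝ (Fin N) → ℝ)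
    (x : EuclideanSpace ℝ (Fin N)) : heat t w x = ∫ z, w (x - √t • z) ∂gaussMeasure N := by
  unfold heat
  split_ifs with ht
  · rw [integral_gaussMeasure]
    have h1 := integral_sub_left_eq_self (fun y => heatKernel t y * w (x - y)) volume x
    simp only [sub_sub_cancel] at h1
    have h2 := Measure.integral_comp_smul (volume : Measure (EuclideanSpace ℝ (Fin N)))
      (fun y => heatKernel t y * w (x - y)) (√t)
    have hs : 0 < √t ^ N := by positivity
    simp only [heatKernel_smul_sqrt ht, finrank_euclideanSpace, Fintype.card_fin, smul_eq_mul,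
      abs_of_pos (inv_pos.2 hs), mul_assoc, integral_const_mul] at h2
    rw [h1]
    exact (mul_left_cancel₀ (inv_pos.2 hs).ne' h2).symm
  · rw [Real.sqrt_eq_zero'.2 (not_lt.1 ht)]
    simp

/-- Translation on `C₀`. -/
def transl (y : EuclideanSpace ℝ (Fin N)) (w : C₀(EuclideanSpace ℝ (Fin N), ℝ)) :
    C₀(EuclideanSpace ℝ (Fin N), ℝ) where
  toFun x := w (x - y)
  continuous_toFun := w.continuous.comp (continuous_id.sub continuous_const)
  zero_at_infty' := (zero_at_infty w).comp
    (Homeomorph.subRight y).isClosedEmbedding.tendsto_cocompact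

lemma norm_transl_le (y : EuclideanSpace ℝ (Fin N)) (w : C₀(EuclideanSpace ℝ (Fin N), ℝ)) :
    ‖transl y w‖ ≤ ‖w‖ :=
  norm_le_of_forall_abs_le (norm_nonneg w) fun x => abs_apply_le_norm w (x - y)

lemma continuous_transl (w : C₀(EuclideanSpace ℝ (Fin N), ℝ)) :
    Continuous fun y => transl y w := by
  rw [Metric.continuous_iff]
  intro y ε hε
  obtain ⟨δ, hδ, h⟩ := Metric.uniformContinuous_iff.1 (ZeroAtInftyContinuousMap.uniformContinuous w)
    (ε / 2) (half_pos hε)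
  refine ⟨δ, hδ, fun z hz => ?_⟩
  rw [dist_eq_norm]
  refine lt_of_le_of_lt (norm_le_of_forall_abs_le (half_pos hε).le fun x => ?_) (half_lt_self hε)
  have : dist (x - z) (x - y) < δ := by rwa [dist_sub_left]
  exact (h this).le

lemma integrable_transl (s : ℝ) (w : C₀(EuclideanSpace ℝ (Fin N), ℝ)) :
    Integrable (fun z => transl (s • z) w) (gaussMeasure N) :=
  Integrable.of_bound ((continuous_transl w).comp
    (continuous_const_smul s)).aestronglyMeasurable ‖w‖
    (Eventually.of_forall fun _ => norm_transl_le _ w)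

/-- The heat semigroup as bounded operators on `C₀`. -/
def heatOp (s : ℝ) : C₀(EuclideanSpace ℝ (Fin N), ℝ) →L[ℝ] C₀(EuclideanSpace ℝ (Fin N), ℝ) :=
  LinearMap.mkContinuous
    { toFun := fun w => ∫ z, transl (√s • z) w ∂gaussMeasure N
      map_add' := fun w w' => integral_add (integrable_transl _ w) (integrable_transl _ w')
      map_smul' := fun c w => integral_smul c fun z => transl (√s • z) w } 1 fun w => by
    refine (norm_integral_le_of_norm_le_const (Eventually.of_forall fun z =>
      norm_transl_le (√s • z) w)).trans (by simp)

lemma heatOp_def (s : ℝ) (w : C₀(EuclideanSpace ℝ (Fin N), ℝ)) :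
    heatOp s w = ∫ z, transl (√s • z) w ∂gaussMeasure N := rfl

lemma heatOp_apply (s : ℝ) (w : C₀(EuclideanSpace ℝ (Fin N), ℝ))
    (x : EuclideanSpace ℝ (Fin N)) : heatOp s w x = heat s w x := by
  rw [heatOp_def, integral_apply_eq (integrable_transl _ w), heat_eq_integral_gaussMeasure]
  rfl

lemma norm_heatOp_le (s : ℝ) (w : C₀(EuclideanSpace ℝ (Fin N), ℝ)) : ‖heatOp s w‖ ≤ ‖w‖ := by
  refine (norm_integral_le_of_norm_le_const (Eventually.of_forall fun z =>
      norm_transl_le (√s • z) w)).trans (by simp)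

lemma continuous_heatOp (w : C₀(EuclideanSpace ℝ (Fin N), ℝ)) :
    Continuous fun s => heatOp s w := by
  simp only [heatOp_def]
  refine continuous_of_dominated (bound := fun _ => ‖w‖)
    (fun s => (integrable_transl _ w).aestronglyMeasurable)
    (fun s => Eventually.of_forall fun z => norm_transl_le _ w) (integrable_const _)
    (Eventually.of_forall fun z => (continuous_transl w).comp
      (Real.continuous_sqrt.smul continuous_const))

lemma heatOp_nonneg (s : ℝ) {w : C₀(EuclideanSpace ℝ (Fin N), ℝ)} (hw : ∀ x, 0 ≤ w x)
    (x : EuclideanSpace ℝ (Fin N)) : 0 ≤ heatOp s w x := by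
  rw [heatOp_apply, heat_eq_integral_gaussMeasure]
  exact integral_nonneg fun z => hw _

lemma heatOp_zero (w : C₀(EuclideanSpace ℝ (Fin N), ℝ)) : heatOp 0 w = w := by
  ext x; rw [heatOp_apply, heat, if_neg (lt_irrefl _)]

lemma heatOp_apply_of_pos {s : ℝ} (hs : 0 < s) (w : C₀(EuclideanSpace ℝ (Fin N), ℝ))
    (x : EuclideanSpace ℝ (Fin N)) : heatOp s w x = ∫ y, heatKernel s (x - y) * w y := by
  rw [heatOp_apply, heat, if_pos hs]

lemma integrable_heatKernel_mul {s : ℝ} (hs : 0 < s) (w : C₀(EuclideanSpace ℝ (Fin N), ℝ))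
    (x : EuclideanSpace ℝ (Fin N)) : Integrable fun y => heatKernel s (x - y) * w y := by
  refine ((integrable_heatKernel hs).comp_sub_left x).mul_bdd (c := ‖w‖)
    w.continuous.aestronglyMeasurable (Eventually.of_forall fun y => abs_apply_le_norm w y)

/-- Completing the square in `y`; integrating out `y` gives the semigroup law. -/
lemma heatKernel_mul_heatKernel {s t : ℝ} (hs : 0 < s) (ht : 0 < t)
    (x y : EuclideanSpace ℝ (Fin N)) : heatKernel s (x - y) * heatKernel t y =
      heatKernel (s + t) x * heatKernel (s * t / (s + t)) (y - (t / (s + t)) • x) := by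
  unfold heatKernel
  have h1 : (4 * Real.pi * s) ^ ((N : ℝ) / 2) * (4 * Real.pi * t) ^ ((N : ℝ) / 2) =
      (4 * Real.pi * (s + t)) ^ ((N : ℝ) / 2) *
        (4 * Real.pi * (s * t / (s + t))) ^ ((N : ℝ) / 2) := by
    rw [← Real.mul_rpow (by positivity) (by positivity),
      ← Real.mul_rpow (by positivity) (by positivity)]
    congr 1; field_simp
  have h2 : -‖x - y‖ ^ 2 / (4 * s) + -‖y‖ ^ 2 / (4 * t) = -‖x‖ ^ 2 / (4 * (s + t)) +
      -‖y - (t / (s + t)) • x‖ ^ 2 / (4 * (s * t / (s + t))) := by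
    rw [norm_sub_sq_real, norm_sub_sq_real, inner_smul_right, norm_smul, real_inner_comm y x,
      Real.norm_of_nonneg (by positivity)]
    field_simp
    ring
  rw [mul_mul_mul_comm, ← Real.exp_add, h2, Real.exp_add, mul_mul_mul_comm (1 / _) _ (1 / _),
    div_mul_div_comm, div_mul_div_comm, h1]

lemma integral_heatKernel_mul_heatKernel {s t : ℝ} (hs : 0 < s) (ht : 0 < t)
    (x y : EuclideanSpace ℝ (Fin N)) :
    ∫ z, heatKernel s (x - z) * heatKernel t (z - y) = heatKernel (s + t) (x - y) := by
  have h := integral_add_right_eq_self (μ := volume)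
    (fun z => heatKernel s (x - z) * heatKernel t (z - y)) y
  rw [← h]
  have e : ∀ z, heatKernel s (x - (z + y)) * heatKernel t (z + y - y) =
      heatKernel (s + t) (x - y) * heatKernel (s * t / (s + t)) (z - (t / (s + t)) • (x - y)) := by
    intro z
    rw [add_sub_cancel_right, show x - (z + y) = (x - y) - z by abel,
      heatKernel_mul_heatKernel hs ht]
  simp only [e]
  rw [integral_const_mul, integral_sub_right_eq_self (fun z => heatKernel (s * t / (s + t)) z),
    integral_heatKernel (by positivity), mul_one]

lemma heatOp_add {s t : ℝ} (hs : 0 ≤ s) (ht : 0 ≤ t) (w : C₀(EuclideanSpace ℝ (Fin N), ℝ)) :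
    heatOp s (heatOp t w) = heatOp (s + t) w := by
  rcases hs.eq_or_lt with rfl | hs
  · rw [heatOp_zero, zero_add]
  rcases ht.eq_or_lt with rfl | ht
  · rw [heatOp_zero, add_zero]
  ext x
  rw [heatOp_apply_of_pos hs, heatOp_apply_of_pos (by positivity)]
  simp only [heatOp_apply_of_pos ht, ← integral_const_mul]
  rw [integral_integral_swap]
  · refine integral_congr_ae (Eventually.of_forall fun y => ?_)
    simp only [← mul_assoc, integral_mul_const, integral_heatKernel_mul_heatKernel hs ht]
  · have hm : AEStronglyMeasurable (Function.uncurry fun z y : EuclideanSpace ℝ (Fin N) =>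
        heatKernel s (x - z) * (heatKernel t (z - y) * w y)) (volume.prod volume) := by
      apply Continuous.aestronglyMeasurable
      have h1 := continuous_heatKernel (N := N) s
      have h2 := continuous_heatKernel (N := N) t
      have h3 := w.continuous
      simp only [Function.uncurry_def]
      fun_prop
    have hb : Integrable (Function.uncurry fun z y : EuclideanSpace ℝ (Fin N) =>
        heatKernel s (x - z) * heatKernel t (z - y)) (volume.prod volume) := by
      refine (integrable_prod_iff ?_).2 ⟨Eventually.of_forall fun z => ?_, ?_⟩
      · apply Continuous.aestronglyMeasurable
        have h1 := continuous_heatKernel (N := N) s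
        have h2 := continuous_heatKernel (N := N) t
        simp only [Function.uncurry_def]
        fun_prop
      · exact ((integrable_heatKernel ht).comp_sub_left z).const_mul (heatKernel s (x - z))
      · simp only [Function.uncurry_apply_pair, norm_mul,
          Real.norm_of_nonneg (heatKernel_nonneg hs _), Real.norm_of_nonneg (heatKernel_nonneg ht _),
          integral_const_mul]
        simp only [integral_sub_left_eq_self (fun y => heatKernel t y), integral_heatKernel ht,
          mul_one]
        exact (integrable_heatKernel hs).comp_sub_left x
    refine (hb.mul_const ‖w‖).mono' hm (Eventually.of_forall fun p => ?_)
    simp only [Function.uncurry_def, norm_mul, ← mul_assoc,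
      Real.norm_of_nonneg (heatKernel_nonneg hs _), Real.norm_of_nonneg (heatKernel_nonneg ht _)]
    exact mul_le_mul_of_nonneg_left (abs_apply_le_norm w _)
      (mul_nonneg (heatKernel_nonneg hs _) (heatKernel_nonneg ht _))

/-- The Gaussian exponent improves with time, so only the normalising factors compete. This is the
sole comparison between different diffusion times, used both for nonexistence and for the history
estimate. -/
lemma heatKernel_le_heatKernel {a b : ℝ} (ha : 0 < a) (hab : a ≤ b)
    (x : EuclideanSpace ℝ (Fin N)) :
    (a / b) ^ ((N : ℝ) / 2) * heatKernel a x ≤ heatKernel b x := by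
  have hb : 0 < b := ha.trans_le hab
  unfold heatKernel
  have h1 : (a / b) ^ ((N : ℝ) / 2) * (1 / (4 * Real.pi * a) ^ ((N : ℝ) / 2)) =
      1 / (4 * Real.pi * b) ^ ((N : ℝ) / 2) := by
    rw [← Real.one_rpow ((N : ℝ) / 2), ← Real.div_rpow (by positivity) (by positivity),
      ← Real.div_rpow (by positivity) (by positivity),
      ← Real.mul_rpow (by positivity) (by positivity)]
    congr 1; field_simp
  rw [← mul_assoc, h1]
  refine mul_le_mul_of_nonneg_left (Real.exp_le_exp.2 ?_) (by positivity)
  rw [neg_div, neg_div, neg_le_neg_iff]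
  gcongr

lemma heatOp_le_heatOp {a b : ℝ} (ha : 0 < a) (hab : a ≤ b)
    {w : C₀(EuclideanSpace ℝ (Fin N), ℝ)} (hw : ∀ x, 0 ≤ w x) (x : EuclideanSpace ℝ (Fin N)) :
    (a / b) ^ ((N : ℝ) / 2) * heatOp a w x ≤ heatOp b w x := by
  rw [heatOp_apply_of_pos ha, heatOp_apply_of_pos (ha.trans_le hab), ← integral_const_mul]
  refine integral_mono ((integrable_heatKernel_mul ha w x).const_mul _)
    (integrable_heatKernel_mul (ha.trans_le hab) w x) fun y => ?_
  simp only [← mul_assoc]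
  exact mul_le_mul_of_nonneg_right (heatKernel_le_heatKernel ha hab _) (hw y)

lemma heatOp_pos {a : ℝ} (ha : 0 < a) {w : C₀(EuclideanSpace ℝ (Fin N), ℝ)}
    (hw : ∀ x, 0 ≤ w x) (hw0 : ∃ x, w x ≠ 0) (x : EuclideanSpace ℝ (Fin N)) :
    0 < heatOp a w x := by
  obtain ⟨y, hy⟩ := hw0
  rw [heatOp_apply_of_pos ha]
  have hc : Continuous fun y => heatKernel a (x - y) * w y :=
    ((continuous_heatKernel a).comp (continuous_const.sub continuous_id)).mul w.continuous
  exact integral_pos_of_integrable_nonneg_nonzero hc (integrable_heatKernel_mul ha w x)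
    (fun y => mul_nonneg (heatKernel_nonneg ha _) (hw y))
    (mul_ne_zero (heatKernel_pos ha (x - y)).ne' hy)

end

section

/-! ### Averages of the heat semigroup -/

variable {N : ℕ}

lemma integrable_smul_heatOp {ω : ℝ → ℝ} (hω : IntegrableOn ω (Ioi 0)) (c : ℝ)
    (w : C₀(EuclideanSpace ℝ (Fin N), ℝ)) :
    Integrable (fun θ => ω θ • heatOp (c * θ) w) (volume.restrict (Ioi 0)) := by
  refine (hω.norm.mul_const ‖w‖).mono' (hω.aestronglyMeasurable.smul
    ((continuous_heatOp w).comp (continuous_const_mul c)).aestronglyMeasurable)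
    (Eventually.of_forall fun θ => ?_)
  rw [norm_smul]
  exact mul_le_mul_of_nonneg_left (norm_heatOp_le _ _) (norm_nonneg _)

/-- The operator `∫_0^∞ ω(θ) e^{cθΔ} dθ` on `C₀`. -/
def heatAvg (ω : ℝ → ℝ) (hω : IntegrableOn ω (Ioi 0)) (c : ℝ) :
    C₀(EuclideanSpace ℝ (Fin N), ℝ) →L[ℝ] C₀(EuclideanSpace ℝ (Fin N), ℝ) :=
  LinearMap.mkContinuous
    { toFun := fun w => ∫ θ in Ioi (0 : ℝ), ω θ • heatOp (c * θ) w
      map_add' := fun w w' => by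
        refine Eq.trans ?_
          (integral_add (integrable_smul_heatOp hω c w) (integrable_smul_heatOp hω c w'))
        refine integral_congr_ae (Eventually.of_forall fun θ => ?_)
        simp only [map_add]
        exact smul_add (ω θ) (heatOp (c * θ) w) (heatOp (c * θ) w')
      map_smul' := fun r w => by
        simp only [map_smul, RingHom.id_apply, smul_comm _ r]
        exact integral_smul r fun θ => ω θ • heatOp (c * θ) w }
    (∫ θ in Ioi (0 : ℝ), ‖ω θ‖) fun w => by
    rw [← integral_mul_const]
    refine norm_integral_le_of_norm_le (hω.norm.mul_const _) (Eventually.of_forall fun θ => ?_)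
    rw [norm_smul]
    exact mul_le_mul_of_nonneg_left (norm_heatOp_le _ _) (norm_nonneg _)

section
variable {ω : ℝ → ℝ} (hω : IntegrableOn ω (Ioi 0))

lemma heatAvg_def (c : ℝ) (w : C₀(EuclideanSpace ℝ (Fin N), ℝ)) :
    heatAvg ω hω c w = ∫ θ in Ioi (0 : ℝ), ω θ • heatOp (c * θ) w := rfl

lemma heatAvg_apply (c : ℝ) (w : C₀(EuclideanSpace ℝ (Fin N), ℝ))
    (x : EuclideanSpace ℝ (Fin N)) :
    heatAvg ω hω c w x = ∫ θ in Ioi (0 : ℝ), ω θ * heatOp (c * θ) w x := by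
  rw [heatAvg_def, integral_apply_eq (integrable_smul_heatOp hω c w)]
  rfl

lemma integrable_mul_heatOp (hω : IntegrableOn ω (Ioi 0)) (c : ℝ)
    (w : C₀(EuclideanSpace ℝ (Fin N), ℝ)) (x : EuclideanSpace ℝ (Fin N)) :
    IntegrableOn (fun θ => ω θ * heatOp (c * θ) w x) (Ioi 0) :=
  (evalCLM x).integrable_comp (integrable_smul_heatOp hω c w)

lemma norm_heatAvg_le (c : ℝ) (w : C₀(EuclideanSpace ℝ (Fin N), ℝ)) :
    ‖heatAvg ω hω c w‖ ≤ (∫ θ in Ioi (0 : ℝ), ‖ω θ‖) * ‖w‖ := by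
  rw [heatAvg_def, ← integral_mul_const]
  refine norm_integral_le_of_norm_le (hω.norm.mul_const _) (Eventually.of_forall fun θ => ?_)
  rw [norm_smul]
  exact mul_le_mul_of_nonneg_left (norm_heatOp_le _ _) (norm_nonneg _)

lemma continuous_heatAvg (w : C₀(EuclideanSpace ℝ (Fin N), ℝ)) :
    Continuous fun c => heatAvg ω hω c w := by
  simp only [heatAvg_def]
  refine continuous_of_dominated (bound := fun θ => ‖ω θ‖ * ‖w‖)
    (fun c => (integrable_smul_heatOp hω c w).aestronglyMeasurable)
    (fun c => Eventually.of_forall fun θ => ?_) (hω.norm.mul_const _)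
    (Eventually.of_forall fun θ => ((continuous_heatOp w).comp
      (continuous_mul_const θ)).const_smul (ω θ))
  rw [norm_smul]
  exact mul_le_mul_of_nonneg_left (norm_heatOp_le _ _) (norm_nonneg _)

lemma continuous_heatAvg_uncurry {Ω : Type*} [TopologicalSpace Ω] {a : Ω → ℝ}
    {f : Ω → C₀(EuclideanSpace ℝ (Fin N), ℝ)} (ha : Continuous a) (hf : Continuous f) :
    Continuous fun z => heatAvg ω hω (a z) (f z) := by
  rw [continuous_iff_continuousAt]
  intro z₀
  have h1 : Tendsto (fun z => heatAvg ω hω (a z) (f z - f z₀)) (𝓝 z₀) (𝓝 0) := by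
    refine squeeze_zero_norm (fun z => norm_heatAvg_le hω _ _) ?_
    have := ((hf.sub (continuous_const (y := f z₀))).norm.tendsto z₀).const_mul
      (∫ θ in Ioi (0 : ℝ), ‖ω θ‖)
    simpa using this
  have h2 := ((continuous_heatAvg hω (f z₀)).comp ha).tendsto z₀
  have := h1.add h2
  simp only [Function.comp_apply, zero_add] at this
  refine this.congr fun z => ?_
  rw [← map_add, sub_add_cancel]

lemma heatAvg_nonneg (hω0 : ∀ θ, 0 < θ → 0 ≤ ω θ) (c : ℝ)
    {w : C₀(EuclideanSpace ℝ (Fin N), ℝ)} (hw : ∀ x, 0 ≤ w x) (x : EuclideanSpace ℝ (Fin N)) :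
    0 ≤ heatAvg ω hω c w x := by
  rw [heatAvg_apply]
  exact setIntegral_nonneg measurableSet_Ioi fun θ hθ =>
    mul_nonneg (hω0 θ hθ) (heatOp_nonneg _ hw x)

lemma heatOp_heatAvg {s c : ℝ} (hs : 0 ≤ s) (hc : 0 ≤ c)
    (w : C₀(EuclideanSpace ℝ (Fin N), ℝ)) :
    heatOp s (heatAvg ω hω c w) = ∫ θ in Ioi (0 : ℝ), ω θ • heatOp (s + c * θ) w := by
  rw [heatAvg_def, ← (heatOp s).integral_comp_comm (integrable_smul_heatOp hω c w)]
  refine setIntegral_congr_fun measurableSet_Ioi fun θ hθ => ?_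
  have : 0 ≤ c * θ := mul_nonneg hc (le_of_lt hθ)
  simp only [map_smul, heatOp_add hs this]

lemma heatOp_heatAvg_comm {s c : ℝ} (hs : 0 ≤ s) (hc : 0 ≤ c)
    (w : C₀(EuclideanSpace ℝ (Fin N), ℝ)) :
    heatOp s (heatAvg ω hω c w) = heatAvg ω hω c (heatOp s w) := by
  rw [heatOp_heatAvg hω hs hc, heatAvg_def]
  refine setIntegral_congr_fun measurableSet_Ioi fun θ hθ => ?_
  have : 0 ≤ c * θ := mul_nonneg hc (le_of_lt hθ)
  simp only [heatOp_add this hs, add_comm]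

lemma heatAvg_heatAvg {ω' : ℝ → ℝ} (hω' : IntegrableOn ω' (Ioi 0)) (c c' : ℝ)
    (w : C₀(EuclideanSpace ℝ (Fin N), ℝ)) :
    heatAvg ω' hω' c' (heatAvg ω hω c w) =
      ∫ θ in Ioi (0 : ℝ), ω θ • heatAvg ω' hω' c' (heatOp (c * θ) w) := by
  rw [heatAvg_def hω, ← (heatAvg ω' hω' c').integral_comp_comm (integrable_smul_heatOp hω c w)]
  simp only [map_smul]

/-- Keep only `θ ≤ 1`: there the total diffusion time `a + c θ` is at most `2 a`, so each operator
loses no more than `(1/2)^{N/2}` against `e^{aΔ}`. -/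
lemma heatOp_heatAvg_ge (hω0 : ∀ θ, 0 < θ → 0 ≤ ω θ) {a c : ℝ} (ha : 0 < a) (hc : 0 ≤ c)
    (hca : c ≤ a) {w : C₀(EuclideanSpace ℝ (Fin N), ℝ)} (hw : ∀ x, 0 ≤ w x)
    (x : EuclideanSpace ℝ (Fin N)) :
    (1 / 2) ^ ((N : ℝ) / 2) * (∫ θ in Ioc (0 : ℝ) 1, ω θ) * heatOp a w x ≤
      heatOp a (heatAvg ω hω c w) x := by
  rw [heatOp_heatAvg_comm hω ha.le hc, heatAvg_apply]
  have hsub : Ioc (0 : ℝ) 1 ⊆ Ioi 0 := Ioc_subset_Ioi_self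
  have hi := integrable_mul_heatOp hω c (heatOp a w) x
  have hnn : ∀ θ ∈ Ioi (0 : ℝ), 0 ≤ ω θ * heatOp (c * θ) (heatOp a w) x := fun θ hθ =>
    mul_nonneg (hω0 θ hθ) (heatOp_nonneg _ (heatOp_nonneg _ hw) x)
  calc (1 / 2) ^ ((N : ℝ) / 2) * (∫ θ in Ioc (0 : ℝ) 1, ω θ) * heatOp a w x
      = ∫ θ in Ioc (0 : ℝ) 1, ω θ * ((1 / 2) ^ ((N : ℝ) / 2) * heatOp a w x) := by
        rw [integral_mul_const]; ring
    _ ≤ ∫ θ in Ioc (0 : ℝ) 1, ω θ * heatOp (c * θ) (heatOp a w) x := by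
        refine setIntegral_mono_on ((hω.mono_set hsub).mul_const _) (hi.mono_set hsub)
          measurableSet_Ioc fun θ hθ => mul_le_mul_of_nonneg_left ?_ (hω0 θ hθ.1)
        have hcθ : 0 ≤ c * θ := mul_nonneg hc hθ.1.le
        rw [heatOp_add hcθ ha.le]
        refine le_trans (mul_le_mul_of_nonneg_right ?_ (heatOp_nonneg a hw x))
          (heatOp_le_heatOp ha (by linarith : a ≤ c * θ + a) hw x)
        refine Real.rpow_le_rpow (by norm_num) ?_ (by positivity)
        rw [div_le_div_iff₀ (by norm_num) (by positivity)]
        nlinarith [hθ.2]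
    _ ≤ ∫ θ in Ioi (0 : ℝ), ω θ * heatOp (c * θ) (heatOp a w) x :=
        setIntegral_mono_set hi ((ae_restrict_iff' measurableSet_Ioi).2
          (Eventually.of_forall hnn)) hsub.eventuallyLE

end

/-! ### The solution operators of the linear fractional equation -/

lemma integrableOn_wright {α : ℝ} (hα : 0 < α ∧ α < 1) : IntegrableOn (wright α) (Ioi 0) := by
  simpa using integrableOn_pow_mul_wright hα.1 hα.2 0

lemma integrableOn_mul_wright {α : ℝ} (hα : 0 < α ∧ α < 1) :
    IntegrableOn (fun θ => θ * wright α θ) (Ioi 0) := by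
  simpa using integrableOn_pow_mul_wright hα.1 hα.2 1

lemma mul_wright_nonneg {α : ℝ} (hα : 0 < α ∧ α < 1) (θ : ℝ) (hθ : 0 < θ) :
    0 ≤ θ * wright α θ := mul_nonneg hθ.le (wright_nonneg hα.1 hα.2 hθ.le)

/-- `P_α(t)` on `C₀`. -/
def fracP {α : ℝ} (hα : 0 < α ∧ α < 1) (t : ℝ) :
    C₀(EuclideanSpace ℝ (Fin N), ℝ) →L[ℝ] C₀(EuclideanSpace ℝ (Fin N), ℝ) :=
  heatAvg (wright α) (integrableOn_wright hα) (t ^ α)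

/-- `S_α(t)` on `C₀`. -/
def fracS {α : ℝ} (hα : 0 < α ∧ α < 1) (t : ℝ) :
    C₀(EuclideanSpace ℝ (Fin N), ℝ) →L[ℝ] C₀(EuclideanSpace ℝ (Fin N), ℝ) :=
  α • heatAvg (fun θ => θ * wright α θ) (integrableOn_mul_wright hα) (t ^ α)

section
variable {α : ℝ} (hα : 0 < α ∧ α < 1)

lemma fracP_apply (t : ℝ) (w : C₀(EuclideanSpace ℝ (Fin N), ℝ)) (x : EuclideanSpace ℝ (Fin N)) :
    fracP hα t w x = opP α t w x := by
  rw [fracP, heatAvg_apply, opP]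
  simp only [heatOp_apply]

lemma fracS_apply (t : ℝ) (w : C₀(EuclideanSpace ℝ (Fin N), ℝ)) (x : EuclideanSpace ℝ (Fin N)) :
    fracS hα t w x = opS α t w x := by
  rw [fracS, _root_.smul_apply, ZeroAtInftyContinuousMap.smul_apply, heatAvg_apply,
    opS, smul_eq_mul]
  simp only [heatOp_apply]

lemma fracP_nonneg (t : ℝ) {w : C₀(EuclideanSpace ℝ (Fin N), ℝ)} (hw : ∀ x, 0 ≤ w x)
    (x : EuclideanSpace ℝ (Fin N)) : 0 ≤ fracP hα t w x :=
  heatAvg_nonneg _ (fun _ hθ => wright_nonneg hα.1 hα.2 hθ.le) _ hw x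

lemma fracS_nonneg (t : ℝ) {w : C₀(EuclideanSpace ℝ (Fin N), ℝ)} (hw : ∀ x, 0 ≤ w x)
    (x : EuclideanSpace ℝ (Fin N)) : 0 ≤ fracS hα t w x :=
  mul_nonneg hα.1.le (heatAvg_nonneg (integrableOn_mul_wright hα) (mul_wright_nonneg hα) _ hw x)

lemma continuous_fracP (w : C₀(EuclideanSpace ℝ (Fin N), ℝ)) :
    Continuous fun t => fracP hα t w :=
  (continuous_heatAvg _ w).comp (Real.continuous_rpow_const hα.1.le)

lemma continuous_fracS_uncurry {Ω : Type*} [TopologicalSpace Ω] {a : Ω → ℝ}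
    {f : Ω → C₀(EuclideanSpace ℝ (Fin N), ℝ)} (ha : Continuous a) (hf : Continuous f) :
    Continuous fun z => fracS hα (a z) (f z) :=
  (continuous_heatAvg_uncurry (integrableOn_mul_wright hα)
    ((Real.continuous_rpow_const hα.1.le).comp ha) hf).const_smul α

/-- A bound for the norms of `S_α(t)`. -/
def fracSBound (α : ℝ) : ℝ := |α| * ∫ θ in Ioi (0 : ℝ), ‖θ * wright α θ‖

/-- A bound for the norms of `P_α(t)`. -/
def fracPBound (α : ℝ) : ℝ := ∫ θ in Ioi (0 : ℝ), ‖wright α θ‖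

lemma fracSBound_nonneg (α : ℝ) : 0 ≤ fracSBound α :=
  mul_nonneg (abs_nonneg _) (integral_nonneg fun _ => norm_nonneg _)

lemma fracPBound_nonneg (α : ℝ) : 0 ≤ fracPBound α := integral_nonneg fun _ => norm_nonneg _

lemma norm_fracS_le (t : ℝ) (w : C₀(EuclideanSpace ℝ (Fin N), ℝ)) :
    ‖fracS hα t w‖ ≤ fracSBound α * ‖w‖ := by
  rw [fracS, _root_.smul_apply, norm_smul, fracSBound, mul_assoc, Real.norm_eq_abs]
  exact mul_le_mul_of_nonneg_left (norm_heatAvg_le _ _ _) (abs_nonneg _)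

lemma norm_fracP_le (t : ℝ) (w : C₀(EuclideanSpace ℝ (Fin N), ℝ)) :
    ‖fracP hα t w‖ ≤ fracPBound α * ‖w‖ := norm_heatAvg_le _ _ _

lemma integral_Ioc_pow_mul_wright_pos {α : ℝ} (hα : 0 < α ∧ α < 1) (m : ℕ) :
    0 < ∫ θ in Ioc (0 : ℝ) 1, θ ^ m * wright α θ := by
  obtain ⟨θ₀, c, hθ₀, hc, h⟩ := exists_wright_lower hα.1 hα.2
  have hcont : Continuous fun θ => θ ^ m * wright α θ :=
    (continuous_pow m).mul (continuous_wright hα.1 hα.2)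
  rw [← intervalIntegral.integral_of_le zero_le_one]
  refine intervalIntegral.integral_pos one_pos hcont.continuousOn (fun θ hθ => ?_)
    ⟨min θ₀ 1, ⟨by positivity, min_le_right _ _⟩, ?_⟩
  · exact mul_nonneg (pow_nonneg hθ.1.le _) (wright_nonneg hα.1 hα.2 hθ.1.le)
  · have := h (min θ₀ 1) ⟨by positivity, min_le_left _ _⟩
    have : 0 < wright α (min θ₀ 1) := hc.trans_le this
    positivity

lemma exists_heatOp_frac_ge {α : ℝ} (hα : 0 < α ∧ α < 1) (N : ℕ) :
    ∃ c : ℝ, 0 < c ∧ ∀ (a t : ℝ), 0 < a → 0 ≤ t → t ^ α ≤ a →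
    ∀ w : C₀(EuclideanSpace ℝ (Fin N), ℝ), (∀ x, 0 ≤ w x) → ∀ x,
      c * heatOp a w x ≤ heatOp a (fracP hα t w) x ∧
      c * heatOp a w x ≤ heatOp a (fracS hα t w) x := by
  have h0 := integral_Ioc_pow_mul_wright_pos hα 0
  have h1 := integral_Ioc_pow_mul_wright_pos hα 1
  simp only [pow_zero, one_mul, pow_one] at h0 h1
  have hα0 := hα.1
  have h2 : (0 : ℝ) < (1 / 2) ^ ((N : ℝ) / 2) := by positivity
  refine ⟨min ((1 / 2) ^ ((N : ℝ) / 2) * ∫ θ in Ioc (0 : ℝ) 1, wright α θ)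
    (α * ((1 / 2) ^ ((N : ℝ) / 2) * ∫ θ in Ioc (0 : ℝ) 1, θ * wright α θ)), by positivity,
    fun a t ha ht hta w hw x => ⟨?_, ?_⟩⟩
  · refine le_trans (mul_le_mul_of_nonneg_right (min_le_left _ _) (heatOp_nonneg a hw x))
      (heatOp_heatAvg_ge _ (fun _ hθ => wright_nonneg hα.1 hα.2 hθ.le) ha (by positivity) hta hw x)
  · refine le_trans (mul_le_mul_of_nonneg_right (min_le_right _ _) (heatOp_nonneg a hw x)) ?_
    rw [fracS, _root_.smul_apply, map_smul, ZeroAtInftyContinuousMap.smul_apply,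
      smul_eq_mul, mul_assoc]
    exact mul_le_mul_of_nonneg_left
      (heatOp_heatAvg_ge _ (mul_wright_nonneg hα) ha (by positivity) hta hw x) hα0.le

end

end

/-! ### Abstract Volterra equations with a weakly singular kernel -/

section Volterra

variable {X : Type*} [NormedAddCommGroup X] [NormedSpace ℝ X]

/-- A weakly singular operator-valued convolution kernel with scalar majorant `k`. -/
structure IsVolterraKernel (A : ℝ → X →L[ℝ] X) (k : ℝ → ℝ) : Prop where
  continuousOn : ∀ f : ℝ → X, Continuous f → ContinuousOn (fun s => A s (f s)) (Ioi 0)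
  norm_le : ∀ s, 0 < s → ∀ x, ‖A s x‖ ≤ k s * ‖x‖
  nonneg : ∀ s, 0 < s → 0 ≤ k s
  integrableOn : ∀ T, IntegrableOn k (Ioc 0 T)

/-- The convolution `∫_0^t A(t - s) f(s) ds`. -/
def volterra (A : ℝ → X →L[ℝ] X) (f : ℝ → X) (t : ℝ) : X := ∫ s in (0 : ℝ)..t, A (t - s) (f s)

lemma volterra_eq (A : ℝ → X →L[ℝ] X) (f : ℝ → X) (t : ℝ) :
    volterra A f t = ∫ s in (0 : ℝ)..t, A s (f (t - s)) := by
  have := intervalIntegral.integral_comp_sub_left (a := 0) (b := t)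
    (fun s => A s (f (t - s))) t
  simpa [volterra] using this

variable {A : ℝ → X →L[ℝ] X} {k : ℝ → ℝ}

lemma IsVolterraKernel.continuousOn_sub (hA : IsVolterraKernel A k) {f : ℝ → X}
    (hf : Continuous f) (t : ℝ) : ContinuousOn (fun s => A s (f (t - s))) (Ioi 0) :=
  hA.continuousOn (fun s => f (t - s)) (hf.comp (continuous_const.sub continuous_id))

lemma exists_norm_bound_Icc {Y : Type*} [NormedAddCommGroup Y] {f : ℝ → Y}
    (hf : Continuous f) (T : ℝ) : ∃ M, 0 ≤ M ∧ ∀ s ∈ Icc 0 T, ‖f s‖ ≤ M := by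
  obtain ⟨M, hM⟩ := isCompact_Icc.exists_bound_of_continuousOn (hf.continuousOn (s := Icc 0 T))
  exact ⟨max M 0, le_max_right _ _, fun s hs => (hM s hs).trans (le_max_left _ _)⟩

lemma IsVolterraKernel.integrableOn_sub (hA : IsVolterraKernel A k) {f : ℝ → X}
    (hf : Continuous f) (t : ℝ) : IntegrableOn (fun s => A s (f (t - s))) (Ioc 0 t) := by
  obtain ⟨M, hM0, hM⟩ := exists_norm_bound_Icc hf t
  refine ((hA.integrableOn t).mul_const M).mono'
    (((hA.continuousOn_sub hf t).mono Ioc_subset_Ioi_self).aestronglyMeasurable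
      measurableSet_Ioc) ((ae_restrict_iff' measurableSet_Ioc).2 (Eventually.of_forall
      fun s hs => (hA.norm_le s hs.1 _).trans ?_))
  exact mul_le_mul_of_nonneg_left (hM _ ⟨by linarith [hs.2], by linarith [hs.1]⟩) (hA.nonneg s hs.1)

lemma IsVolterraKernel.intervalIntegrable (hA : IsVolterraKernel A k) {f : ℝ → X}
    (hf : Continuous f) {t : ℝ} (ht : 0 ≤ t) :
    IntervalIntegrable (fun s => A (t - s) (f s)) volume 0 t := by
  have h := (intervalIntegrable_iff_integrableOn_Ioc_of_le ht).2 (hA.integrableOn_sub hf t)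
  have := (h.comp_sub_left t).symm
  simpa using this

lemma IsVolterraKernel.continuousOn_volterra (hA : IsVolterraKernel A k) {f : ℝ → X}
    (hf : Continuous f) (T : ℝ) : ContinuousOn (volterra A f) (Icc 0 T) := by
  obtain ⟨M, hM0, hM⟩ := exists_norm_bound_Icc hf T
  -- The indicator makes the domain of integration independent of `t`, so that dominated convergence
  -- applies; the integrand is discontinuous in `t` only at `s = t₀`, a null set.
  set F : ℝ → ℝ → X := fun t => (Iio t).indicator fun s => A s (f (t - s)) with hF
  have heq : ∀ t ∈ Icc 0 T, volterra A f t = ∫ s in Ioc 0 T, F t s := by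
    intro t ht
    rw [volterra_eq, intervalIntegral.integral_of_le ht.1, hF,
      setIntegral_indicator measurableSet_Iio, integral_Ioc_eq_integral_Ioo]
    congr 2
    ext s
    simp only [mem_Ioo, mem_inter_iff, mem_Ioc, mem_Iio]
    constructor
    · rintro ⟨h1, h2⟩; exact ⟨⟨h1, by linarith [ht.2]⟩, h2⟩
    · rintro ⟨⟨h1, _⟩, h2⟩; exact ⟨h1, h2⟩
  refine ContinuousOn.congr (fun t₀ ht₀ => ?_) heq
  refine continuousWithinAt_of_dominated (bound := fun s => k s * M) ?_ ?_
    ((hA.integrableOn T).mul_const M) ?_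
  · refine Eventually.of_forall fun t => ?_
    exact (((hA.continuousOn_sub hf t).mono Ioc_subset_Ioi_self).aestronglyMeasurable
      measurableSet_Ioc).indicator measurableSet_Iio
  · filter_upwards [self_mem_nhdsWithin] with t ht
    refine (ae_restrict_iff' measurableSet_Ioc).2 (Eventually.of_forall fun s hs => ?_)
    simp only [hF]
    by_cases hst : s < t
    · rw [indicator_of_mem (mem_Iio.2 hst)]
      exact (hA.norm_le s hs.1 _).trans (mul_le_mul_of_nonneg_left
        (hM _ ⟨by linarith, by linarith [hs.1, ht.2]⟩) (hA.nonneg s hs.1))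
    · rw [indicator_of_notMem (fun h => hst (mem_Iio.1 h)), norm_zero]
      exact mul_nonneg (hA.nonneg s hs.1) hM0
  · have hne : ∀ᵐ s : ℝ, s ≠ t₀ := by simp [ae_iff]
    refine (ae_restrict_iff' measurableSet_Ioc).2 (hne.mono fun s hs _ => ?_)
    rcases lt_or_gt_of_ne hs with h | h
    · have hc : ContinuousAt (fun t => A s (f (t - s))) t₀ :=
        ((A s).continuous.comp (hf.comp (continuous_id.sub continuous_const))).continuousAt
      refine (hc.congr ?_).continuousWithinAt
      filter_upwards [lt_mem_nhds h] with t ht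
      simp only [hF]; rw [indicator_of_mem (mem_Iio.2 ht)]
    · refine (continuousAt_const.congr (f := fun _ => (0 : X)) ?_).continuousWithinAt
      filter_upwards [gt_mem_nhds h] with t ht
      simp only [hF]; rw [indicator_of_notMem (by simpa using ht.le)]

lemma volterra_congr {f f' : ℝ → X} {t : ℝ} (ht : 0 ≤ t) (h : EqOn f f' (Icc 0 t)) :
    volterra A f t = volterra A f' t := by
  refine intervalIntegral.integral_congr fun s hs => ?_
  rw [uIcc_of_le ht] at hs
  simp only [h hs]

/-- Dominated convergence as `l → ∞`: a large exponential weight makes the kernel mass as small as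
desired, whence a contraction on all of `[0, T]` at once. -/
lemma IsVolterraKernel.exists_weight (hA : IsVolterraKernel A k) (T L : ℝ) :
    ∃ l : ℝ, 0 ≤ l ∧ L * ∫ s in Ioc 0 T, Real.exp (-(l * s)) * k s < 1 := by
  have h : Tendsto (fun n : ℕ => L * ∫ s in Ioc 0 T, Real.exp (-((n : ℝ) * s)) * k s) atTop
      (𝓝 (L * ∫ s in Ioc 0 T, (0 : ℝ) * k s)) := by
    refine Tendsto.const_mul _ (tendsto_integral_of_dominated_convergence k (fun n => ?_)
      (hA.integrableOn T) (fun n => ?_) ?_)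
    · exact (Real.continuous_exp.comp (continuous_const_mul (n : ℝ)).neg).aestronglyMeasurable.mul
        (hA.integrableOn T).aestronglyMeasurable
    · refine (ae_restrict_iff' measurableSet_Ioc).2 (Eventually.of_forall fun s hs => ?_)
      have hk := hA.nonneg s hs.1
      rw [Real.norm_of_nonneg (by positivity)]
      refine mul_le_of_le_one_left hk (Real.exp_le_one_iff.2 ?_)
      have := mul_nonneg n.cast_nonneg hs.1.le (α := ℝ)
      linarith
    · refine (ae_restrict_iff' measurableSet_Ioc).2 (Eventually.of_forall fun s hs => ?_)
      refine Tendsto.mul_const _ (Real.tendsto_exp_neg_atTop_nhds_zero.comp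
        (tendsto_natCast_atTop_atTop.atTop_mul_const hs.1))
  simp only [zero_mul, integral_zero, mul_zero] at h
  obtain ⟨n, hn⟩ := (h.eventually (gt_mem_nhds one_pos)).exists
  exact ⟨n, n.cast_nonneg, hn⟩

/-- The exponentially weighted Picard operator of `z = g + A * G(z)` on `[0, T]`. -/
def picardFun (A : ℝ → X →L[ℝ] X) (g : ℝ → X) (G : X → X) (T l : ℝ) (hT : 0 ≤ T)
    (y : C(Icc 0 T, X)) (t : ℝ) : X :=
  Real.exp (-(l * t)) • (g t + volterra A (fun s => G (Real.exp (l * s) • IccExtend hT y s)) t)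

lemma IsVolterraKernel.continuousOn_picardFun (hA : IsVolterraKernel A k) {g : ℝ → X} {G : X → X}
    (hG : Continuous G) {T l : ℝ} (hT : 0 ≤ T) (hg : ContinuousOn g (Icc 0 T))
    (y : C(Icc 0 T, X)) : ContinuousOn (picardFun A g G T l hT y) (Icc 0 T) := by
  have h1 : Continuous fun t : ℝ => Real.exp (-(l * t)) := by fun_prop
  have h2 : Continuous fun s => G (Real.exp (l * s) • IccExtend hT y s) :=
    hG.comp ((by fun_prop : Continuous fun s : ℝ => Real.exp (l * s)).smul y.continuous.Icc_extend')
  exact h1.continuousOn.smul (hg.add (hA.continuousOn_volterra h2 T))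

lemma IsVolterraKernel.norm_picardFun_sub_le (hA : IsVolterraKernel A k) {g : ℝ → X} {G : X → X}
    {L : ℝ} (hL : 0 ≤ L) (hGL : ∀ a b, ‖G a - G b‖ ≤ L * ‖a - b‖) (hG : Continuous G)
    {T l : ℝ} (hT : 0 ≤ T) (y y' : C(Icc 0 T, X)) {t : ℝ} (ht : t ∈ Icc 0 T) :
    ‖picardFun A g G T l hT y t - picardFun A g G T l hT y' t‖ ≤
      (L * ∫ s in Ioc 0 T, Real.exp (-(l * s)) * k s) * ‖y - y'‖ := by
  have hc : ∀ y : C(Icc 0 T, X), Continuous fun s => G (Real.exp (l * s) • IccExtend hT y s) :=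
    fun y => hG.comp ((by fun_prop : Continuous fun s : ℝ => Real.exp (l * s)).smul
      y.continuous.Icc_extend')
  have hik : IntegrableOn (fun s => Real.exp (-(l * s)) * k s) (Ioc 0 T) := by
    refine (hA.integrableOn T).continuousOn_mul_of_subset (K := Icc 0 T) ?_
      isCompact_Icc measurableSet_Ioc Ioc_subset_Icc_self
    fun_prop
  rw [picardFun, picardFun, ← smul_sub, add_sub_add_left_eq_sub, volterra_eq, volterra_eq,
    ← intervalIntegral.integral_sub, ← intervalIntegral.integral_smul,
    intervalIntegral.integral_of_le ht.1]
  rotate_left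
  · exact (intervalIntegrable_iff_integrableOn_Ioc_of_le ht.1).2 (hA.integrableOn_sub (hc y) t)
  · exact (intervalIntegrable_iff_integrableOn_Ioc_of_le ht.1).2 (hA.integrableOn_sub (hc y') t)
  have hsub : Ioc 0 t ⊆ Ioc 0 T := Ioc_subset_Ioc_right ht.2
  calc _ ≤ ∫ s in Ioc 0 t, (L * (Real.exp (-(l * s)) * k s)) * ‖y - y'‖ := by
        refine norm_integral_le_of_norm_le (((hik.mono_set hsub).const_mul L).mul_const _)
          ((ae_restrict_iff' measurableSet_Ioc).2 (Eventually.of_forall fun s hs => ?_))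
        rw [← map_sub, norm_smul, Real.norm_of_nonneg (Real.exp_pos _).le]
        have h1 := hA.norm_le s hs.1 (G (Real.exp (l * (t - s)) • IccExtend hT y (t - s)) -
          G (Real.exp (l * (t - s)) • IccExtend hT y' (t - s)))
        have h2 := hGL (Real.exp (l * (t - s)) • IccExtend hT y (t - s))
          (Real.exp (l * (t - s)) • IccExtend hT y' (t - s))
        rw [← smul_sub, norm_smul, Real.norm_of_nonneg (Real.exp_pos _).le] at h2
        have h3 : ‖IccExtend hT y (t - s) - IccExtend hT y' (t - s)‖ ≤ ‖y - y'‖ :=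
          (y - y').norm_coe_le_norm (projIcc 0 T hT (t - s))
        have hk := hA.nonneg s hs.1
        calc _ ≤ Real.exp (-(l * t)) * (k s * (L * (Real.exp (l * (t - s)) * ‖y - y'‖))) := by
              refine mul_le_mul_of_nonneg_left (h1.trans (mul_le_mul_of_nonneg_left
                (h2.trans ?_) hk)) (Real.exp_pos _).le
              gcongr
          _ = _ := by
              rw [show -(l * s) = -(l * t) + l * (t - s) by ring, Real.exp_add]; ring
    _ = (L * ∫ s in Ioc 0 t, Real.exp (-(l * s)) * k s) * ‖y - y'‖ := by
        rw [integral_mul_const, integral_const_mul]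
    _ ≤ _ := by
        refine mul_le_mul_of_nonneg_right (mul_le_mul_of_nonneg_left ?_ hL) (norm_nonneg _)
        exact setIntegral_mono_set hik ((ae_restrict_iff' measurableSet_Ioc).2
          (Eventually.of_forall fun s hs => mul_nonneg (Real.exp_pos _).le (hA.nonneg s hs.1)))
          hsub.eventuallyLE

/-- The weighted Picard operator as a self-map of `C([0, T], X)`. -/
def IsVolterraKernel.picard (hA : IsVolterraKernel A k) {g : ℝ → X} {G : X → X}
    (hG : Continuous G) {T : ℝ} (l : ℝ) (hT : 0 ≤ T) (hg : ContinuousOn g (Icc 0 T))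
    (y : C(Icc 0 T, X)) : C(Icc 0 T, X) :=
  ⟨fun t => picardFun A g G T l hT y t,
    continuousOn_iff_continuous_domRestrict.1 (hA.continuousOn_picardFun hG hT hg y)⟩

lemma IsVolterraKernel.exists_contracting (hA : IsVolterraKernel A k) {g : ℝ → X} {G : X → X}
    {L : ℝ} (hL : 0 ≤ L) (hGL : ∀ a b, ‖G a - G b‖ ≤ L * ‖a - b‖) (hG : Continuous G)
    {T : ℝ} (hT : 0 ≤ T) (hg : ContinuousOn g (Icc 0 T)) :
    ∃ l K, ContractingWith K (hA.picard (g := g) hG l hT hg) := by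
  obtain ⟨l, -, hl⟩ := hA.exists_weight T L
  have h0 : 0 ≤ L * ∫ s in Ioc 0 T, Real.exp (-(l * s)) * k s :=
    mul_nonneg hL (setIntegral_nonneg measurableSet_Ioc fun s hs =>
      mul_nonneg (Real.exp_pos _).le (hA.nonneg s hs.1))
  refine ⟨l, NNReal.mk _ h0, by exact_mod_cast hl, LipschitzWith.of_dist_le_mul fun y y' => ?_⟩
  rw [dist_eq_norm, dist_eq_norm]
  refine (ContinuousMap.norm_le _ (mul_nonneg h0 (norm_nonneg _))).2 fun t => ?_
  exact hA.norm_picardFun_sub_le hL hGL hG hT y y' t.2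

theorem IsVolterraKernel.exists_solution [CompleteSpace X] (hA : IsVolterraKernel A k)
    {g : ℝ → X} {G : X → X} {L : ℝ} (hL : 0 ≤ L) (hGL : ∀ a b, ‖G a - G b‖ ≤ L * ‖a - b‖)
    (hG : Continuous G) {T : ℝ} (hT : 0 ≤ T) (hg : ContinuousOn g (Icc 0 T)) :
    ∃ z : ℝ → X, Continuous z ∧ ∀ t ∈ Icc 0 T, z t = g t + volterra A (fun s => G (z s)) t := by
  obtain ⟨l, K, hK⟩ := hA.exists_contracting hL hGL hG hT hg
  set y := ContractingWith.fixedPoint _ hK with hy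
  have hfix : hA.picard hG l hT hg y = y := hK.fixedPoint_isFixedPt
  refine ⟨fun t => Real.exp (l * t) • IccExtend hT y t,
    (by fun_prop : Continuous fun s : ℝ => Real.exp (l * s)).smul y.continuous.Icc_extend',
    fun t ht => ?_⟩
  have h1 : y ⟨t, ht⟩ = picardFun A g G T l hT y t := by
    conv_lhs => rw [← hfix]
    rfl
  beta_reduce
  rw [IccExtend_of_mem hT y ht, h1, picardFun, smul_smul, ← Real.exp_add, add_neg_cancel,
    Real.exp_zero, one_smul]

theorem IsVolterraKernel.eqOn_of_solution [CompleteSpace X] (hA : IsVolterraKernel A k)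
    {g : ℝ → X} {G : X → X} {L : ℝ} (hL : 0 ≤ L) (hGL : ∀ a b, ‖G a - G b‖ ≤ L * ‖a - b‖)
    (hG : Continuous G) {T : ℝ} (hT : 0 ≤ T) (hg : ContinuousOn g (Icc 0 T)) {z z' : ℝ → X}
    (hzc : ContinuousOn z (Icc 0 T)) (hzc' : ContinuousOn z' (Icc 0 T))
    (hz : ∀ t ∈ Icc 0 T, z t = g t + volterra A (fun s => G (z s)) t)
    (hz' : ∀ t ∈ Icc 0 T, z' t = g t + volterra A (fun s => G (z' s)) t) :
    EqOn z z' (Icc 0 T) := by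
  obtain ⟨l, K, hK⟩ := hA.exists_contracting hL hGL hG hT hg
  have key : ∀ z : ℝ → X, ContinuousOn z (Icc 0 T) →
      (∀ t ∈ Icc 0 T, z t = g t + volterra A (fun s => G (z s)) t) →
      ∃ y : C(Icc 0 T, X), Function.IsFixedPt (hA.picard hG l hT hg) y ∧
        ∀ t : Icc 0 T, y t = Real.exp (-(l * t)) • z t := by
    intro z hzc hz
    refine ⟨⟨fun t => Real.exp (-(l * t)) • z t, ?_⟩, ?_, fun t => rfl⟩
    · exact (by fun_prop : Continuous fun t : Icc 0 T => Real.exp (-(l * (t : ℝ)))).smul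
        (continuousOn_iff_continuous_domRestrict.1 hzc)
    · ext t
      change Real.exp (-(l * t)) • (g t + volterra A _ t) = Real.exp (-(l * t)) • z t
      rw [hz t t.2]
      congr 2
      refine volterra_congr t.2.1 fun s hs => ?_
      have hs' : s ∈ Icc 0 T := ⟨hs.1, hs.2.trans t.2.2⟩
      rw [IccExtend_of_mem hT _ hs']
      simp only [ContinuousMap.coe_mk, smul_smul, ← Real.exp_add, add_neg_cancel, Real.exp_zero,
        one_smul]
  obtain ⟨y, hy, hyz⟩ := key z hzc hz
  obtain ⟨y', hy', hyz'⟩ := key z' hzc' hz'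
  have : y = y' := hK.fixedPoint_unique' hy hy'
  intro t ht
  have h := hyz ⟨t, ht⟩
  rw [this, hyz' ⟨t, ht⟩] at h
  exact (smul_right_injective X (Real.exp_pos (-(l * t))).ne' h).symm

end Volterra

section

/-! ### Mild solutions as solutions of a Volterra equation in `C₀ × C₀` -/

variable {N : ℕ}

/-- The superposition operator on `C₀` of a continuous function vanishing at `0`. -/
def postComp {f : ℝ → ℝ} (hf : Continuous f) (h0 : f 0 = 0)
    (w : C₀(EuclideanSpace ℝ (Fin N), ℝ)) : C₀(EuclideanSpace ℝ (Fin N), ℝ) where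
  toFun x := f (w x)
  continuous_toFun := hf.comp w.continuous
  zero_at_infty' := by
    have := (hf.tendsto 0).comp (zero_at_infty w)
    rwa [h0] at this

@[simp] lemma postComp_apply {f : ℝ → ℝ} (hf : Continuous f) (h0 : f 0 = 0)
    (w : C₀(EuclideanSpace ℝ (Fin N), ℝ)) (x : EuclideanSpace ℝ (Fin N)) :
    postComp hf h0 w x = f (w x) := rfl

lemma continuous_postComp {f : ℝ → ℝ} (hf : Continuous f) (h0 : f 0 = 0) :
    Continuous (postComp hf h0 : C₀(EuclideanSpace ℝ (Fin N), ℝ) → _) := by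
  rw [Metric.continuous_iff]
  intro w ε hε
  have hu := (isCompact_Icc (a := -(‖w‖ + 1)) (b := ‖w‖ + 1)).uniformContinuousOn_of_continuous
    hf.continuousOn
  obtain ⟨δ, hδ, h⟩ := Metric.uniformContinuousOn_iff.1 hu (ε / 2) (half_pos hε)
  refine ⟨min δ 1, by positivity, fun w' hw' => ?_⟩
  rw [dist_eq_norm] at hw' ⊢
  refine lt_of_le_of_lt (norm_le_of_forall_abs_le (half_pos hε).le fun x => ?_) (half_lt_self hε)
  have h1 := abs_apply_le_norm w x
  have h2 : |w' x - w x| ≤ ‖w' - w‖ := abs_apply_le_norm (w' - w) x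
  have h3 := lt_of_lt_of_le hw' (min_le_left _ _)
  have h4 := lt_of_lt_of_le hw' (min_le_right _ _)
  have h5 := abs_sub_abs_le_abs_sub (w' x) (w x)
  have := h (w' x) (abs_le.1 (by linarith)) (w x) (abs_le.1 (by linarith))
    (by rw [Real.dist_eq]; linarith)
  exact this.le

lemma norm_postComp_sub_le {f : ℝ → ℝ} (hf : Continuous f) (h0 : f 0 = 0) {L : ℝ} (hL : 0 ≤ L)
    (hfL : ∀ a b, |f a - f b| ≤ L * |a - b|) (w w' : C₀(EuclideanSpace ℝ (Fin N), ℝ)) :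
    ‖postComp hf h0 w - postComp hf h0 w'‖ ≤ L * ‖w - w'‖ :=
  norm_le_of_forall_abs_le (by positivity) fun x => (hfL (w x) (w' x)).trans
    (mul_le_mul_of_nonneg_left (abs_apply_le_norm (w - w') x) hL)

/-- The convolution kernel `s^(α - 1) S_α(s)`. -/
def fracK {α : ℝ} (hα : 0 < α ∧ α < 1) (s : ℝ) :
    C₀(EuclideanSpace ℝ (Fin N), ℝ) →L[ℝ] C₀(EuclideanSpace ℝ (Fin N), ℝ) :=
  s ^ (α - 1) • fracS hα s

section
variable {α : ℝ} (hα : 0 < α ∧ α < 1)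

lemma fracK_apply_eq (s : ℝ) (w : C₀(EuclideanSpace ℝ (Fin N), ℝ)) :
    fracK hα s w = s ^ (α - 1) • fracS hα s w := rfl

lemma fracK_apply (s : ℝ) (w : C₀(EuclideanSpace ℝ (Fin N), ℝ)) (x : EuclideanSpace ℝ (Fin N)) :
    fracK hα s w x = s ^ (α - 1) * opS α s w x := by
  rw [fracK_apply_eq, ZeroAtInftyContinuousMap.smul_apply, fracS_apply, smul_eq_mul]

lemma fracK_nonneg {s : ℝ} (hs : 0 ≤ s) {w : C₀(EuclideanSpace ℝ (Fin N), ℝ)}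
    (hw : ∀ x, 0 ≤ w x) (x : EuclideanSpace ℝ (Fin N)) : 0 ≤ fracK hα s w x := by
  rw [fracK_apply, ← fracS_apply hα]
  exact mul_nonneg (Real.rpow_nonneg hs _) (fracS_nonneg hα s hw x)

lemma isVolterraKernel_fracK :
    IsVolterraKernel (fracK (N := N) hα) fun s => fracSBound α * s ^ (α - 1) where
  continuousOn f hf := (continuousOn_id.rpow_const fun s hs => Or.inl (ne_of_gt hs)).smul
    (continuous_fracS_uncurry hα continuous_id hf).continuousOn
  norm_le s hs w := by
    rw [fracK_apply_eq, norm_smul, Real.norm_of_nonneg (Real.rpow_nonneg hs.le _)]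
    have := mul_le_mul_of_nonneg_left (norm_fracS_le hα s w) (Real.rpow_nonneg hs.le (α - 1))
    linarith
  nonneg s hs := mul_nonneg (fracSBound_nonneg α) (Real.rpow_nonneg hs.le _)
  integrableOn T := by
    rcases le_or_gt T 0 with hT | hT
    · simp [Ioc_eq_empty (not_lt.2 hT)]
    · exact ((intervalIntegrable_iff_integrableOn_Ioc_of_le hT.le).1
        (intervalIntegral.intervalIntegrable_rpow' (by linarith [hα.1]))).const_mul _

end

lemma exists_continuous_eqOn {Y : Type*} [TopologicalSpace Y] {T : ℝ} (hT : 0 ≤ T) {f : ℝ → Y}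
    (hf : ContinuousOn f (Icc 0 T)) : ∃ f' : ℝ → Y, Continuous f' ∧ EqOn f f' (Icc 0 T) :=
  ⟨IccExtend hT ((Icc 0 T).domRestrict f),
    (continuousOn_iff_continuous_domRestrict.1 hf).Icc_extend',
    fun t ht => by rw [IccExtend_of_mem hT _ ht]; rfl⟩

section prod
variable {X Y : Type*} [NormedAddCommGroup X] [NormedSpace ℝ X] [NormedAddCommGroup Y]
  [NormedSpace ℝ Y] {A : ℝ → X →L[ℝ] X} {B : ℝ → Y →L[ℝ] Y} {k l : ℝ → ℝ}

lemma IsVolterraKernel.intervalIntegrable_of_continuousOn (hA : IsVolterraKernel A k) {f : ℝ → X}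
    {t : ℝ} (ht : 0 ≤ t) (hf : ContinuousOn f (Icc 0 t)) :
    IntervalIntegrable (fun s => A (t - s) (f s)) volume 0 t := by
  obtain ⟨f', hf', he⟩ := exists_continuous_eqOn ht hf
  refine (hA.intervalIntegrable hf' ht).congr fun s hs => ?_
  rw [uIoc_of_le ht] at hs
  simp only [he (Ioc_subset_Icc_self hs)]

lemma IsVolterraKernel.prodMap (hA : IsVolterraKernel A k) (hB : IsVolterraKernel B l) :
    IsVolterraKernel (fun s => (A s).prodMap (B s)) fun s => k s + l s where
  continuousOn f hf := (hA.continuousOn _ (continuous_fst.comp hf)).prodMk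
    (hB.continuousOn _ (continuous_snd.comp hf))
  norm_le s hs x := by
    have h1 := hA.norm_le s hs x.1
    have h2 := hB.norm_le s hs x.2
    have h3 := hA.nonneg s hs
    have h4 := hB.nonneg s hs
    have h5 := norm_fst_le x
    have h6 := norm_snd_le x
    rw [add_mul]
    refine max_le ?_ ?_
    · have := mul_le_mul_of_nonneg_left h5 h3
      have := mul_nonneg h4 (norm_nonneg x)
      change ‖A s x.1‖ ≤ _
      linarith
    · have := mul_le_mul_of_nonneg_left h6 h4
      have := mul_nonneg h3 (norm_nonneg x)
      change ‖B s x.2‖ ≤ _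
      linarith
  nonneg s hs := add_nonneg (hA.nonneg s hs) (hB.nonneg s hs)
  integrableOn T := (hA.integrableOn T).add (hB.integrableOn T)

lemma volterra_prodMap [CompleteSpace X] [CompleteSpace Y] (hA : IsVolterraKernel A k)
    (hB : IsVolterraKernel B l) {f : ℝ → X × Y} {t : ℝ}
    (ht : 0 ≤ t) (hf : ContinuousOn f (Icc 0 t)) :
    volterra (fun s => (A s).prodMap (B s)) f t =
      (volterra A (fun s => (f s).1) t, volterra B (fun s => (f s).2) t) := by
  have hi := (hA.prodMap hB).intervalIntegrable_of_continuousOn ht hf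
  ext1
  · exact ((ContinuousLinearMap.fst ℝ X Y).intervalIntegral_comp_comm hi).symm
  · exact ((ContinuousLinearMap.snd ℝ X Y).intervalIntegral_comp_comm hi).symm

end prod

section mild

variable {γ₁ γ₂ : ℝ} (hγ₁ : 0 < γ₁ ∧ γ₁ < 1) (hγ₂ : 0 < γ₂ ∧ γ₂ < 1)
  {f g : ℝ → ℝ} (hf : Continuous f) (hf0 : f 0 = 0) (hg : Continuous g) (hg0 : g 0 = 0)
  {u₀ v₀ : C₀(EuclideanSpace ℝ (Fin N), ℝ)} {T : ℝ}
  {u v : ℝ → C₀(EuclideanSpace ℝ (Fin N), ℝ)}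

lemma volterra_fracK_apply {α : ℝ} (hα : 0 < α ∧ α < 1)
    {F : ℝ → C₀(EuclideanSpace ℝ (Fin N), ℝ)} {t : ℝ} (ht : 0 ≤ t)
    (hF : ContinuousOn F (Icc 0 t)) (x : EuclideanSpace ℝ (Fin N)) :
    volterra (fracK hα) F t x =
      ∫ τ in (0 : ℝ)..t, (t - τ) ^ (α - 1) * opS α (t - τ) (F τ) x := by
  have h := (evalCLM x).intervalIntegral_comp_comm
    ((isVolterraKernel_fracK hα).intervalIntegrable_of_continuousOn ht hF)
  simp only [evalCLM_apply, fracK_apply] at h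
  exact h.symm

/-- Evaluation at a point is a continuous functional and commutes with the Bochner integral, so the
pointwise equations are the same as equations in `C₀`. -/
lemma isMildSolution_iff : IsMildSolution γ₁ γ₂ f g u₀ v₀ T u v ↔
    ContinuousOn u (Icc 0 T) ∧ ContinuousOn v (Icc 0 T) ∧ ∀ t ∈ Icc 0 T,
      u t = fracP hγ₁ t u₀ + volterra (fracK hγ₁) (fun s => postComp hf hf0 (v s)) t ∧
      v t = fracP hγ₂ t v₀ + volterra (fracK hγ₂) (fun s => postComp hg hg0 (u s)) t := by
  have key : ContinuousOn u (Icc 0 T) → ContinuousOn v (Icc 0 T) → ∀ t ∈ Icc 0 T, ∀ x,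
      ((fracP hγ₁ t u₀ + volterra (fracK hγ₁) (fun s => postComp hf hf0 (v s)) t) x =
        opP γ₁ t u₀ x +
          ∫ τ in (0 : ℝ)..t, (t - τ) ^ (γ₁ - 1) * opS γ₁ (t - τ) (fun y => f (v τ y)) x) ∧
      ((fracP hγ₂ t v₀ + volterra (fracK hγ₂) (fun s => postComp hg hg0 (u s)) t) x =
        opP γ₂ t v₀ x +
          ∫ τ in (0 : ℝ)..t, (t - τ) ^ (γ₂ - 1) * opS γ₂ (t - τ) (fun y => g (u τ y)) x) := by
    intro hu hv t ht x
    have hsub : Icc 0 t ⊆ Icc 0 T := Icc_subset_Icc_right ht.2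
    rw [ZeroAtInftyContinuousMap.add_apply, ZeroAtInftyContinuousMap.add_apply, fracP_apply,
      fracP_apply, volterra_fracK_apply hγ₁ (F := fun s => postComp hf hf0 (v s)) ht.1
        ((continuous_postComp hf hf0).comp_continuousOn (hv.mono hsub)),
      volterra_fracK_apply hγ₂ (F := fun s => postComp hg hg0 (u s)) ht.1
        ((continuous_postComp hg hg0).comp_continuousOn (hu.mono hsub))]
    exact ⟨rfl, rfl⟩
  constructor
  · rintro ⟨hu, hv, h1, h2⟩
    refine ⟨hu, hv, fun t ht => ⟨?_, ?_⟩⟩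
    · ext x; rw [h1 t ht x, (key hu hv t ht x).1]
    · ext x; rw [h2 t ht x, (key hu hv t ht x).2]
  · rintro ⟨hu, hv, h⟩
    refine ⟨hu, hv, fun t ht x => ?_, fun t ht x => ?_⟩
    · rw [← (key hu hv t ht x).1, ← (h t ht).1]
    · rw [← (key hu hv t ht x).2, ← (h t ht).2]

/-- The Volterra kernel of the system. -/
def sysKernel (s : ℝ) :
    (C₀(EuclideanSpace ℝ (Fin N), ℝ) × C₀(EuclideanSpace ℝ (Fin N), ℝ)) →L[ℝ]
      (C₀(EuclideanSpace ℝ (Fin N), ℝ) × C₀(EuclideanSpace ℝ (Fin N), ℝ)) :=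
  (fracK hγ₁ s).prodMap (fracK hγ₂ s)

lemma isMildSolution_iff_volterra : IsMildSolution γ₁ γ₂ f g u₀ v₀ T u v ↔
    ContinuousOn (fun t => (u t, v t)) (Icc 0 T) ∧ ∀ t ∈ Icc 0 T,
      (u t, v t) = (fracP hγ₁ t u₀, fracP hγ₂ t v₀) + volterra (sysKernel hγ₁ hγ₂)
        (fun s => (postComp hf hf0 (v s), postComp hg hg0 (u s))) t := by
  have hc : ContinuousOn (fun t => (u t, v t)) (Icc 0 T) ↔
      ContinuousOn u (Icc 0 T) ∧ ContinuousOn v (Icc 0 T) :=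
    ⟨fun h => ⟨continuous_fst.comp_continuousOn h, continuous_snd.comp_continuousOn h⟩,
      fun h => h.1.prodMk h.2⟩
  rw [isMildSolution_iff hγ₁ hγ₂ hf hf0 hg hg0, hc, and_assoc]
  refine and_congr_right fun hu => and_congr_right fun hv => forall₂_congr fun t ht => ?_
  have hsub : Icc 0 t ⊆ Icc 0 T := Icc_subset_Icc_right ht.2
  have h := volterra_prodMap (isVolterraKernel_fracK hγ₁) (isVolterraKernel_fracK hγ₂)
    (f := fun s => (postComp hf hf0 (v s), postComp hg hg0 (u s))) ht.1
    (((continuous_postComp hf hf0).comp_continuousOn (hv.mono hsub)).prodMk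
        ((continuous_postComp hg hg0).comp_continuousOn (hu.mono hsub)))
  unfold sysKernel
  rw [h, Prod.mk_add_mk, Prod.mk.injEq]

variable {L : ℝ} (hL : 0 ≤ L) (hfL : ∀ a b, |f a - f b| ≤ L * |a - b|)
  (hgL : ∀ a b, |g a - g b| ≤ L * |a - b|)

lemma norm_sys_sub_le (hL : 0 ≤ L) (hfL : ∀ a b, |f a - f b| ≤ L * |a - b|)
    (hgL : ∀ a b, |g a - g b| ≤ L * |a - b|)
    (a b : C₀(EuclideanSpace ℝ (Fin N), ℝ) × C₀(EuclideanSpace ℝ (Fin N), ℝ)) :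
    ‖(postComp hf hf0 a.2, postComp hg hg0 a.1) - (postComp hf hf0 b.2, postComp hg hg0 b.1)‖ ≤
      L * ‖a - b‖ := by
  have h1 := norm_postComp_sub_le hf hf0 hL hfL a.2 b.2
  have h2 := norm_postComp_sub_le hg hg0 hL hgL a.1 b.1
  have h3 := norm_fst_le (a - b)
  have h4 := norm_snd_le (a - b)
  exact max_le (h1.trans (mul_le_mul_of_nonneg_left h4 hL))
    (h2.trans (mul_le_mul_of_nonneg_left h3 hL))

include hγ₁ hγ₂ hf hf0 hg hg0 hL hfL hgL

lemma exists_isMildSolution_of_lipschitz (u₀ v₀ : C₀(EuclideanSpace ℝ (Fin N), ℝ))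
    (hT : 0 ≤ T) : ∃ u v : ℝ → C₀(EuclideanSpace ℝ (Fin N), ℝ),
      Continuous u ∧ Continuous v ∧ IsMildSolution γ₁ γ₂ f g u₀ v₀ T u v := by
  obtain ⟨z, hz, h⟩ := ((isVolterraKernel_fracK hγ₁).prodMap
    (isVolterraKernel_fracK hγ₂)).exists_solution
    (g := fun t => (fracP hγ₁ t u₀, fracP hγ₂ t v₀))
    (G := fun a => (postComp hf hf0 a.2, postComp hg hg0 a.1)) hL
    (norm_sys_sub_le hf hf0 hg hg0 hL hfL hgL)
    (((continuous_postComp hf hf0).comp continuous_snd).prodMk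
      ((continuous_postComp hg hg0).comp continuous_fst)) hT
    ((continuous_fracP hγ₁ u₀).prodMk (continuous_fracP hγ₂ v₀)).continuousOn
  exact ⟨fun t => (z t).1, fun t => (z t).2, continuous_fst.comp hz, continuous_snd.comp hz,
    (isMildSolution_iff_volterra hγ₁ hγ₂ hf hf0 hg hg0).2 ⟨hz.continuousOn, h⟩⟩

lemma IsMildSolution.eqOn_of_lipschitz (hT : 0 ≤ T)
    {u' v' : ℝ → C₀(EuclideanSpace ℝ (Fin N), ℝ)}
    (h : IsMildSolution γ₁ γ₂ f g u₀ v₀ T u v) (h' : IsMildSolution γ₁ γ₂ f g u₀ v₀ T u' v') :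
    EqOn u u' (Icc 0 T) ∧ EqOn v v' (Icc 0 T) := by
  obtain ⟨h1, h2⟩ := (isMildSolution_iff_volterra hγ₁ hγ₂ hf hf0 hg hg0).1 h
  obtain ⟨h1', h2'⟩ := (isMildSolution_iff_volterra hγ₁ hγ₂ hf hf0 hg hg0).1 h'
  have := ((isVolterraKernel_fracK hγ₁).prodMap
    (isVolterraKernel_fracK hγ₂)).eqOn_of_solution
    (g := fun t => (fracP hγ₁ t u₀, fracP hγ₂ t v₀))
    (G := fun a => (postComp hf hf0 a.2, postComp hg hg0 a.1)) hL
    (norm_sys_sub_le hf hf0 hg hg0 hL hfL hgL)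
    (((continuous_postComp hf hf0).comp continuous_snd).prodMk
      ((continuous_postComp hg hg0).comp continuous_fst)) hT
    ((continuous_fracP hγ₁ u₀).prodMk (continuous_fracP hγ₂ v₀)).continuousOn h1 h1' h2 h2'
  exact ⟨fun t ht => congrArg Prod.fst (this ht), fun t ht => congrArg Prod.snd (this ht)⟩

end mild

lemma IsMildSolution.mono {γ₁ γ₂ : ℝ} {f g : ℝ → ℝ} {u₀ v₀ : C₀(EuclideanSpace ℝ (Fin N), ℝ)}
    {T T' : ℝ} {u v : ℝ → C₀(EuclideanSpace ℝ (Fin N), ℝ)} (hT : T' ≤ T)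
    (h : IsMildSolution γ₁ γ₂ f g u₀ v₀ T u v) : IsMildSolution γ₁ γ₂ f g u₀ v₀ T' u v := by
  have hsub : Icc 0 T' ⊆ Icc 0 T := Icc_subset_Icc_right hT
  exact ⟨h.1.mono hsub, h.2.mono hsub, fun t ht => h.3 t (hsub ht), fun t ht => h.4 t (hsub ht)⟩

lemma IsMildSolution.congr {γ₁ γ₂ : ℝ} {f g f' g' : ℝ → ℝ}
    {u₀ v₀ : C₀(EuclideanSpace ℝ (Fin N), ℝ)} {T : ℝ}
    {u v u' v' : ℝ → C₀(EuclideanSpace ℝ (Fin N), ℝ)}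
    (h : IsMildSolution γ₁ γ₂ f g u₀ v₀ T u v) (hu : EqOn u' u (Icc 0 T))
    (hv : EqOn v' v (Icc 0 T)) (hf : ∀ t ∈ Icc 0 T, ∀ y, f' (v t y) = f (v t y))
    (hg : ∀ t ∈ Icc 0 T, ∀ y, g' (u t y) = g (u t y)) :
    IsMildSolution γ₁ γ₂ f' g' u₀ v₀ T u' v' := by
  refine ⟨h.1.congr hu, h.2.congr hv, fun t ht x => ?_, fun t ht x => ?_⟩
  · rw [hu ht, h.3 t ht x]
    congr 1
    refine intervalIntegral.integral_congr fun s hs => ?_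
    rw [uIcc_of_le ht.1] at hs
    have hs' : s ∈ Icc 0 T := ⟨hs.1, hs.2.trans ht.2⟩
    simp only [hv hs', hf s hs']
  · rw [hv ht, h.4 t ht x]
    congr 1
    refine intervalIntegral.integral_congr fun s hs => ?_
    rw [uIcc_of_le ht.1] at hs
    have hs' : s ∈ Icc 0 T := ⟨hs.1, hs.2.trans ht.2⟩
    simp only [hu hs', hg s hs']

lemma IsMildSolution.swap {γ₁ γ₂ : ℝ} {f g : ℝ → ℝ} {u₀ v₀ : C₀(EuclideanSpace ℝ (Fin N), ℝ)}
    {T : ℝ} {u v : ℝ → C₀(EuclideanSpace ℝ (Fin N), ℝ)}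
    (h : IsMildSolution γ₁ γ₂ f g u₀ v₀ T u v) : IsMildSolution γ₂ γ₁ g f v₀ u₀ T v u :=
  ⟨h.2, h.1, h.4, h.3⟩

/-! ### Truncated power nonlinearities -/

/-- The power nonlinearity, truncated at height `R`. -/
def truncPow (p R a : ℝ) : ℝ := (min |a| R) ^ p

lemma truncPow_eq {p R a : ℝ} (h : |a| ≤ R) : truncPow p R a = |a| ^ p := by
  rw [truncPow, min_eq_left h]

lemma continuous_abs_rpow {p : ℝ} (hp : 1 ≤ p) : Continuous fun s : ℝ => |s| ^ p :=
  continuous_abs.rpow_const fun _ => Or.inr (by linarith)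

lemma abs_zero_rpow {p : ℝ} (hp : 1 ≤ p) : |(0 : ℝ)| ^ p = 0 := by
  rw [abs_zero, Real.zero_rpow (by linarith)]

/-- The mean value bound for `x ^ p` on `[0, R]`, composed with the `1`-Lipschitz map `a ↦ min |a|
R`. -/
lemma truncPow_lipschitz {p R : ℝ} (hp : 1 ≤ p) (hR : 0 ≤ R) (a b : ℝ) :
    |truncPow p R a - truncPow p R b| ≤ p * R ^ (p - 1) * |a - b| := by
  have h := (convex_Icc (0 : ℝ) R).norm_image_sub_le_of_norm_hasDerivWithin_le
    (f := fun x : ℝ => x ^ p) (f' := fun x => p * x ^ (p - 1)) (C := p * R ^ (p - 1))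
    (fun x _ => (Real.hasDerivAt_rpow_const (Or.inr hp)).hasDerivWithinAt) (fun x hx => by
      have h1 := Real.rpow_le_rpow hx.1 hx.2 (by linarith : 0 ≤ p - 1)
      rw [Real.norm_of_nonneg (mul_nonneg (by linarith) (Real.rpow_nonneg hx.1 _))]
      exact mul_le_mul_of_nonneg_left h1 (by linarith))
    (x := min |b| R) (y := min |a| R) ⟨le_min (abs_nonneg _) hR, min_le_right _ _⟩
    ⟨le_min (abs_nonneg _) hR, min_le_right _ _⟩
  refine h.trans (mul_le_mul_of_nonneg_left ?_ (mul_nonneg (by linarith) (Real.rpow_nonneg hR _)))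
  refine (abs_min_sub_min_le_max _ _ _ _).trans ?_
  rw [sub_self, abs_zero, max_eq_left (abs_nonneg _)]
  exact abs_abs_sub_abs_le a b

lemma truncPow_zero {p R : ℝ} (hp : 1 ≤ p) (hR : 0 ≤ R) : truncPow p R 0 = 0 := by
  rw [truncPow, abs_zero, min_eq_left hR, Real.zero_rpow (by linarith)]

lemma continuous_truncPow {p : ℝ} (hp : 1 ≤ p) (R : ℝ) : Continuous (truncPow p R) :=
  (continuous_abs.min continuous_const).rpow_const fun _ => Or.inr (by linarith)

section pow

variable {γ₁ γ₂ p q : ℝ} (hγ₁ : 0 < γ₁ ∧ γ₁ < 1) (hγ₂ : 0 < γ₂ ∧ γ₂ < 1)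
  (hp : 1 ≤ p) (hq : 1 ≤ q) {u₀ v₀ : C₀(EuclideanSpace ℝ (Fin N), ℝ)} {T : ℝ}
  {u v u' v' : ℝ → C₀(EuclideanSpace ℝ (Fin N), ℝ)}

include hγ₁ hγ₂ hp hq

lemma exists_isMildSolution_truncPow (u₀ v₀ : C₀(EuclideanSpace ℝ (Fin N), ℝ)) {R : ℝ}
    (hR : 0 ≤ R) (hT : 0 ≤ T) : ∃ u v : ℝ → C₀(EuclideanSpace ℝ (Fin N), ℝ),
      Continuous u ∧ Continuous v ∧
        IsMildSolution γ₁ γ₂ (truncPow p R) (truncPow q R) u₀ v₀ T u v := by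
  have h1 : 0 ≤ p * R ^ (p - 1) := mul_nonneg (by linarith) (Real.rpow_nonneg hR _)
  refine exists_isMildSolution_of_lipschitz hγ₁ hγ₂ (continuous_truncPow hp R)
    (truncPow_zero hp hR) (continuous_truncPow hq R) (truncPow_zero hq hR)
    (L := max (p * R ^ (p - 1)) (q * R ^ (q - 1))) (le_max_of_le_left h1)
    (fun a b => (truncPow_lipschitz hp hR a b).trans ?_)
    (fun a b => (truncPow_lipschitz hq hR a b).trans ?_) u₀ v₀ hT
  · exact mul_le_mul_of_nonneg_right (le_max_left _ _) (abs_nonneg _)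
  · exact mul_le_mul_of_nonneg_right (le_max_right _ _) (abs_nonneg _)

lemma IsMildSolution.eqOn_of_truncPow {R : ℝ} (hR : 0 ≤ R) (hT : 0 ≤ T)
    (h : IsMildSolution γ₁ γ₂ (truncPow p R) (truncPow q R) u₀ v₀ T u v)
    (h' : IsMildSolution γ₁ γ₂ (truncPow p R) (truncPow q R) u₀ v₀ T u' v') :
    EqOn u u' (Icc 0 T) ∧ EqOn v v' (Icc 0 T) := by
  have h1 : 0 ≤ p * R ^ (p - 1) := mul_nonneg (by linarith) (Real.rpow_nonneg hR _)
  refine IsMildSolution.eqOn_of_lipschitz hγ₁ hγ₂ (continuous_truncPow hp R)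
    (truncPow_zero hp hR) (continuous_truncPow hq R) (truncPow_zero hq hR)
    (L := max (p * R ^ (p - 1)) (q * R ^ (q - 1))) (le_max_of_le_left h1)
    (fun a b => (truncPow_lipschitz hp hR a b).trans ?_)
    (fun a b => (truncPow_lipschitz hq hR a b).trans ?_) hT h h'
  · exact mul_le_mul_of_nonneg_right (le_max_left _ _) (abs_nonneg _)
  · exact mul_le_mul_of_nonneg_right (le_max_right _ _) (abs_nonneg _)

omit hγ₁ hγ₂ hp hq in
lemma IsMildSolution.truncPow {R : ℝ}
    (h : IsMildSolution γ₁ γ₂ (fun s => |s| ^ p) (fun s => |s| ^ q) u₀ v₀ T u v)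
    (hu : ∀ t ∈ Icc 0 T, ‖u t‖ ≤ R) (hv : ∀ t ∈ Icc 0 T, ‖v t‖ ≤ R) :
    IsMildSolution γ₁ γ₂ (truncPow p R) (truncPow q R) u₀ v₀ T u v :=
  h.congr (fun _ _ => rfl) (fun _ _ => rfl)
    (fun t ht _ => truncPow_eq ((abs_apply_le_norm _ _).trans (hv t ht)))
    (fun t ht _ => truncPow_eq ((abs_apply_le_norm _ _).trans (hu t ht)))

omit hγ₁ hγ₂ hp hq in
lemma IsMildSolution.of_truncPow {R : ℝ}
    (h : IsMildSolution γ₁ γ₂ (FracDiffusion.truncPow p R) (FracDiffusion.truncPow q R) u₀ v₀ T u v)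
    (hu : ∀ t ∈ Icc 0 T, ‖u t‖ ≤ R) (hv : ∀ t ∈ Icc 0 T, ‖v t‖ ≤ R) :
    IsMildSolution γ₁ γ₂ (fun s => |s| ^ p) (fun s => |s| ^ q) u₀ v₀ T u v :=
  h.congr (fun _ _ => rfl) (fun _ _ => rfl)
    (fun t ht _ => (truncPow_eq ((abs_apply_le_norm _ _).trans (hv t ht))).symm)
    (fun t ht _ => (truncPow_eq ((abs_apply_le_norm _ _).trans (hu t ht))).symm)

omit hγ₁ hγ₂ hp hq in
lemma IsMildSolution.exists_bound {f g : ℝ → ℝ}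
    (h : IsMildSolution γ₁ γ₂ f g u₀ v₀ T u v) :
    ∃ R, 0 ≤ R ∧ ∀ t ∈ Icc 0 T, ‖u t‖ ≤ R ∧ ‖v t‖ ≤ R := by
  obtain ⟨a, ha⟩ := isCompact_Icc.exists_bound_of_continuousOn h.1
  obtain ⟨b, hb⟩ := isCompact_Icc.exists_bound_of_continuousOn h.2
  exact ⟨max 0 (max a b), le_max_left _ _, fun t ht =>
    ⟨(ha t ht).trans (by simp), (hb t ht).trans (by simp)⟩⟩

theorem IsMildSolution.eqOn (hT : 0 ≤ T)
    (h : IsMildSolution γ₁ γ₂ (fun s => |s| ^ p) (fun s => |s| ^ q) u₀ v₀ T u v)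
    (h' : IsMildSolution γ₁ γ₂ (fun s => |s| ^ p) (fun s => |s| ^ q) u₀ v₀ T u' v') :
    EqOn u u' (Icc 0 T) ∧ EqOn v v' (Icc 0 T) := by
  obtain ⟨R, hR, hb⟩ := h.exists_bound
  obtain ⟨R', hR', hb'⟩ := h'.exists_bound
  have h1 := h.truncPow (R := max R R') (fun t ht => (hb t ht).1.trans (le_max_left _ _))
    (fun t ht => (hb t ht).2.trans (le_max_left _ _))
  have h2 := h'.truncPow (R := max R R') (fun t ht => (hb' t ht).1.trans (le_max_right _ _))
    (fun t ht => (hb' t ht).2.trans (le_max_right _ _))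
  exact IsMildSolution.eqOn_of_truncPow hγ₁ hγ₂ hp hq (le_max_of_le_left hR) hT h1 h2

end pow

end

section

/-! ### Positivity and nonexistence of solutions on large time intervals -/

variable {N : ℕ}

lemma volterra_fracK_nonneg {α : ℝ} (hα : 0 < α ∧ α < 1)
    {F : ℝ → C₀(EuclideanSpace ℝ (Fin N), ℝ)} {t : ℝ} (ht : 0 ≤ t)
    (hF : ContinuousOn F (Icc 0 t)) (hF0 : ∀ s ∈ Icc 0 t, ∀ x, 0 ≤ F s x)
    (x : EuclideanSpace ℝ (Fin N)) : 0 ≤ volterra (fracK hα) F t x := by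
  rw [volterra_fracK_apply hα ht hF]
  refine intervalIntegral.integral_nonneg ht fun s hs => ?_
  rw [← fracK_apply hα]
  exact fracK_nonneg hα (by linarith [hs.2]) (hF0 s hs) x

section

variable {γ₁ γ₂ p q : ℝ} (hγ₁ : 0 < γ₁ ∧ γ₁ < 1) (hγ₂ : 0 < γ₂ ∧ γ₂ < 1)
  (hp : 1 ≤ p) (hq : 1 ≤ q) {u₀ v₀ : C₀(EuclideanSpace ℝ (Fin N), ℝ)} {T : ℝ}
  {u v : ℝ → C₀(EuclideanSpace ℝ (Fin N), ℝ)}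

/-- The first equation of the system in Bochner form, with the continuity it rests on. -/
lemma IsMildSolution.eq_pow
    (h : IsMildSolution γ₁ γ₂ (fun s => |s| ^ p) (fun s => |s| ^ q) u₀ v₀ T u v)
    {t : ℝ} (ht : t ∈ Icc 0 T) :
    ContinuousOn (fun s => postComp (continuous_abs_rpow hp) (abs_zero_rpow hp) (v s)) (Icc 0 t) ∧
    u t = fracP hγ₁ t u₀ + volterra (fracK hγ₁)
      (fun s => postComp (continuous_abs_rpow hp) (abs_zero_rpow hp) (v s)) t := by
  have hsub : Icc 0 t ⊆ Icc 0 T := Icc_subset_Icc_right ht.2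
  have hF := (continuous_postComp (N := N) (continuous_abs_rpow hp)
    (abs_zero_rpow hp)).comp_continuousOn (h.2.mono hsub)
  refine ⟨hF, ?_⟩
  ext x
  rw [h.3 t ht x, ZeroAtInftyContinuousMap.add_apply, fracP_apply,
    volterra_fracK_apply hγ₁ (F := fun s => postComp (continuous_abs_rpow hp)
      (abs_zero_rpow hp) (v s)) ht.1 hF]
  rfl

include hγ₁ hp in
-- No maximum principle is involved: the source `|v| ^ p` is nonnegative whatever the sign of `v`,
-- and both solution operators preserve positivity.
lemma IsMildSolution.nonneg
    (h : IsMildSolution γ₁ γ₂ (fun s => |s| ^ p) (fun s => |s| ^ q) u₀ v₀ T u v)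
    (hu₀ : ∀ x, 0 ≤ u₀ x) {t : ℝ} (ht : t ∈ Icc 0 T) (x : EuclideanSpace ℝ (Fin N)) :
    0 ≤ u t x := by
  obtain ⟨hF, he⟩ := h.eq_pow hγ₁ hp ht
  rw [he]
  exact add_nonneg (fracP_nonneg hγ₁ t hu₀ x) (volterra_fracK_nonneg hγ₁ ht.1 hF
    (fun s _ x => Real.rpow_nonneg (abs_nonneg _) _) x)

end

/-! ### Averaged inequalities and nonexistence on long intervals -/

/-- Jensen's inequality for the heat semigroup. -/
lemma rpow_heatOp_le {p : ℝ} (hp : 1 ≤ p) (a : ℝ) {w : C₀(EuclideanSpace ℝ (Fin N), ℝ)}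
    (hw : ∀ x, 0 ≤ w x) (x : EuclideanSpace ℝ (Fin N)) :
    (heatOp a w x) ^ p ≤
      heatOp a (postComp (continuous_abs_rpow hp) (abs_zero_rpow hp) w) x := by
  have hc : ∀ w : C₀(EuclideanSpace ℝ (Fin N), ℝ),
      Integrable (fun z => w (x - √a • z)) (gaussMeasure N) := fun w =>
    Integrable.of_bound (w.continuous.comp
      (continuous_const.sub (continuous_const_smul _))).aestronglyMeasurable ‖w‖
      (Eventually.of_forall fun z => abs_apply_le_norm w _)
  rw [heatOp_apply, heatOp_apply, heat_eq_integral_gaussMeasure, heat_eq_integral_gaussMeasure]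
  have h := (convexOn_rpow hp).map_integral_le (μ := gaussMeasure N)
    (f := fun z => w (x - √a • z))
    (continuousOn_id.rpow_const fun _ _ => Or.inr (by linarith)) isClosed_Ici
    (Eventually.of_forall fun z => hw _) (hc w) ?_
  · refine h.trans (le_of_eq (integral_congr_ae (Eventually.of_forall fun z => ?_)))
    simp only [postComp_apply, abs_of_nonneg (hw _)]
  · refine (hc (postComp (continuous_abs_rpow hp) (abs_zero_rpow hp) w)).congr
      (Eventually.of_forall fun z => ?_)
    simp only [postComp_apply, abs_of_nonneg (hw _), Function.comp_apply]

/-- Lower bound for the heat average of a convolution over a short window. -/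
lemma heatOp_volterra_ge {α : ℝ} (hα : 0 < α ∧ α < 1) {c a : ℝ} (hc : 0 < c)
    (h : ∀ t : ℝ, 0 ≤ t → t ^ α ≤ a → ∀ w : C₀(EuclideanSpace ℝ (Fin N), ℝ),
      (∀ x, 0 ≤ w x) → ∀ x, c * heatOp a w x ≤ heatOp a (fracS hα t w) x)
    {F : ℝ → C₀(EuclideanSpace ℝ (Fin N), ℝ)} {σ t m : ℝ} (hσ : 0 ≤ σ) (hσt : σ ≤ t)
    (hta : (t - σ) ^ α ≤ a) (hF : ContinuousOn F (Icc 0 t))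
    (hF0 : ∀ s ∈ Icc 0 t, ∀ x, 0 ≤ F s x) (x : EuclideanSpace ℝ (Fin N))
    (hm : ∀ s ∈ Icc σ t, m ≤ heatOp a (F s) x) :
    c / α * m * (t - σ) ^ α ≤ heatOp a (volterra (fracK hα) F t) x := by
  have ht : 0 ≤ t := hσ.trans hσt
  have hi := (isVolterraKernel_fracK hα).intervalIntegrable_of_continuousOn ht hF
  set l := (evalCLM x).comp (heatOp (N := N) a) with hl
  have e : heatOp a (volterra (fracK hα) F t) x =
      ∫ s in (0 : ℝ)..t, l (fracK hα (t - s) (F s)) :=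
    (l.intervalIntegral_comp_comm hi).symm
  have hi' : IntervalIntegrable (fun s => l (fracK hα (t - s) (F s))) volume 0 t :=
    ⟨l.integrable_comp hi.1, l.integrable_comp hi.2⟩
  have hnn : ∀ s ∈ Icc 0 t, 0 ≤ l (fracK hα (t - s) (F s)) := fun s hs =>
    heatOp_nonneg a (fracK_nonneg hα (by linarith [hs.2]) (hF0 s hs)) x
  have hpow : IntervalIntegrable (fun s => c * m * (t - s) ^ (α - 1)) volume σ t := by
    have := (intervalIntegral.intervalIntegrable_rpow' (a := 0) (b := t - σ)
      (by linarith [hα.1] : -1 < α - 1)).comp_sub_left t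
    simp only [sub_zero, sub_sub_cancel] at this
    exact this.symm.const_mul _
  have h2 : ∫ s in σ..t, c * m * (t - s) ^ (α - 1) = c / α * m * (t - σ) ^ α := by
    rw [intervalIntegral.integral_const_mul,
      intervalIntegral.integral_comp_sub_left (fun s => s ^ (α - 1)) t, sub_self,
      integral_rpow (Or.inl (by linarith [hα.1])), sub_add_cancel,
      Real.zero_rpow hα.1.ne', sub_zero]
    ring
  rw [e, ← h2, ← intervalIntegral.integral_add_adjacent_intervals (b := σ)
    (hi'.mono_set (by rw [uIcc_of_le hσ, uIcc_of_le ht]; exact Icc_subset_Icc_right hσt))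
    (hi'.mono_set (by rw [uIcc_of_le hσt, uIcc_of_le ht]; exact Icc_subset_Icc_left hσ))]
  have h3 : 0 ≤ ∫ s in (0 : ℝ)..σ, l (fracK hα (t - s) (F s)) :=
    intervalIntegral.integral_nonneg hσ fun s hs => hnn s ⟨hs.1, hs.2.trans hσt⟩
  have h4 : ∫ s in σ..t, c * m * (t - s) ^ (α - 1) ≤
      ∫ s in σ..t, l (fracK hα (t - s) (F s)) := by
    refine intervalIntegral.integral_mono_on hσt hpow (hi'.mono_set (by
      rw [uIcc_of_le hσt, uIcc_of_le ht]; exact Icc_subset_Icc_left hσ)) fun s hs => ?_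
    have hts : 0 ≤ t - s := by linarith [hs.2]
    have h5 := h (t - s) hts ((Real.rpow_le_rpow hts (by linarith [hs.1]) hα.1.le).trans hta)
      (F s) (hF0 s ⟨hσ.trans hs.1, hs.2⟩) x
    have h6 := mul_le_mul_of_nonneg_left (hm s hs) hc.le
    have h7 : l (fracK hα (t - s) (F s)) =
        (t - s) ^ (α - 1) * heatOp a (fracS hα (t - s) (F s)) x := by
      rw [fracK_apply_eq, map_smul, smul_eq_mul]; rfl
    rw [h7, mul_comm]
    exact mul_le_mul_of_nonneg_left (h6.trans h5) (Real.rpow_nonneg hts _)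
  linarith

/-- The iteration that rules out large lower bounds in a system of Volterra inequalities. -/
lemma false_of_volterra_iteration {p q γ₁ γ₂ T A c₁ c₂ M : ℝ}
    (hpq : 1 < p * q) (hT : 0 < T) (hA : 0 < A) (hAT : A ≤ T)
    (hc₁ : 0 < c₁) (hc₂ : 0 < c₂) (hM : 0 < M) {U V : ℝ → ℝ}
    (hU : ∀ σ t m, 0 ≤ σ → σ ≤ t → t ≤ T → 0 ≤ m → (∀ s ∈ Icc σ t, m ≤ V s) →
      c₁ * m ^ p * (t - σ) ^ γ₁ ≤ U t)
    (hV : ∀ σ t m, 0 ≤ σ → σ ≤ t → t ≤ T → t - σ ≤ A → 0 ≤ m → (∀ s ∈ Icc σ t, m ≤ U s) →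
      c₂ * m ^ q * (t - σ) ^ γ₂ ≤ V t)
    (hU0 : ∀ t ∈ Icc 0 T, M ≤ U t)
    (hbig : max 2 ((2 : ℝ) ^ ((γ₂ * p + γ₁) / (p * q - 1))) ≤
      c₁ * c₂ ^ p * (1 / 8) ^ (γ₂ * p + γ₁) * (A ^ (γ₂ * p) * T ^ γ₁) * M ^ (p * q - 1)) :
    False := by
  -- The windows halve at each round, which costs a factor `2 ^ (γ₂ p + γ₁)` per round; this `D` is
  -- large enough that the gain `D ^ (p q - 1)` pays for it.
  set D := max 2 ((2 : ℝ) ^ ((γ₂ * p + γ₁) / (p * q - 1))) with hD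
  have hD2 : 2 ≤ D := le_max_left _ _
  have hD0 : 0 < D := by linarith
  have hDpow : (2 : ℝ) ^ (γ₂ * p + γ₁) ≤ D ^ (p * q - 1) := by
    calc (2 : ℝ) ^ (γ₂ * p + γ₁) =
        ((2 : ℝ) ^ ((γ₂ * p + γ₁) / (p * q - 1))) ^ (p * q - 1) := by
          rw [← Real.rpow_mul (by norm_num), div_mul_cancel₀ _ (by linarith)]
      _ ≤ _ := Real.rpow_le_rpow (by positivity) (le_max_right _ _) (by linarith)
  -- The left endpoints never pass `T / 2`, so every bound holds at `t = T`, which makes `U T`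
  -- exceed all `M D ^ j`.
  have key : ∀ j : ℕ, ∀ t ∈ Icc (T / 2 * (1 - (1 / 2) ^ j)) T, M * D ^ j ≤ U t := by
    intro j
    induction j with
    | zero => intro t ht; simpa using hU0 t (by simpa using ht)
    | succ j ih =>
      set e : ℝ := (1 / 2) ^ j with he
      have he0 : 0 < e := by positivity
      have he1 : e ≤ 1 := pow_le_one₀ (by norm_num) (by norm_num)
      have hMj : 0 < M * D ^ j := by positivity
      have h1 : ∀ t ∈ Icc (T / 2 * (1 - e) + e / 8 * T) T,
          c₂ * (M * D ^ j) ^ q * (e / 8 * A) ^ γ₂ ≤ V t := by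
        intro t ht
        have h8 : e / 8 * A ≤ e / 8 * T := by gcongr
        have h9 : 0 < e / 8 * A := by positivity
        have h10 : 0 ≤ T / 2 * (1 - e) := mul_nonneg (by positivity) (by linarith)
        have := hV (t - e / 8 * A) t (M * D ^ j) (by linarith [ht.1]) (by linarith) ht.2
          (by rw [sub_sub_cancel]; nlinarith) hMj.le
          (fun s hs => ih s ⟨by linarith [hs.1, ht.1], by linarith [hs.2, ht.2]⟩)
        rwa [sub_sub_cancel] at this
      intro t ht
      rw [pow_succ, ← he] at ht
      have h9 : 0 < e / 8 * T := by positivity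
      have h10 : 0 ≤ T / 2 * (1 - e) := mul_nonneg (by positivity) (by linarith)
      -- The advance `e T / 4` of the left endpoint is shared between two windows: one for passing
      -- from `U` to `V`, whose length `e A / 8` fits because `A ≤ T`, and one for returning to `U`.
      have h11 : T / 2 * (1 - e * (1 / 2)) = T / 2 * (1 - e) + e / 8 * T + e / 8 * T := by ring
      have ht1 := ht.1
      rw [h11] at ht1
      have h2 := hU (t - e / 8 * T) t _ (by linarith) (by linarith) ht.2
        (by positivity : 0 ≤ c₂ * (M * D ^ j) ^ q * (e / 8 * A) ^ γ₂)
        (fun s hs => h1 s ⟨by linarith [hs.1], hs.2.trans ht.2⟩)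
      rw [sub_sub_cancel] at h2
      refine le_trans ?_ h2
      have e1 : c₁ * (c₂ * (M * D ^ j) ^ q * (e / 8 * A) ^ γ₂) ^ p * (e / 8 * T) ^ γ₁ =
          (c₁ * c₂ ^ p * (1 / 8) ^ (γ₂ * p + γ₁) * (A ^ (γ₂ * p) * T ^ γ₁) * M ^ (p * q - 1)) *
          (e ^ (γ₂ * p + γ₁) * (D ^ j) ^ (p * q - 1)) * (M * D ^ j) := by
        have a1 : (M * D ^ j) ^ (q * p) = M ^ (p * q - 1) * (D ^ j) ^ (p * q - 1) * (M * D ^ j) := by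
          rw [← Real.mul_rpow hM.le (by positivity), ← Real.rpow_add_one hMj.ne']
          congr 1; ring
        rw [Real.mul_rpow (by positivity) (by positivity), Real.mul_rpow (by positivity)
          (by positivity), ← Real.rpow_mul hMj.le, a1, ← Real.rpow_mul (by positivity),
          div_eq_mul_one_div e 8, Real.mul_rpow (by positivity) hA.le,
          Real.mul_rpow (by positivity) hT.le, Real.mul_rpow he0.le (by norm_num),
          Real.mul_rpow he0.le (by norm_num), Real.rpow_add he0, Real.rpow_add (by norm_num)]
        ring
      have e2 : 1 ≤ e ^ (γ₂ * p + γ₁) * (D ^ j) ^ (p * q - 1) := by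
        have b1 : e ^ (γ₂ * p + γ₁) = (((2 : ℝ) ^ (γ₂ * p + γ₁)) ^ j)⁻¹ := by
          rw [he, ← Real.rpow_natCast, ← Real.rpow_natCast, ← Real.rpow_mul (by norm_num),
            ← Real.rpow_mul (by norm_num), one_div, Real.inv_rpow (by norm_num), mul_comm]
        have b2 : (D ^ j) ^ (p * q - 1) = (D ^ (p * q - 1)) ^ j := by
          rw [← Real.rpow_natCast, ← Real.rpow_natCast, ← Real.rpow_mul hD0.le,
            ← Real.rpow_mul hD0.le, mul_comm]
        rw [b1, b2, inv_mul_eq_div, one_le_div (by positivity)]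
        gcongr
      rw [e1]
      calc M * D ^ (j + 1) = D * 1 * (M * D ^ j) := by ring
        _ ≤ _ := by gcongr
  have hlim : Tendsto (fun j : ℕ => M * D ^ j) atTop atTop :=
    (tendsto_pow_atTop_atTop_of_one_lt (by linarith)).const_mul_atTop hM
  obtain ⟨j, hj⟩ := (hlim.eventually (eventually_gt_atTop (U T))).exists
  have h1 := key j T ⟨?_, le_rfl⟩
  · linarith
  · have : (0 : ℝ) < (1 / 2) ^ j := by positivity
    nlinarith

/-- The powers of `T` in the iteration criterion are `γ₁` and `p min(γ₁, γ₂)` from the two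
convolutions and `-(N/2) γ₁ (pq - 1)` from the decay of the linear part; `hcrit` says that their sum
is positive. -/
theorem eventually_not_isMildSolution {γ₁ γ₂ p q : ℝ} (hγ₁ : 0 < γ₁ ∧ γ₁ < 1)
    (hγ₂ : 0 < γ₂ ∧ γ₂ < 1) (hp : 1 ≤ p) (hq : 1 ≤ q) (hpq : 1 < p * q)
    (hcrit : (N : ℝ) / 2 * γ₁ * (p * q - 1) < γ₁ + p * min γ₁ γ₂)
    {u₀ v₀ : C₀(EuclideanSpace ℝ (Fin N), ℝ)} (hu₀ : ∀ x, 0 ≤ u₀ x) (hv₀ : ∀ x, 0 ≤ v₀ x)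
    (hu₀_ne : ∃ x, u₀ x ≠ 0) : ∀ᶠ T : ℝ in atTop, ∀ u v : ℝ → C₀(EuclideanSpace ℝ (Fin N), ℝ),
      ¬ IsMildSolution γ₁ γ₂ (fun s => |s| ^ p) (fun s => |s| ^ q) u₀ v₀ T u v := by
  obtain ⟨c₁, hc₁, h₁⟩ := exists_heatOp_frac_ge hγ₁ N
  obtain ⟨c₂, hc₂, h₂⟩ := exists_heatOp_frac_ge hγ₂ N
  have hg1 := hγ₁.1
  have hg2 := hγ₂.1
  set m₀ := heatOp 1 u₀ 0 with hm₀
  have hm₀pos : 0 < m₀ := heatOp_pos one_pos hu₀ hu₀_ne 0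
  set C := c₁ / γ₁ * (c₂ / γ₂) ^ p * (1 / 8) ^ (γ₂ * p + γ₁) * (c₁ * m₀) ^ (p * q - 1) with hC
  have hC0 : 0 < C := by positivity
  set E := γ₁ + p * min γ₁ γ₂ - (N : ℝ) / 2 * γ₁ * (p * q - 1) with hE
  have hlim : Tendsto (fun T : ℝ => C * T ^ E) atTop atTop :=
    (tendsto_rpow_atTop (by linarith)).const_mul_atTop hC0
  filter_upwards [hlim.eventually (eventually_ge_atTop
    (max 2 ((2 : ℝ) ^ ((γ₂ * p + γ₁) / (p * q - 1))))), eventually_ge_atTop 1]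
    with T hTbig hT1 u v hmild
  have hT : 0 < T := by linarith
  set a := T ^ γ₁ with ha
  have ha1 : 1 ≤ a := Real.one_le_rpow hT1 hg1.le
  have ha0 : 0 < a := by linarith
  set A := T ^ (min γ₁ γ₂ / γ₂) with hA
  have hA0 : 0 < A := by positivity
  have hAT : A ≤ T := by
    conv_rhs => rw [← Real.rpow_one T]
    exact Real.rpow_le_rpow_of_exponent_le hT1 ((div_le_one hg2).2 (min_le_right _ _))
  have hAa : A ^ γ₂ ≤ a := by
    rw [hA, ← Real.rpow_mul hT.le, div_mul_cancel₀ _ hg2.ne']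
    exact Real.rpow_le_rpow_of_exponent_le hT1 (min_le_left _ _)
  have hun : ∀ t ∈ Icc 0 T, ∀ x, 0 ≤ u t x := fun t ht => hmild.nonneg hγ₁ hp hu₀ ht
  have hvn : ∀ t ∈ Icc 0 T, ∀ x, 0 ≤ v t x := fun t ht => hmild.swap.nonneg hγ₂ hq hv₀ ht
  have hpn : ∀ {r : ℝ} (hr : 1 ≤ r) (w : C₀(EuclideanSpace ℝ (Fin N), ℝ)) x,
      0 ≤ postComp (continuous_abs_rpow hr) (abs_zero_rpow hr) w x := fun hr w x =>
    Real.rpow_nonneg (abs_nonneg _) _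
  refine false_of_volterra_iteration (p := p) (q := q) (γ₁ := γ₁) (γ₂ := γ₂) (T := T) (A := A)
    (c₁ := c₁ / γ₁) (c₂ := c₂ / γ₂) (M := c₁ * (a ^ (-((N : ℝ) / 2)) * m₀))
    (U := fun t => heatOp a (u t) 0)
    (V := fun t => heatOp a (v t) 0) hpq hT hA0 hAT (by positivity)
    (by positivity) (by positivity) ?_ ?_ ?_ ?_
  · intro σ t m hσ hσt htT hm0 hm
    have ht : t ∈ Icc 0 T := ⟨hσ.trans hσt, htT⟩
    obtain ⟨hF, he⟩ := hmild.eq_pow hγ₁ hp ht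
    have := heatOp_volterra_ge hγ₁ hc₁ (fun t ht hta w hw x => (h₁ a t ha0 ht hta w hw x).2) hσ hσt
      (Real.rpow_le_rpow (by linarith) (by linarith) hg1.le : (t - σ) ^ γ₁ ≤ a) hF
      (fun s _ => hpn hp (v s)) 0 (m := m ^ p) (fun s hs => ?_)
    · rw [he, map_add, ZeroAtInftyContinuousMap.add_apply]
      linarith [heatOp_nonneg a (fracP_nonneg hγ₁ t hu₀) 0]
    · have hs' : s ∈ Icc 0 T := ⟨hσ.trans hs.1, hs.2.trans htT⟩
      exact (Real.rpow_le_rpow hm0 (hm s hs) (by linarith)).trans (rpow_heatOp_le hp a (hvn s hs') 0)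
  · intro σ t m hσ hσt htT htA hm0 hm
    have ht : t ∈ Icc 0 T := ⟨hσ.trans hσt, htT⟩
    obtain ⟨hF, he⟩ := hmild.swap.eq_pow hγ₂ hq ht
    have := heatOp_volterra_ge hγ₂ hc₂ (fun t ht hta w hw x => (h₂ a t ha0 ht hta w hw x).2) hσ hσt
      ((Real.rpow_le_rpow (by linarith) htA hg2.le).trans hAa) hF
      (fun s _ => hpn hq (u s)) 0 (m := m ^ q) (fun s hs => ?_)
    · rw [he, map_add, ZeroAtInftyContinuousMap.add_apply]
      linarith [heatOp_nonneg a (fracP_nonneg hγ₂ t hv₀) 0]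
    · have hs' : s ∈ Icc 0 T := ⟨hσ.trans hs.1, hs.2.trans htT⟩
      exact (Real.rpow_le_rpow hm0 (hm s hs) (by linarith)).trans (rpow_heatOp_le hq a (hun s hs') 0)
  · intro t ht
    obtain ⟨hF, he⟩ := hmild.eq_pow hγ₁ hp ht
    have h3 := (h₁ a t ha0 ht.1 (Real.rpow_le_rpow ht.1 ht.2 hg1.le) u₀ hu₀ 0).1
    have h4 := heatOp_nonneg a (volterra_fracK_nonneg hγ₁ ht.1 hF (fun s _ => hpn hp (v s))) 0
    have h5 := heatOp_le_heatOp one_pos ha1 hu₀ 0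
    rw [one_div, Real.inv_rpow ha0.le, ← Real.rpow_neg ha0.le] at h5
    have h6 := mul_le_mul_of_nonneg_left h5 hc₁.le
    rw [he, map_add, ZeroAtInftyContinuousMap.add_apply]
    linarith
  · refine hTbig.trans (le_of_eq ?_)
    have e1 : A ^ (γ₂ * p) = T ^ (p * min γ₁ γ₂) := by
      rw [hA, ← Real.rpow_mul hT.le]
      congr 1; field_simp
    have e2 : (c₁ * (a ^ (-((N : ℝ) / 2)) * m₀)) ^ (p * q - 1) =
        (c₁ * m₀) ^ (p * q - 1) * T ^ (-((N : ℝ) / 2 * γ₁ * (p * q - 1))) := by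
      rw [show c₁ * (a ^ (-((N : ℝ) / 2)) * m₀) = (c₁ * m₀) * a ^ (-((N : ℝ) / 2)) by ring,
        Real.mul_rpow (by positivity) (by positivity), ha, ← Real.rpow_mul hT.le,
        ← Real.rpow_mul hT.le]
      congr 2; ring
    have e3 : T ^ E = T ^ (p * min γ₁ γ₂) * T ^ γ₁ * T ^ (-((N : ℝ) / 2 * γ₁ * (p * q - 1))) := by
      rw [← Real.rpow_add hT, ← Real.rpow_add hT, hE]
      congr 1; ring
    rw [e1, e2, e3, hC]
    ring

end

/-! ### Comparison of the solution kernels at different times -/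

/-- Read the factor `θ` as the length of `(θ, 2θ]`, spread `h θ` over that interval by the doubling
bound `hK`, and apply Fubini. The density `φ` is thereby replaced by its mass in windows, which
moments control even where no pointwise decay of `φ` is known. -/
lemma integral_mul_le_integral_window {φ h : ℝ → ℝ} {K M : ℝ} (hφ : Continuous φ)
    (hφ0 : ∀ θ, 0 < θ → 0 ≤ φ θ) (hφi : IntegrableOn (fun θ => θ * φ θ) (Ioi 0))
    (hh : Continuous h) (hh0 : ∀ r, 0 ≤ h r) (hhM : ∀ r, h r ≤ M)
    (hK : ∀ a b, 0 < a → a ≤ b → b ≤ 2 * a → h a ≤ K * h b) :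
    IntegrableOn (fun η => (∫ θ in Ico (η / 2) η, φ θ) * h η) (Ioi 0) ∧
    ∫ θ in Ioi (0 : ℝ), θ * φ θ * h θ ≤
      K * ∫ η in Ioi (0 : ℝ), (∫ θ in Ico (η / 2) η, φ θ) * h η := by
  set μ : Measure ℝ := volume.restrict (Ioi 0) with hμ
  set D : Set (ℝ × ℝ) := {z | z.1 < z.2 ∧ z.2 ≤ 2 * z.1} with hD
  have hDm : MeasurableSet D := (measurableSet_lt measurable_fst measurable_snd).inter
    (measurableSet_le measurable_snd (measurable_fst.const_mul 2))
  set G : ℝ × ℝ → ℝ := D.indicator fun z => φ z.1 * h z.2 with hG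
  have hGm : AEStronglyMeasurable G (μ.prod μ) :=
    (((hφ.comp continuous_fst).mul (hh.comp continuous_snd)).measurable.indicator
      hDm).aestronglyMeasurable
  have hcφ : ∀ θ, Continuous fun η => φ θ * h η := fun θ => continuous_const.mul hh
  have e1 : ∀ θ, (fun η => G (θ, η)) = (Ioc θ (2 * θ)).indicator fun η => φ θ * h η := by
    intro θ; ext η; simp only [hG, hD, indicator, mem_ofPred_eq, mem_Ioc]
  have e2 : ∀ η, (fun θ => G (θ, η)) = (Ico (η / 2) η).indicator fun θ => φ θ * h η := by
    intro η; ext θ; simp only [hG, hD, indicator, mem_ofPred_eq, mem_Ico]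
    congr 1
    exact propext ⟨fun h => ⟨by linarith [h.2], h.1⟩, fun h => ⟨h.2, by linarith [h.1]⟩⟩
  have i1 : ∀ θ ∈ Ioi (0 : ℝ), ∫ η, G (θ, η) ∂μ = ∫ η in Ioc θ (2 * θ), φ θ * h η := by
    intro θ hθ
    rw [e1, integral_indicator measurableSet_Ioc, hμ, Measure.restrict_restrict measurableSet_Ioc,
      inter_eq_self_of_subset_left (show Ioc θ (2 * θ) ⊆ Ioi 0 from
        fun η hη => (mem_Ioi.1 hθ).trans hη.1)]
  have i2 : ∀ η ∈ Ioi (0 : ℝ), ∫ θ, G (θ, η) ∂μ = (∫ θ in Ico (η / 2) η, φ θ) * h η := by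
    intro η hη
    rw [e2, integral_indicator measurableSet_Ico, hμ, Measure.restrict_restrict measurableSet_Ico,
      inter_eq_self_of_subset_left (show Ico (η / 2) η ⊆ Ioi 0 from
        fun θ hθ => (half_pos (mem_Ioi.1 hη)).trans_le hθ.1), integral_mul_const]
  have hG0 : ∀ θ ∈ Ioi (0 : ℝ), ∀ η, 0 ≤ G (θ, η) := fun θ hθ η =>
    by
    rw [hG]; exact indicator_apply_nonneg fun _ => mul_nonneg (hφ0 θ hθ) (hh0 η)
  have hvol : ∀ θ ∈ Ioi (0 : ℝ), ∀ c : ℝ, ∫ _ in Ioc θ (2 * θ), c = θ * c := by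
    intro θ hθ c
    have hθ' : 0 < θ := hθ
    rw [setIntegral_const, Real.volume_real_Ioc_of_le (by linarith), smul_eq_mul]
    ring
  have b1 : ∀ θ ∈ Ioi (0 : ℝ), ∫ η in Ioc θ (2 * θ), φ θ * h η ≤ θ * φ θ * M := by
    intro θ hθ
    rw [mul_assoc, ← hvol θ hθ]
    exact setIntegral_mono_on (hcφ θ).integrableOn_Ioc (integrableOn_const (by simp))
      measurableSet_Ioc fun η _ => mul_le_mul_of_nonneg_left (hhM η) (hφ0 θ hθ)
  have hint : Integrable G (μ.prod μ) := by
    refine (integrable_prod_iff hGm).2 ⟨(ae_restrict_iff' measurableSet_Ioi).2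
      (Eventually.of_forall fun θ hθ => ?_), ?_⟩
    · rw [e1]
      exact ((integrable_indicator_iff measurableSet_Ioc).2 (hcφ θ).integrableOn_Ioc).restrict
    · refine (hφi.mul_const M).mono' hGm.norm.integral_prod_right'
        ((ae_restrict_iff' measurableSet_Ioi).2 (Eventually.of_forall fun θ hθ => ?_))
      simp only [Real.norm_of_nonneg (hG0 θ hθ _)]
      rw [i1 θ hθ, Real.norm_of_nonneg]
      · exact b1 θ hθ
      · exact setIntegral_nonneg measurableSet_Ioc fun η _ => mul_nonneg (hφ0 θ hθ) (hh0 η)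
  refine ⟨(integrableOn_congr_fun i2 measurableSet_Ioi).1 hint.integral_prod_right, ?_⟩
  calc ∫ θ in Ioi (0 : ℝ), θ * φ θ * h θ ≤ ∫ θ in Ioi (0 : ℝ), K * ∫ η, G (θ, η) ∂μ := by
        refine integral_mono_of_nonneg ((ae_restrict_iff' measurableSet_Ioi).2
          (Eventually.of_forall fun θ hθ => mul_nonneg (mul_nonneg (le_of_lt hθ) (hφ0 θ hθ))
            (hh0 θ))) (hint.integral_prod_left.const_mul K)
          ((ae_restrict_iff' measurableSet_Ioi).2 (Eventually.of_forall fun θ hθ => ?_))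
        have h1 : θ * (φ θ * h θ) ≤ ∫ η in Ioc θ (2 * θ), K * (φ θ * h η) := by
          rw [← hvol θ hθ]
          refine setIntegral_mono_on (integrableOn_const (by simp))
            ((hcφ θ).integrableOn_Ioc.const_mul K) measurableSet_Ioc fun η hη => ?_
          have := mul_le_mul_of_nonneg_left (hK θ η hθ hη.1.le hη.2) (hφ0 θ hθ)
          linarith
        rw [integral_const_mul] at h1
        simp only [i1 θ hθ]
        linarith
    _ = K * ∫ η in Ioi (0 : ℝ), (∫ θ in Ico (η / 2) η, φ θ) * h η := by
        rw [integral_const_mul, integral_integral_swap (f := fun θ η => G (θ, η)) hint]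
        congr 1
        exact setIntegral_congr_fun measurableSet_Ioi i2

/-- The weight `min(r^(κ-1), r^(-2))`. -/
def tailWeight (κ r : ℝ) : ℝ := min (r ^ (κ - 1)) (r ^ (-2 : ℝ))

lemma tailWeight_nonneg (κ : ℝ) {r : ℝ} (hr : 0 < r) : 0 ≤ tailWeight κ r :=
  le_min (Real.rpow_nonneg hr.le _) (Real.rpow_nonneg hr.le _)

lemma tailWeight_anti {κ : ℝ} (hκ : κ ≤ 1) {r r' : ℝ} (hr : 0 < r) (h : r ≤ r') :
    tailWeight κ r' ≤ tailWeight κ r :=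
  min_le_min (Real.rpow_le_rpow_of_nonpos hr h (by linarith))
    (Real.rpow_le_rpow_of_nonpos hr h (by norm_num))

lemma integrableOn_tailWeight {κ : ℝ} (hκ : 0 < κ) : IntegrableOn (tailWeight κ) (Ioi 0) := by
  have hm : Measurable (tailWeight κ) :=
    (measurable_id.pow_const _).min (measurable_id.pow_const _)
  rw [← Ioc_union_Ioi_eq_Ioi zero_le_one, integrableOn_union]
  constructor
  · have h := (intervalIntegrable_iff_integrableOn_Ioc_of_le zero_le_one).1
      (intervalIntegral.intervalIntegrable_rpow' (a := 0) (b := 1) (by linarith : -1 < κ - 1))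
    refine h.mono' hm.aestronglyMeasurable ((ae_restrict_iff' measurableSet_Ioc).2
      (Eventually.of_forall fun r hr => ?_))
    rw [Real.norm_of_nonneg (tailWeight_nonneg κ hr.1)]
    exact min_le_left _ _
  · refine (integrableOn_Ioi_rpow_of_lt (by norm_num : (-2 : ℝ) < -1) one_pos).mono'
      hm.aestronglyMeasurable ((ae_restrict_iff' measurableSet_Ioi).2
      (Eventually.of_forall fun r hr => ?_))
    rw [Real.norm_of_nonneg (tailWeight_nonneg κ (one_pos.trans hr))]
    exact min_le_right _ _

/-- Bounds for the mass of the Wright function in a window. -/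
lemma exists_window_wright_le {α : ℝ} (hα : 0 < α ∧ α < 1) (θ₀ : ℝ) :
    ∃ C : ℝ, 0 < C ∧ ∀ η, 0 < η → 0 ≤ ∫ θ in Ico (η / 2) η, wright α θ ∧
      (∫ θ in Ico (η / 2) η, wright α θ) ≤ C ∧
      (∫ θ in Ico (η / 2) η, wright α θ) ≤ C * η ^ (-2 : ℝ) ∧
      (η ≤ θ₀ → (∫ θ in Ico (η / 2) η, wright α θ) ≤ C * η) := by
  have hc := continuous_wright hα.1 hα.2
  have h0 : ∀ θ, 0 < θ → 0 ≤ wright α θ := fun θ hθ => wright_nonneg hα.1 hα.2 hθ.le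
  obtain ⟨B, hB⟩ := (isCompact_Icc (a := 0) (b := θ₀)).exists_bound_of_continuousOn hc.continuousOn
  set m₀ := ∫ θ in Ioi (0 : ℝ), wright α θ with hm₀
  set m₂ := ∫ θ in Ioi (0 : ℝ), θ ^ 2 * wright α θ with hm₂
  have hsub : ∀ η : ℝ, 0 < η → Ico (η / 2) η ⊆ Ioi 0 := fun η hη θ hθ =>
    (half_pos hη).trans_le hθ.1
  have hcm : ∀ η : ℝ, IntegrableOn (wright α) (Ico (η / 2) η) := fun η =>
    (hc.continuousOn.integrableOn_Icc).mono_set Ico_subset_Icc_self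
  have hm₀' : 0 ≤ m₀ := setIntegral_nonneg measurableSet_Ioi h0
  have hm₂' : 0 ≤ m₂ := setIntegral_nonneg measurableSet_Ioi fun θ hθ =>
    mul_nonneg (sq_nonneg θ) (h0 θ hθ)
  refine ⟨1 + m₀ + 4 * m₂ + |B|, by positivity, fun η hη => ⟨?_, ?_, ?_, fun hηθ => ?_⟩⟩
  · exact setIntegral_nonneg measurableSet_Ico fun θ hθ => h0 θ (hsub η hη hθ)
  · have : (∫ θ in Ico (η / 2) η, wright α θ) ≤ m₀ :=
      setIntegral_mono_set (integrableOn_wright hα) ((ae_restrict_iff' measurableSet_Ioi).2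
        (Eventually.of_forall h0)) (hsub η hη).eventuallyLE
    linarith [abs_nonneg B]
  · have h2 := integrableOn_pow_mul_wright hα.1 hα.2 2
    have h3 : (∫ θ in Ico (η / 2) η, θ ^ 2 * wright α θ) ≤ m₂ :=
      setIntegral_mono_set h2 ((ae_restrict_iff' measurableSet_Ioi).2
        (Eventually.of_forall fun θ hθ => mul_nonneg (sq_nonneg θ) (h0 θ hθ)))
        (hsub η hη).eventuallyLE
    have h4 : (η / 2) ^ 2 * (∫ θ in Ico (η / 2) η, wright α θ) ≤
        ∫ θ in Ico (η / 2) η, θ ^ 2 * wright α θ := by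
      rw [← integral_const_mul]
      refine setIntegral_mono_on ((hcm η).const_mul _) (h2.mono_set (hsub η hη)) measurableSet_Ico
        fun θ hθ => mul_le_mul_of_nonneg_right ?_ (h0 θ (hsub η hη hθ))
      exact pow_le_pow_left₀ (by positivity) hθ.1 2
    have e : η ^ (-2 : ℝ) = (η ^ 2)⁻¹ := by
      rw [Real.rpow_neg hη.le]; norm_num
    rw [e, ← div_eq_mul_inv, le_div_iff₀ (by positivity)]
    nlinarith [abs_nonneg B]
  · have h5 : (∫ θ in Ico (η / 2) η, wright α θ) ≤ ∫ _ in Ico (η / 2) η, |B| := by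
      refine setIntegral_mono_on (hcm η) (integrableOn_const (by simp)) measurableSet_Ico
        fun θ hθ => (le_abs_self _).trans ((hB θ ⟨?_, ?_⟩).trans (le_abs_self _))
      · exact (hsub η hη hθ).le
      · exact hθ.2.le.trans hηθ
    rw [setIntegral_const, Real.volume_real_Ico_of_le (by linarith), smul_eq_mul] at h5
    nlinarith [abs_nonneg B]

/-- Shift the variable by `x`; as `m` decreases, dropping the shift in its argument only enlarges
the integral. -/
lemma integral_Ioi_le_integral_shift {m h : ℝ → ℝ} {M : ℝ} (hm0 : ∀ r, 0 < r → 0 ≤ m r)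
    (hm : ∀ r r', 0 < r → r ≤ r' → m r' ≤ m r) (hmi : IntegrableOn m (Ioi 0))
    (hh : Continuous h) (hh0 : ∀ r, 0 ≤ h r) (hhM : ∀ r, h r ≤ M) {x ρ : ℝ} (hx : 0 ≤ x)
    (hxρ : x ≤ ρ) :
    ∫ r in Ioi ρ, m r * h r ≤ ∫ r in Ioi (0 : ℝ), m r * h (x + r) := by
  have hbd : ∀ y : ℝ, IntegrableOn (fun r => m r * h (y + r)) (Ioi 0) := fun y =>
    hmi.mul_bdd (c := M) (hh.comp (continuous_const_add y)).aestronglyMeasurable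
      (Eventually.of_forall fun r => by rw [Real.norm_of_nonneg (hh0 _)]; exact hhM _)
  have e : ∫ r in Ioi ρ, m r * h r = ∫ r in Ioi (ρ - x), m (r + x) * h (r + x) := by
    have h1 := (measurePreserving_add_right volume x).setIntegral_preimage_emb
      (measurableEmbedding_addRight x) (fun r => m r * h r) (Ioi ρ)
    rw [← h1]
    congr 2
    ext r
    simp [sub_lt_iff_lt_add]
  rw [e]
  have hsub : Ioi (ρ - x) ⊆ Ioi 0 := Ioi_subset_Ioi (by linarith)
  refine le_trans (integral_mono_of_nonneg ?_ ((hbd x).mono_set hsub) ?_) (setIntegral_mono_set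
    (hbd x) ((ae_restrict_iff' measurableSet_Ioi).2 (Eventually.of_forall fun r hr =>
      mul_nonneg (hm0 r hr) (hh0 _))) hsub.eventuallyLE)
  · exact (ae_restrict_iff' measurableSet_Ioi).2 (Eventually.of_forall fun r hr =>
      mul_nonneg (hm0 _ (by linarith [mem_Ioi.1 (hsub hr)])) (hh0 _))
  · refine (ae_restrict_iff' measurableSet_Ioi).2 (Eventually.of_forall fun r hr => ?_)
    simp only [add_comm x r]
    exact mul_le_mul_of_nonneg_right (hm _ _ (hsub hr) (by linarith)) (hh0 _)

/-- The window mass is bounded by `C min(1, η^{-2})`, hence also by `C η^{κ-1}`. Rescaling by `b`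
costs `b^{-κ} ≤ D` in one branch of the weight and `b ≤ 1 + Tb` in the other. With `κ = 0` the first
cost would vanish, but the weight would no longer be integrable at `0`. -/
lemma le_tailWeight_of_le {κ C b D Tb η y : ℝ} (hκ : 0 < κ) (hκ1 : κ ≤ 1) (hC : 0 < C)
    (hb : 0 < b) (hD : 1 ≤ D) (hDb : b ^ (-κ) ≤ D) (hbT : b ≤ Tb) (hη : 0 < η)
    (h1 : y ≤ C) (h2 : y ≤ C * η ^ (-2 : ℝ)) :
    y ≤ C * (1 + Tb) * D * (b * tailWeight κ (b * η)) := by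
  have hTb : 0 < Tb := hb.trans_le hbT
  have hbη : 0 < b * η := by positivity
  rcases min_choice ((b * η) ^ (κ - 1)) ((b * η) ^ (-2 : ℝ)) with h | h
  · rw [tailWeight, h, Real.mul_rpow hb.le hη.le]
    have h3 : y ≤ C * η ^ (κ - 1) := by
      rcases le_total η 1 with h4 | h4
      · exact h1.trans (le_mul_of_one_le_right hC.le
          (Real.one_le_rpow_of_pos_of_le_one_of_nonpos hη h4 (by linarith)))
      · exact h2.trans (mul_le_mul_of_nonneg_left
          (Real.rpow_le_rpow_of_exponent_le h4 (by linarith)) hC.le)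
    have h5 : 1 ≤ D * (b * b ^ (κ - 1)) := by
      rw [← Real.rpow_one_add' hb.le (by linarith), add_sub_cancel]
      calc (1 : ℝ) = b ^ (-κ) * b ^ κ := by rw [← Real.rpow_add hb]; simp
        _ ≤ D * b ^ κ := by gcongr
    calc y ≤ C * η ^ (κ - 1) * 1 * 1 := by linarith
      _ ≤ C * η ^ (κ - 1) * (1 + Tb) * (D * (b * b ^ (κ - 1))) := by gcongr; linarith
      _ = _ := by ring
  · rw [tailWeight, h, Real.mul_rpow hb.le hη.le]
    have h5 : 1 ≤ (1 + Tb) * (b * b ^ (-2 : ℝ)) := by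
      have : b * b ^ (-2 : ℝ) = b⁻¹ := by
        rw [← Real.rpow_one_add' hb.le (by norm_num), ← Real.rpow_neg_one]; norm_num
      rw [this, ← div_eq_mul_inv, one_le_div hb]
      linarith
    calc y ≤ C * η ^ (-2 : ℝ) * 1 * 1 := by linarith
      _ ≤ C * η ^ (-2 : ℝ) * D * ((1 + Tb) * (b * b ^ (-2 : ℝ))) := by gcongr
      _ = _ := by ring

/-- Small diffusion times. Substituting `b η = a η'` maps the range onto `(0, θ₀]` with Jacobian
factor `(a/b)² ≤ 1`, and there `C η ≤ (C/c) η φ(η)`. -/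
lemma integral_Ioc_mul_comp_le {φ Φ h : ℝ → ℝ} {θ₀ c C a b : ℝ} (hθ₀ : 0 < θ₀) (hc : 0 < c)
    (hC : 0 ≤ C) (ha : 0 < a) (hab : a ≤ b) (hφ : ∀ θ ∈ Icc 0 θ₀, c ≤ φ θ)
    (hφ0 : ∀ θ, 0 < θ → 0 ≤ φ θ) (hφi : IntegrableOn (fun θ => θ * φ θ * h (a * θ)) (Ioi 0))
    (hΦ0 : ∀ η, 0 < η → 0 ≤ Φ η) (hΦ : ∀ η, 0 < η → η ≤ θ₀ → Φ η ≤ C * η)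
    (hh : Continuous h) (hh0 : ∀ r, 0 ≤ h r) :
    ∫ η in Ioc 0 (θ₀ * a / b), Φ η * h (b * η) ≤
      C / c * ∫ θ in Ioi (0 : ℝ), θ * φ θ * h (a * θ) := by
  have hb : 0 < b := ha.trans_le hab
  have hab' : a / b ≤ 1 := (div_le_one hb).2 hab
  have hη₀ : θ₀ * a / b = a / b * θ₀ := by ring
  have hη₀' : 0 ≤ θ₀ * a / b := by positivity
  have hη₁ : θ₀ * a / b ≤ θ₀ := by rw [hη₀]; exact mul_le_of_le_one_left hθ₀.le hab'
  have hcont : ∀ y : ℝ, Continuous fun η => C * (η * h (y * η)) := fun y =>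
    continuous_const.mul (continuous_id.mul (hh.comp (continuous_const_mul y)))
  have e := intervalIntegral.integral_comp_mul_left (a := 0) (b := θ₀)
    (fun η => C * (η * h (b * η))) (div_pos ha hb).ne'
  rw [mul_zero, ← hη₀] at e
  have e' : ∫ η in (0 : ℝ)..(θ₀ * a / b), C * (η * h (b * η)) =
      (a / b) ^ 2 * ∫ η in (0 : ℝ)..θ₀, C * (η * h (a * η)) := by
    rw [eq_inv_smul_iff₀ (div_pos ha hb).ne', smul_eq_mul] at e
    rw [← e, pow_two, mul_assoc, ← intervalIntegral.integral_const_mul (a / b) fun η =>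
      C * (η * h (a * η))]
    congr 2
    ext η
    rw [← mul_assoc b, mul_div_cancel₀ a hb.ne']
    ring
  have h0 : 0 ≤ ∫ η in (0 : ℝ)..θ₀, C * (η * h (a * η)) :=
    intervalIntegral.integral_nonneg hθ₀.le fun η hη => mul_nonneg hC (mul_nonneg hη.1 (hh0 _))
  calc ∫ η in Ioc 0 (θ₀ * a / b), Φ η * h (b * η)
      ≤ ∫ η in Ioc 0 (θ₀ * a / b), C * (η * h (b * η)) := by
        refine integral_mono_of_nonneg ((ae_restrict_iff' measurableSet_Ioc).2
          (Eventually.of_forall fun η hη => mul_nonneg (hΦ0 η hη.1) (hh0 _)))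
          (hcont b).integrableOn_Ioc ((ae_restrict_iff' measurableSet_Ioc).2
          (Eventually.of_forall fun η hη => ?_))
        have := mul_le_mul_of_nonneg_right (hΦ η hη.1 (hη.2.trans hη₁)) (hh0 (b * η))
        simp only
        linarith
    _ = (a / b) ^ 2 * ∫ η in (0 : ℝ)..θ₀, C * (η * h (a * η)) := by
        rw [← intervalIntegral.integral_of_le hη₀', e']
    _ ≤ ∫ η in (0 : ℝ)..θ₀, C * (η * h (a * η)) :=
        mul_le_of_le_one_left h0 (pow_le_one₀ (by positivity) hab')
    _ ≤ ∫ η in Ioc 0 θ₀, C / c * (η * φ η * h (a * η)) := by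
        rw [intervalIntegral.integral_of_le hθ₀.le]
        refine setIntegral_mono_on (hcont a).integrableOn_Ioc
          ((hφi.mono_set Ioc_subset_Ioi_self).const_mul _) measurableSet_Ioc fun η hη => ?_
        have h1 : 1 ≤ φ η / c := (one_le_div hc).2 (hφ η ⟨hη.1.le, hη.2⟩)
        have h2 : 0 ≤ C * (η * h (a * η)) := mul_nonneg hC (mul_nonneg hη.1.le (hh0 _))
        calc C * (η * h (a * η)) ≤ C * (η * h (a * η)) * (φ η / c) := le_mul_of_one_le_right h2 h1
          _ = _ := by ring
    _ ≤ C / c * ∫ θ in Ioi (0 : ℝ), θ * φ θ * h (a * θ) := by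
        rw [integral_const_mul]
        refine mul_le_mul_of_nonneg_left (setIntegral_mono_set hφi
          ((ae_restrict_iff' measurableSet_Ioi).2 (Eventually.of_forall fun θ hθ => ?_))
          Ioc_subset_Ioi_self.eventuallyLE) (by positivity)
        exact mul_nonneg (mul_nonneg (le_of_lt hθ) (hφ0 θ hθ)) (hh0 _)

/-- Large diffusion times. What remains is at most `C ∫_{r > θ₀ a} m(r) h(r) dr`, and this integral
is below its shifted version for every shift `a θ` with `θ ≤ θ₀`. Averaging over these `θ` with
density `θ φ(θ) ≥ c θ`, of mass at least `c θ₀² / 2`, produces the right side. -/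
lemma integral_Ioi_mul_comp_le {φ Φ h m : ℝ → ℝ} {θ₀ c C a b M : ℝ} (hθ₀ : 0 < θ₀) (hc : 0 < c)
    (hC : 0 ≤ C) (ha : 0 < a) (hab : a ≤ b) (hφ : ∀ θ ∈ Icc 0 θ₀, c ≤ φ θ)
    (hφ0 : ∀ θ, 0 < θ → 0 ≤ φ θ) (hφi : IntegrableOn (fun θ => θ * φ θ) (Ioi 0))
    (hm0 : ∀ r, 0 < r → 0 ≤ m r) (hm : ∀ r r', 0 < r → r ≤ r' → m r' ≤ m r)
    (hmi : IntegrableOn m (Ioi 0))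
    (hΦ0 : ∀ η, 0 < η → 0 ≤ Φ η) (hΦ : ∀ η, 0 < η → Φ η ≤ C * (b * m (b * η)))
    (hh : Continuous h) (hh0 : ∀ r, 0 ≤ h r) (hhM : ∀ r, h r ≤ M) :
    ∫ η in Ioi (θ₀ * a / b), Φ η * h (b * η) ≤
      C * (2 / (c * θ₀ ^ 2)) *
        ∫ θ in Ioi (0 : ℝ), θ * φ θ * ∫ r in Ioi (0 : ℝ), m r * h (a * θ + r) := by
  have hb : 0 < b := ha.trans_le hab
  have hη₀ : 0 < θ₀ * a / b := by positivity
  have hρ : 0 < θ₀ * a := by positivity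
  have hbd : ∀ y : ℝ, IntegrableOn (fun r => m r * h (y + r)) (Ioi 0) := fun y =>
    hmi.mul_bdd (c := M) (hh.comp (continuous_const_add y)).aestronglyMeasurable
      (Eventually.of_forall fun r => by rw [Real.norm_of_nonneg (hh0 _)]; exact hhM _)
  have hbd0 : IntegrableOn (fun r => m r * h r) (Ioi (θ₀ * a)) := by
    simpa using (hbd 0).mono_set (Ioi_subset_Ioi hρ.le)
  set I := ∫ r in Ioi (θ₀ * a), m r * h r with hI
  set J : ℝ → ℝ := fun θ => ∫ r in Ioi (0 : ℝ), m r * h (a * θ + r) with hJ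
  have hJc : Continuous J := by
    refine continuous_of_dominated (bound := fun r => ‖m r‖ * M)
      (fun θ => (hbd (a * θ)).aestronglyMeasurable) (fun θ => Eventually.of_forall fun r => ?_)
      (hmi.norm.mul_const M) (Eventually.of_forall fun r => continuous_const.mul
        (hh.comp ((continuous_const_mul a).add continuous_const)))
    rw [norm_mul, Real.norm_of_nonneg (hh0 _)]
    exact mul_le_mul_of_nonneg_left (hhM _) (norm_nonneg _)
  have hJ0 : ∀ θ, 0 ≤ J θ := fun θ =>
    setIntegral_nonneg measurableSet_Ioi fun r hr => mul_nonneg (hm0 r hr) (hh0 _)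
  have hJM : ∀ θ, J θ ≤ (∫ r in Ioi (0 : ℝ), m r) * M := fun θ => by
    rw [← integral_mul_const]
    exact setIntegral_mono_on (hbd _) (hmi.mul_const M) measurableSet_Ioi fun r hr =>
      mul_le_mul_of_nonneg_left (hhM _) (hm0 r hr)
  have hφJ : IntegrableOn (fun θ => θ * φ θ * J θ) (Ioi 0) :=
    hφi.mul_bdd (c := (∫ r in Ioi (0 : ℝ), m r) * M) hJc.aestronglyMeasurable
      (Eventually.of_forall fun θ => by rw [Real.norm_of_nonneg (hJ0 _)]; exact hJM _)
  have h1 : ∫ η in Ioi (θ₀ * a / b), Φ η * h (b * η) ≤ C * I := by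
    have e := integral_comp_mul_left_Ioi (fun r => m r * h r) (θ₀ * a / b) hb
    rw [mul_div_cancel₀ _ hb.ne', eq_inv_smul_iff₀ hb.ne', smul_eq_mul] at e
    have hi : IntegrableOn (fun η => m (b * η) * h (b * η)) (Ioi (θ₀ * a / b)) := by
      refine (integrableOn_Ioi_comp_mul_left_iff (fun r => m r * h r) _ hb).2 ?_
      rwa [mul_div_cancel₀ _ hb.ne']
    rw [hI, ← e, ← mul_assoc, ← integral_const_mul]
    refine integral_mono_of_nonneg ((ae_restrict_iff' measurableSet_Ioi).2
      (Eventually.of_forall fun η hη => mul_nonneg (hΦ0 η (hη₀.trans hη)) (hh0 _)))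
      (hi.const_mul _) ((ae_restrict_iff' measurableSet_Ioi).2 (Eventually.of_forall fun η hη => ?_))
    have := mul_le_mul_of_nonneg_right (hΦ η (hη₀.trans hη)) (hh0 (b * η))
    simp only
    linarith
  have h2 : c * θ₀ ^ 2 / 2 * I ≤ ∫ θ in Ioi (0 : ℝ), θ * φ θ * J θ := by
    have hI0 : 0 ≤ I := setIntegral_nonneg measurableSet_Ioi fun r hr =>
      mul_nonneg (hm0 r (hρ.trans hr)) (hh0 _)
    have e : c * θ₀ ^ 2 / 2 * I = ∫ θ in Ioc 0 θ₀, θ * (c * I) := by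
      rw [integral_mul_const, ← intervalIntegral.integral_of_le hθ₀.le, integral_id]
      ring
    rw [e]
    refine le_trans (setIntegral_mono_on (continuous_mul_const _).integrableOn_Ioc
      (hφJ.mono_set Ioc_subset_Ioi_self) measurableSet_Ioc fun θ hθ => ?_)
      (setIntegral_mono_set hφJ ((ae_restrict_iff' measurableSet_Ioi).2 (Eventually.of_forall
        fun θ hθ => mul_nonneg (mul_nonneg (le_of_lt hθ) (hφ0 θ hθ)) (hJ0 _)))
        Ioc_subset_Ioi_self.eventuallyLE)
    have h3 : I ≤ J θ := integral_Ioi_le_integral_shift hm0 hm hmi hh hh0 hhM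
      (mul_nonneg ha.le hθ.1.le) (by rw [mul_comm]; exact mul_le_mul_of_nonneg_right hθ.2 ha.le)
    rw [mul_assoc]
    exact mul_le_mul_of_nonneg_left (mul_le_mul (hφ θ ⟨hθ.1.le, hθ.2⟩) h3 hI0 (hφ0 θ hθ.1)) hθ.1.le
  refine h1.trans ?_
  rw [mul_assoc]
  refine mul_le_mul_of_nonneg_left ?_ hC
  rw [div_mul_eq_mul_div, le_div_iff₀ (by positivity)]
  linarith

/-- Up to an average, the kernel at a later time is dominated by the kernel at an earlier one. -/
lemma exists_integral_mul_wright_comp_le {α κ K : ℝ} (hα : 0 < α ∧ α < 1) (hκ : 0 < κ)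
    (hκ1 : κ ≤ 1) (hK0 : 0 ≤ K) (Tb : ℝ) : ∃ C : ℝ, 0 ≤ C ∧ ∀ (h : ℝ → ℝ) (M : ℝ), Continuous h →
      (∀ r, 0 ≤ h r) → (∀ r, h r ≤ M) → (∀ a b, 0 < a → a ≤ b → b ≤ 2 * a → h a ≤ K * h b) →
      ∀ a b D, 0 < a → a ≤ b → b ≤ Tb → 1 ≤ D → b ^ (-κ) ≤ D →
      ∫ θ in Ioi (0 : ℝ), θ * wright α θ * h (b * θ) ≤
        C * D * ((∫ θ in Ioi (0 : ℝ), θ * wright α θ * h (a * θ)) +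
          ∫ θ in Ioi (0 : ℝ), θ * wright α θ *
            ∫ r in Ioi (0 : ℝ), tailWeight κ r * h (a * θ + r)) := by
  obtain ⟨θ₀, c, hθ₀, hc, hlow⟩ := exists_wright_lower hα.1 hα.2
  obtain ⟨C, hC, hwin⟩ := exists_window_wright_le hα θ₀
  have hcφ := continuous_wright hα.1 hα.2
  have h0 : ∀ θ, 0 < θ → 0 ≤ wright α θ := fun θ hθ => wright_nonneg hα.1 hα.2 hθ.le
  refine ⟨K * (C / c + C * (1 + |Tb|) * (2 / (c * θ₀ ^ 2))), by positivity,
    fun h M hh hh0 hhM hK a b D ha hab hbT hD hDb => ?_⟩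
  have hb : 0 < b := ha.trans_le hab
  have hφi : ∀ y : ℝ, IntegrableOn (fun θ => θ * wright α θ * h (y * θ)) (Ioi 0) := fun y =>
    (integrableOn_mul_wright hα).mul_bdd (c := M)
      (hh.comp (continuous_const_mul y)).aestronglyMeasurable
      (Eventually.of_forall fun r => by rw [Real.norm_of_nonneg (hh0 _)]; exact hhM _)
  obtain ⟨hi, hle⟩ := integral_mul_le_integral_window (h := fun r => h (b * r)) hcφ h0
    (integrableOn_mul_wright hα) (hh.comp (continuous_const_mul b)) (fun r => hh0 _)
    (fun r => hhM _) (fun x y hx hxy hyx => hK _ _ (by positivity) (by gcongr) (by nlinarith))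
  have h1 := integral_Ioc_mul_comp_le hθ₀ hc hC.le ha hab hlow h0 (hφi a)
    (fun η hη => (hwin η hη).1) (fun η hη => (hwin η hη).2.2.2) hh hh0
  have h2 := integral_Ioi_mul_comp_le (C := C * (1 + |Tb|) * D) (m := tailWeight κ) hθ₀ hc
    (by positivity) ha hab hlow h0
    (integrableOn_mul_wright hα) (fun r hr => tailWeight_nonneg κ hr)
    (fun r r' hr hrr => tailWeight_anti hκ1 hr hrr) (integrableOn_tailWeight hκ)
    (fun η hη => (hwin η hη).1) (fun η hη => le_tailWeight_of_le hκ hκ1 hC hb hD hDb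
      (hbT.trans (le_abs_self _)) hη (hwin η hη).2.1 (hwin η hη).2.2.1) hh hh0 hhM
  set X := ∫ θ in Ioi (0 : ℝ), θ * wright α θ * h (a * θ) with hX
  set Y := ∫ θ in Ioi (0 : ℝ), θ * wright α θ *
    ∫ r in Ioi (0 : ℝ), tailWeight κ r * h (a * θ + r) with hY
  have hX0 : 0 ≤ X := setIntegral_nonneg measurableSet_Ioi fun θ hθ =>
    mul_nonneg (mul_wright_nonneg hα θ hθ) (hh0 _)
  have hY0 : 0 ≤ Y := setIntegral_nonneg measurableSet_Ioi fun θ hθ =>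
    mul_nonneg (mul_wright_nonneg hα θ hθ) (setIntegral_nonneg measurableSet_Ioi fun r hr =>
      mul_nonneg (tailWeight_nonneg κ hr) (hh0 _))
  have hη₀ : 0 ≤ θ₀ * a / b := by positivity
  rw [← Ioc_union_Ioi_eq_Ioi hη₀, setIntegral_union (Ioc_disjoint_Ioi le_rfl) measurableSet_Ioi
    (hi.mono_set Ioc_subset_Ioi_self) (hi.mono_set (Ioi_subset_Ioi hη₀)),
    Ioc_union_Ioi_eq_Ioi hη₀] at hle
  refine hle.trans ?_
  have h3 : C / c * X ≤ C / c * D * X := by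
    have : 0 ≤ C / c * X := by positivity
    nlinarith
  have h4 : 0 ≤ C / c * D * Y := by positivity
  have h5 : 0 ≤ C * (1 + |Tb|) * D * (2 / (c * θ₀ ^ 2)) * X := by positivity
  calc _ ≤ K * (C / c * D * X + C * (1 + |Tb|) * D * (2 / (c * θ₀ ^ 2)) * Y) := by
        refine mul_le_mul_of_nonneg_left ?_ hK0
        linarith
    _ ≤ K * ((C / c * D * X + C * (1 + |Tb|) * D * (2 / (c * θ₀ ^ 2)) * Y) +
        (C / c * D * Y + C * (1 + |Tb|) * D * (2 / (c * θ₀ ^ 2)) * X)) := by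
        refine mul_le_mul_of_nonneg_left ?_ hK0
        linarith
    _ = _ := by ring

section

variable {N : ℕ}

/-- Long diffusion times matter more in the later kernel, hence the additional heat average. It is
harmless in sup norm, and `κ` may be taken arbitrarily small. -/
lemma exists_fracK_add_le {α κ : ℝ} (hα : 0 < α ∧ α < 1) (hκ : 0 < κ) (hκ1 : κ ≤ 1) (N : ℕ)
    (Tb : ℝ) : ∃ C : ℝ, 0 ≤ C ∧ ∀ s δ : ℝ, 0 < s → 0 < δ → δ ≤ 1 → s + δ ≤ Tb →
      ∀ w : C₀(EuclideanSpace ℝ (Fin N), ℝ), (∀ x, 0 ≤ w x) → ∀ x,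
      fracK hα (s + δ) w x ≤ C * δ ^ (-(α * κ)) * (fracK hα s w x +
        heatAvg (tailWeight κ) (integrableOn_tailWeight hκ) 1 (fracK hα s w) x) := by
  obtain ⟨C, hC, H⟩ := exists_integral_mul_wright_comp_le (K := (2 : ℝ) ^ ((N : ℝ) / 2)) hα hκ hκ1
    (by positivity) (Tb ^ α)
  have hα0 := hα.1
  refine ⟨C, hC, fun s δ hs hδ hδ1 hsT w hw x => ?_⟩
  have hsδ : 0 < s + δ := by linarith
  have e1 : ∀ r : ℝ, fracK hα r w x =
      r ^ (α - 1) * (α * ∫ θ in Ioi (0 : ℝ), θ * wright α θ * heatOp (r ^ α * θ) w x) := fun r => by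
    rw [fracK_apply_eq, ZeroAtInftyContinuousMap.smul_apply, fracS, _root_.smul_apply,
      ZeroAtInftyContinuousMap.smul_apply, heatAvg_apply, smul_eq_mul, smul_eq_mul]
  -- By the semigroup law, averaging after the kernel shifts its diffusion times by `r`; this is the
  -- second term of the scalar estimate.
  have e2 : heatAvg (tailWeight κ) (integrableOn_tailWeight hκ) 1 (fracK hα s w) x =
      s ^ (α - 1) * (α * ∫ θ in Ioi (0 : ℝ), θ * wright α θ *
        ∫ r in Ioi (0 : ℝ), tailWeight κ r * heatOp (s ^ α * θ + r) w x) := by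
    rw [fracK_apply_eq, fracS, _root_.smul_apply, map_smul, map_smul,
      ZeroAtInftyContinuousMap.smul_apply, ZeroAtInftyContinuousMap.smul_apply,
      heatAvg_heatAvg, integral_apply_eq, smul_eq_mul, smul_eq_mul]
    · congr 2
      refine setIntegral_congr_fun measurableSet_Ioi fun θ hθ => ?_
      simp only [ZeroAtInftyContinuousMap.smul_apply, smul_eq_mul, heatAvg_apply]
      congr 1
      refine setIntegral_congr_fun measurableSet_Ioi fun r hr => ?_
      have h1 : 0 ≤ s ^ α * θ := mul_nonneg (by positivity) (le_of_lt hθ)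
      simp only [one_mul, heatOp_add (le_of_lt hr) h1, add_comm r]
    · simpa only [map_smul] using (heatAvg (N := N) (tailWeight κ) (integrableOn_tailWeight hκ)
        1).integrable_comp (integrable_smul_heatOp (integrableOn_mul_wright hα) (s ^ α) w)
  have hK : ∀ a b : ℝ, 0 < a → a ≤ b → b ≤ 2 * a →
      heatOp a w x ≤ (2 : ℝ) ^ ((N : ℝ) / 2) * heatOp b w x := fun a b ha hab hba => by
    have hb : 0 < b := ha.trans_le hab
    have h1 : (1 : ℝ) ≤ 2 ^ ((N : ℝ) / 2) * (a / b) ^ ((N : ℝ) / 2) := by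
      rw [← Real.mul_rpow (by norm_num) (by positivity)]
      refine Real.one_le_rpow ?_ (by positivity)
      rw [← mul_div_assoc, one_le_div hb]
      exact hba
    calc heatOp a w x ≤ 2 ^ ((N : ℝ) / 2) * (a / b) ^ ((N : ℝ) / 2) * heatOp a w x :=
          le_mul_of_one_le_left (heatOp_nonneg a hw x) h1
      _ ≤ _ := by
          rw [mul_assoc]
          exact mul_le_mul_of_nonneg_left (heatOp_le_heatOp ha hab hw x) (by positivity)
  have h := H (fun r => heatOp r w x) ‖w‖ ((evalCLM x).continuous.comp (continuous_heatOp w))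
    (fun r => heatOp_nonneg r hw x)
    (fun r => (le_abs_self _).trans ((abs_apply_le_norm _ x).trans (norm_heatOp_le r w))) hK
    (s ^ α) ((s + δ) ^ α) (δ ^ (-(α * κ))) (by positivity)
    (Real.rpow_le_rpow hs.le (by linarith) hα0.le) (Real.rpow_le_rpow hsδ.le hsT hα0.le)
    (Real.one_le_rpow_of_pos_of_le_one_of_nonpos hδ hδ1 (by nlinarith))
    (by rw [← Real.rpow_mul hsδ.le, mul_neg]
        exact Real.rpow_le_rpow_of_nonpos hδ (by linarith) (by nlinarith))
  rw [e1 (s + δ), e1 s, e2]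
  set X := ∫ θ in Ioi (0 : ℝ), θ * wright α θ * heatOp ((s + δ) ^ α * θ) w x
  have hX : 0 ≤ X := setIntegral_nonneg measurableSet_Ioi fun θ hθ =>
    mul_nonneg (mul_wright_nonneg hα θ hθ) (heatOp_nonneg _ hw x)
  calc (s + δ) ^ (α - 1) * (α * X) ≤ s ^ (α - 1) * (α * X) :=
        mul_le_mul_of_nonneg_right (Real.rpow_le_rpow_of_nonpos hs (by linarith)
          (by linarith [hα.2])) (by positivity)
    _ ≤ _ := (mul_le_mul_of_nonneg_left (mul_le_mul_of_nonneg_left h hα0.le)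
        (Real.rpow_nonneg hs.le _)).trans_eq (by ring)

/-- Smoothing of the history: the contribution of times before `t₀` to a convolution at time `t`
is controlled by its supremum at time `t₀`, up to an arbitrarily weak singularity. -/
lemma exists_volterra_fracK_le {α κ : ℝ} (hα : 0 < α ∧ α < 1) (hκ : 0 < κ) (hκ1 : κ ≤ 1) (N : ℕ)
    (Tb : ℝ) : ∃ C : ℝ, 0 ≤ C ∧ ∀ (F : ℝ → C₀(EuclideanSpace ℝ (Fin N), ℝ)) (t₀ t M : ℝ), 0 ≤ t₀ →
      t₀ < t → t - t₀ ≤ 1 → t ≤ Tb → ContinuousOn F (Icc 0 t) →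
      (∀ s ∈ Icc 0 t, ∀ x, 0 ≤ F s x) → 0 ≤ M → (∀ x, volterra (fracK hα) F t₀ x ≤ M) →
      ∀ x, volterra (fracK hα) F t x ≤ C * M * (t - t₀) ^ (-(α * κ)) +
        fracSBound α * ∫ τ in t₀..t, (t - τ) ^ (α - 1) * ‖F τ‖ := by
  obtain ⟨C, hC, H⟩ := exists_fracK_add_le hα hκ hκ1 N Tb
  set m := ∫ r in Ioi (0 : ℝ), ‖tailWeight κ r‖ with hm
  have hm0 : 0 ≤ m := integral_nonneg fun _ => norm_nonneg _
  refine ⟨C * (1 + m), by positivity, fun F t₀ t M ht₀ htt ht1 htT hF hF0 hM hW x => ?_⟩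
  have ht : 0 ≤ t := ht₀.trans htt.le
  have hF₀ : ContinuousOn F (Icc 0 t₀) := hF.mono (Icc_subset_Icc_right htt.le)
  have hi := (isVolterraKernel_fracK hα).intervalIntegrable_of_continuousOn ht hF
  have hi₀ := (isVolterraKernel_fracK hα).intervalIntegrable_of_continuousOn ht₀ hF₀
  set l := evalCLM (N := N) x
  set A := heatAvg (N := N) (tailWeight κ) (integrableOn_tailWeight hκ) 1
  -- The comparison bounds `l` of the kernel at the later time by `l'` of the kernel at the earlier
  -- one. As `l'` is linear and continuous, the integrated right side is `l'` of the convolution at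
  -- `t₀`, and only the sup norm of that convolution enters.
  set l' := l + l.comp A
  have e : volterra (fracK hα) F t x = ∫ s in (0 : ℝ)..t, l (fracK hα (t - s) (F s)) :=
    (l.intervalIntegral_comp_comm hi).symm
  have e' : l' (volterra (fracK hα) F t₀) = ∫ s in (0 : ℝ)..t₀, l' (fracK hα (t₀ - s) (F s)) :=
    (l'.intervalIntegral_comp_comm hi₀).symm
  have hil : IntervalIntegrable (fun s => l (fracK hα (t - s) (F s))) volume 0 t :=
    ⟨l.integrable_comp hi.1, l.integrable_comp hi.2⟩
  have hil' : IntervalIntegrable (fun s => l' (fracK hα (t₀ - s) (F s))) volume 0 t₀ :=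
    ⟨l'.integrable_comp hi₀.1, l'.integrable_comp hi₀.2⟩
  have hil₀ : IntervalIntegrable (fun s => l (fracK hα (t - s) (F s))) volume 0 t₀ :=
    hil.mono_set (by rw [uIcc_of_le ht₀, uIcc_of_le ht]; exact Icc_subset_Icc_right htt.le)
  have hil₁ : IntervalIntegrable (fun s => l (fracK hα (t - s) (F s))) volume t₀ t :=
    hil.mono_set (by rw [uIcc_of_le htt.le, uIcc_of_le ht]; exact Icc_subset_Icc_left ht₀)
  rw [e, ← intervalIntegral.integral_add_adjacent_intervals hil₀ hil₁]
  refine add_le_add ?_ ?_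
  · have h1 : ∫ s in (0 : ℝ)..t₀, l (fracK hα (t - s) (F s)) ≤
        ∫ s in (0 : ℝ)..t₀, C * (t - t₀) ^ (-(α * κ)) * l' (fracK hα (t₀ - s) (F s)) := by
      refine intervalIntegral.integral_mono_on_of_le_Ioo ht₀ hil₀ (hil'.const_mul _) fun s hs => ?_
      have := H (t₀ - s) (t - t₀) (by linarith [hs.2]) (by linarith) ht1 (by linarith [hs.1]) (F s)
        (hF0 s ⟨hs.1.le, hs.2.le.trans htt.le⟩) x
      rw [show t₀ - s + (t - t₀) = t - s by ring] at this
      exact this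
    rw [intervalIntegral.integral_const_mul, ← e'] at h1
    have hW0 : ∀ y, 0 ≤ volterra (fracK hα) F t₀ y :=
      volterra_fracK_nonneg hα ht₀ hF₀ fun s hs => hF0 s ⟨hs.1, hs.2.trans htt.le⟩
    have h2 : ‖volterra (fracK hα) F t₀‖ ≤ M := norm_le_of_forall_abs_le hM fun y => by
      rw [abs_of_nonneg (hW0 y)]; exact hW y
    have h3 : l' (volterra (fracK hα) F t₀) ≤ (1 + m) * M := by
      have h4 := (le_abs_self _).trans ((abs_apply_le_norm (A (volterra (fracK hα) F t₀)) x).trans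
        (norm_heatAvg_le _ _ _))
      have h5 : m * ‖volterra (fracK hα) F t₀‖ ≤ m * M := by gcongr
      have h6 : l' (volterra (fracK hα) F t₀) =
        volterra (fracK hα) F t₀ x + A (volterra (fracK hα) F t₀) x := rfl
      rw [h6]
      linarith [hW x]
    have h7 : 0 ≤ C * (t - t₀) ^ (-(α * κ)) :=
      mul_nonneg hC (Real.rpow_nonneg (by linarith) _)
    calc _ ≤ _ := h1
      _ ≤ C * (t - t₀) ^ (-(α * κ)) * ((1 + m) * M) := mul_le_mul_of_nonneg_left h3 h7
      _ = _ := by ring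
  · have hpow : IntervalIntegrable (fun s => (t - s) ^ (α - 1)) volume t₀ t := by
      have := (intervalIntegral.intervalIntegrable_rpow' (a := 0) (b := t - t₀)
        (by linarith [hα.1] : -1 < α - 1)).comp_sub_left t
      simp only [sub_zero, sub_sub_cancel] at this
      exact this.symm
    have hFn : ContinuousOn (fun s => ‖F s‖) (uIcc t₀ t) := by
      rw [uIcc_of_le htt.le]
      exact (hF.mono (Icc_subset_Icc_left ht₀)).norm
    rw [← intervalIntegral.integral_const_mul]
    refine intervalIntegral.integral_mono_on_of_le_Ioo htt.le hil₁
      ((hpow.mul_continuousOn hFn).const_mul _) fun s hs => ?_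
    have := (isVolterraKernel_fracK hα).norm_le (t - s) (by linarith [hs.2]) (F s)
    have h8 : l (fracK hα (t - s) (F s)) ≤ ‖fracK hα (t - s) (F s)‖ :=
      (le_abs_self _).trans (abs_apply_le_norm (fracK hα (t - s) (F s)) x)
    linarith

/-! ### Bootstrap for weakly singular Volterra inequalities -/

/-- Replace the larger base by the smaller one. This separates the two endpoint singularities and
makes a Beta integral unnecessary. -/
lemma rpow_mul_rpow_neg_le {a b γ η : ℝ} (ha : 0 < a) (hb : 0 < b) (hγ : γ ≤ 1) (hη : 0 ≤ η) :
    a ^ (γ - 1) * b ^ (-η) ≤ a ^ (γ - 1 - η) + b ^ (γ - 1 - η) := by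
  rcases le_total a b with h | h
  · have h1 : b ^ (-η) ≤ a ^ (-η) := Real.rpow_le_rpow_of_nonpos ha h (by linarith)
    have h2 : a ^ (γ - 1) * a ^ (-η) = a ^ (γ - 1 - η) := by
      rw [← Real.rpow_add ha, sub_eq_add_neg (γ - 1)]
    have := mul_le_mul_of_nonneg_left h1 (Real.rpow_nonneg ha.le (γ - 1))
    linarith [Real.rpow_nonneg hb.le (γ - 1 - η)]
  · have h1 : a ^ (γ - 1) ≤ b ^ (γ - 1) := Real.rpow_le_rpow_of_nonpos hb h (by linarith)
    have h2 : b ^ (γ - 1) * b ^ (-η) = b ^ (γ - 1 - η) := by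
      rw [← Real.rpow_add hb, sub_eq_add_neg (γ - 1)]
    have := mul_le_mul_of_nonneg_right h1 (Real.rpow_nonneg hb.le (-η))
    linarith [Real.rpow_nonneg ha.le (γ - 1 - η)]

lemma integral_rpow_mul_le_of_singular {γ η c t₀ t : ℝ} {f : ℝ → ℝ} (hγ : γ ≤ 1) (hη : 0 ≤ η)
    (hηγ : η < γ) (hc : 0 ≤ c) (ht : t₀ ≤ t) (hf0 : ∀ τ ∈ Ioo t₀ t, 0 ≤ f τ)
    (hf : ∀ τ ∈ Ioo t₀ t, f τ ≤ c * (τ - t₀) ^ (-η)) :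
    ∫ τ in t₀..t, (t - τ) ^ (γ - 1) * f τ ≤ c * (2 / (γ - η) * (t - t₀) ^ (γ - η)) := by
  have hr : -1 < γ - 1 - η := by linarith
  have h0 := intervalIntegral.intervalIntegrable_rpow' (a := 0) (b := t - t₀) hr
  have i1 : IntervalIntegrable (fun τ => (t - τ) ^ (γ - 1 - η)) volume t₀ t := by
    have := h0.comp_sub_left t
    simp only [sub_zero, sub_sub_cancel] at this
    exact this.symm
  have i2 : IntervalIntegrable (fun τ => (τ - t₀) ^ (γ - 1 - η)) volume t₀ t := by
    have := h0.comp_sub_right t₀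
    simpa only [zero_add, sub_add_cancel] using this
  have e : ∫ τ in t₀..t, c * ((t - τ) ^ (γ - 1 - η) + (τ - t₀) ^ (γ - 1 - η)) =
      c * (2 / (γ - η) * (t - t₀) ^ (γ - η)) := by
    rw [intervalIntegral.integral_const_mul, intervalIntegral.integral_add i1 i2,
      intervalIntegral.integral_comp_sub_left (fun s => s ^ (γ - 1 - η)) t,
      intervalIntegral.integral_comp_sub_right (fun s => s ^ (γ - 1 - η)) t₀, sub_self, sub_self,
      integral_rpow (Or.inl hr), show γ - 1 - η + 1 = γ - η by ring,
      Real.zero_rpow (by linarith)]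
    ring
  rw [← e, intervalIntegral.integral_of_le ht, intervalIntegral.integral_of_le ht,
    integral_Ioc_eq_integral_Ioo, integral_Ioc_eq_integral_Ioo]
  refine integral_mono_of_nonneg ((ae_restrict_iff' measurableSet_Ioo).2
    (Eventually.of_forall fun τ hτ => mul_nonneg (Real.rpow_nonneg (by linarith [hτ.2]) _)
      (hf0 τ hτ))) ?_ ((ae_restrict_iff' measurableSet_Ioo).2 (Eventually.of_forall fun τ hτ => ?_))
  · exact ((intervalIntegrable_iff_integrableOn_Ioo_of_le ht).1 ((i1.add i2).const_mul c))
  · have h1 : 0 < t - τ := by linarith [hτ.2]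
    have h2 : 0 < τ - t₀ := by linarith [hτ.1]
    calc (t - τ) ^ (γ - 1) * f τ ≤ (t - τ) ^ (γ - 1) * (c * (τ - t₀) ^ (-η)) :=
          mul_le_mul_of_nonneg_left (hf τ hτ) (Real.rpow_nonneg h1.le _)
      _ = c * ((t - τ) ^ (γ - 1) * (τ - t₀) ^ (-η)) := by ring
      _ ≤ _ := mul_le_mul_of_nonneg_left (rpow_mul_rpow_neg_le h1 h2 hγ hη) hc

/-- One step of the bootstrap. -/
lemma singular_bootstrap_step {γ p ε A B d t₀ t : ℝ} (hγ : γ ≤ 1) (hp : 0 ≤ p) (hε : 0 < ε)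
    (hεp : ε * p < γ) (hA : 0 < A) (hB : 0 ≤ B) (ht : t₀ < t) (htd : t ≤ t₀ + d)
    (hd : B * ((2 * A) ^ p * (2 / (γ - ε * p))) * d ^ (γ - ε * p + ε) < A) {y : ℝ} {z : ℝ → ℝ}
    (hz0 : ∀ τ ∈ Ioo t₀ t, 0 ≤ z τ) (hz : ∀ τ ∈ Ioo t₀ t, z τ ≤ 2 * A * (τ - t₀) ^ (-ε))
    (hy : y ≤ A * (t - t₀) ^ (-ε) + B * ∫ τ in t₀..t, (t - τ) ^ (γ - 1) * z τ ^ p) :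
    (t - t₀) ^ ε * y < 2 * A := by
  have hs : 0 < t - t₀ := by linarith
  have hεp0 : 0 ≤ ε * p := mul_nonneg hε.le hp
  have h1 := integral_rpow_mul_le_of_singular (f := fun τ => z τ ^ p) (c := (2 * A) ^ p) hγ
    hεp0 hεp (by positivity) ht.le
    (fun τ hτ => Real.rpow_nonneg (hz0 τ hτ) p) (fun τ hτ => by
      have h2 : 0 < τ - t₀ := by linarith [hτ.1]
      refine (Real.rpow_le_rpow (hz0 τ hτ) (hz τ hτ) hp).trans (le_of_eq ?_)
      rw [Real.mul_rpow (by positivity) (by positivity), ← Real.rpow_mul h2.le, neg_mul])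
  have h2 : (t - t₀) ^ ε * (t - t₀) ^ (-ε) = 1 := by rw [← Real.rpow_add hs]; simp
  have h3 : (t - t₀) ^ ε * (t - t₀) ^ (γ - ε * p) = (t - t₀) ^ (γ - ε * p + ε) := by
    rw [← Real.rpow_add hs, add_comm]
  have h4 : (t - t₀) ^ (γ - ε * p + ε) ≤ d ^ (γ - ε * p + ε) :=
    Real.rpow_le_rpow hs.le (by linarith) (by linarith)
  have h5 : 0 ≤ B * ((2 * A) ^ p * (2 / (γ - ε * p))) := by
    have : 0 < γ - ε * p := by linarith
    positivity
  calc (t - t₀) ^ ε * y ≤ (t - t₀) ^ ε * (A * (t - t₀) ^ (-ε) +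
        B * ((2 * A) ^ p * (2 / (γ - ε * p) * (t - t₀) ^ (γ - ε * p)))) := by
        refine mul_le_mul_of_nonneg_left (hy.trans ?_) (Real.rpow_nonneg hs.le _)
        gcongr
    _ = A * ((t - t₀) ^ ε * (t - t₀) ^ (-ε)) + B * ((2 * A) ^ p * (2 / (γ - ε * p))) *
        ((t - t₀) ^ ε * (t - t₀) ^ (γ - ε * p)) := by ring
    _ ≤ A + B * ((2 * A) ^ p * (2 / (γ - ε * p))) * d ^ (γ - ε * p + ε) := by
        rw [h2, h3, mul_one]
        gcongr
    _ < 2 * A := by linarith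

lemma exists_pos_mul_rpow_lt {c e A : ℝ} (he : 0 < e) (hA : 0 < A) :
    ∀ᶠ d in 𝓝[>] (0 : ℝ), c * d ^ e < A := by
  have h : Tendsto (fun d : ℝ => c * d ^ e) (𝓝 0) (𝓝 (c * 0 ^ e)) :=
    ((Real.continuous_rpow_const he.le).tendsto 0).const_mul c
  rw [Real.zero_rpow he.ne', mul_zero] at h
  exact (h.mono_left nhdsWithin_le_nhds).eventually (gt_mem_nhds hA)

/-- A continuity argument for `(t - t₀)^ε max(y, z)`, which vanishes at `t₀`: at the first time it
reached `2 A`, the bootstrap step would give a value strictly below `2 A`. That `d` is chosen before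
`t₀` and the functions is the whole point. -/
lemma exists_singular_bootstrap {γ₁ γ₂ p q ε A B : ℝ} (hγ₁ : γ₁ ≤ 1) (hγ₂ : γ₂ ≤ 1) (hp : 0 ≤ p)
    (hq : 0 ≤ q) (hε : 0 < ε) (hεp : ε * p < γ₁) (hεq : ε * q < γ₂) (hA : 0 < A) (hB : 0 ≤ B) :
    ∃ d : ℝ, 0 < d ∧ d ≤ 1 ∧ ∀ (t₀ T : ℝ) (y z : ℝ → ℝ), t₀ ≤ T → T ≤ t₀ + d →
      ContinuousOn y (Icc t₀ T) → ContinuousOn z (Icc t₀ T) →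
      (∀ t ∈ Icc t₀ T, 0 ≤ y t) → (∀ t ∈ Icc t₀ T, 0 ≤ z t) →
      (∀ t ∈ Ioc t₀ T, y t ≤ A * (t - t₀) ^ (-ε) +
        B * ∫ τ in t₀..t, (t - τ) ^ (γ₁ - 1) * z τ ^ p) →
      (∀ t ∈ Ioc t₀ T, z t ≤ A * (t - t₀) ^ (-ε) +
        B * ∫ τ in t₀..t, (t - τ) ^ (γ₂ - 1) * y τ ^ q) →
      ∀ t ∈ Ioc t₀ T, y t ≤ 2 * A * (t - t₀) ^ (-ε) ∧ z t ≤ 2 * A * (t - t₀) ^ (-ε) := by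
  obtain ⟨d, ⟨hd₁, hd₂, hd1⟩, hd0⟩ := (((exists_pos_mul_rpow_lt
      (c := B * ((2 * A) ^ p * (2 / (γ₁ - ε * p)))) (by linarith : 0 < γ₁ - ε * p + ε) hA).and
    ((exists_pos_mul_rpow_lt (c := B * ((2 * A) ^ q * (2 / (γ₂ - ε * q))))
      (by linarith : 0 < γ₂ - ε * q + ε) hA).and
    (nhdsWithin_le_nhds (ge_mem_nhds one_pos)))).and self_mem_nhdsWithin).exists
  refine ⟨d, hd0, hd1, fun t₀ T y z htT hTd hyc hzc hy0 hz0 hy hz => ?_⟩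
  set Y : ℝ → ℝ := fun t => (t - t₀) ^ ε * max (y t) (z t) with hY
  have hYc : ContinuousOn Y (Icc t₀ T) :=
    ((Real.continuous_rpow_const hε.le).comp (continuous_sub_right t₀)).continuousOn.mul
      (hyc.sup hzc)
  have conv : ∀ t, t₀ < t → Y t ≤ 2 * A →
      y t ≤ 2 * A * (t - t₀) ^ (-ε) ∧ z t ≤ 2 * A * (t - t₀) ^ (-ε) := by
    intro t ht h
    have hs : 0 < t - t₀ := by linarith
    have h1 : max (y t) (z t) ≤ 2 * A * (t - t₀) ^ (-ε) := by
      rw [Real.rpow_neg hs.le, ← div_eq_mul_inv, le_div_iff₀ (by positivity), mul_comm]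
      exact h
    exact max_le_iff.1 h1
  suffices hlt : ∀ t ∈ Icc t₀ T, Y t < 2 * A from
    fun t ht => conv t ht.1 (hlt t ⟨ht.1.le, ht.2⟩).le
  by_contra! hcon
  have hcomp : IsCompact (Icc t₀ T ∩ Y ⁻¹' Ici (2 * A)) :=
    isCompact_Icc.of_isClosed_subset (hYc.preimage_isClosed_of_isClosed isClosed_Icc isClosed_Ici)
      inter_subset_left
  obtain ⟨t, ⟨htI, htY⟩, hmin⟩ := hcomp.exists_isLeast
    (let ⟨t, ht, h⟩ := hcon; ⟨t, ht, h⟩)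
  have hlt : t₀ < t := by
    refine lt_of_le_of_ne htI.1 fun h => ?_
    have : Y t = 0 := by rw [hY]; simp [← h, Real.zero_rpow hε.ne']
    have h2 : 2 * A ≤ Y t := htY
    linarith
  have hbefore : ∀ τ ∈ Ioo t₀ t, y τ ≤ 2 * A * (τ - t₀) ^ (-ε) ∧ z τ ≤ 2 * A * (τ - t₀) ^ (-ε) := by
    intro τ hτ
    refine conv τ hτ.1 (le_of_lt ?_)
    by_contra! h
    exact absurd (hmin ⟨⟨hτ.1.le, hτ.2.le.trans htI.2⟩, h⟩) (not_le.2 hτ.2)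
  have hmem : ∀ τ ∈ Ioo t₀ t, τ ∈ Icc t₀ T := fun τ hτ => ⟨hτ.1.le, hτ.2.le.trans htI.2⟩
  have h1 := singular_bootstrap_step hγ₁ hp hε hεp hA hB hlt (htI.2.trans hTd) hd₁
    (fun τ hτ => hz0 τ (hmem τ hτ)) (fun τ hτ => (hbefore τ hτ).2) (hy t ⟨hlt, htI.2⟩)
  have h2 := singular_bootstrap_step hγ₂ hq hε hεq hA hB hlt (htI.2.trans hTd) hd₂
    (fun τ hτ => hy0 τ (hmem τ hτ)) (fun τ hτ => (hbefore τ hτ).1) (hz t ⟨hlt, htI.2⟩)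
  have h3 : Y t < 2 * A := by
    rcases max_choice (y t) (z t) with h | h
    · simp only [hY, h]; exact h1
    · simp only [hY, h]; exact h2
  exact absurd htY (not_le.2 h3)

end

section

/-! ### Blow-up alternative -/

variable {N : ℕ}

lemma norm_postComp_abs_rpow_le {p : ℝ} (hp : 1 ≤ p) (w : C₀(EuclideanSpace ℝ (Fin N), ℝ)) :
    ‖postComp (continuous_abs_rpow hp) (abs_zero_rpow hp) w‖ ≤ ‖w‖ ^ p :=
  norm_le_of_forall_abs_le (by positivity) fun x => by
    rw [postComp_apply, abs_of_nonneg (by positivity)]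
    exact Real.rpow_le_rpow (abs_nonneg _) (abs_apply_le_norm w x) (by linarith)

/-- The history estimate applies because the linear part is nonnegative: the convolution at `t₀` is
at most `u t₀`, hence at most `M`. The constant is independent of the solution and of `t₀`. -/
lemma exists_norm_le_of_isMildSolution {γ₁ κ p : ℝ} (hγ₁ : 0 < γ₁ ∧ γ₁ < 1) (hκ : 0 < κ)
    (hκ1 : κ ≤ 1) (hp : 1 ≤ p) (N : ℕ) (Tb : ℝ) : ∃ C : ℝ, 0 ≤ C ∧ ∀ (γ₂ q : ℝ)
      (u₀ v₀ : C₀(EuclideanSpace ℝ (Fin N), ℝ)) (u v : ℝ → C₀(EuclideanSpace ℝ (Fin N), ℝ))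
      (t₀ t M : ℝ), (∀ x, 0 ≤ u₀ x) → 0 ≤ t₀ → t₀ < t → t - t₀ ≤ 1 → t ≤ Tb →
      IsMildSolution γ₁ γ₂ (fun s => |s| ^ p) (fun s => |s| ^ q) u₀ v₀ t u v → ‖u t₀‖ ≤ M →
      ‖u t‖ ≤ (fracPBound γ₁ * ‖u₀‖ + C * M) * (t - t₀) ^ (-(γ₁ * κ)) +
        fracSBound γ₁ * ∫ τ in t₀..t, (t - τ) ^ (γ₁ - 1) * ‖v τ‖ ^ p := by
  obtain ⟨C, hC, H⟩ := exists_volterra_fracK_le hγ₁ hκ hκ1 N Tb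
  refine ⟨C, hC, fun γ₂ q u₀ v₀ u v t₀ t M hu₀ ht₀ htt ht1 htT h hM => ?_⟩
  have ht : 0 ≤ t := ht₀.trans htt.le
  have htI : t ∈ Icc 0 t := ⟨ht, le_rfl⟩
  obtain ⟨hF, he⟩ := h.eq_pow hγ₁ hp htI
  obtain ⟨hF₀, he₀⟩ := h.eq_pow hγ₁ hp ⟨ht₀, htt.le⟩
  have hM0 : 0 ≤ M := (norm_nonneg _).trans hM
  have hpos : 0 < t - t₀ := by linarith
  have h1 : (1 : ℝ) ≤ (t - t₀) ^ (-(γ₁ * κ)) :=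
    Real.one_le_rpow_of_pos_of_le_one_of_nonpos hpos ht1 (by nlinarith [hγ₁.1])
  have hP := mul_nonneg (fracPBound_nonneg γ₁) (norm_nonneg u₀)
  set F : ℝ → C₀(EuclideanSpace ℝ (Fin N), ℝ) := fun s =>
    postComp (continuous_abs_rpow hp) (abs_zero_rpow hp) (v s) with hFdef
  have hF0 : ∀ s x, 0 ≤ F s x := fun s x => Real.rpow_nonneg (abs_nonneg _) _
  have hW : ∀ x, volterra (fracK hγ₁) F t₀ x ≤ M := fun x => by
    have h2 := (le_abs_self _).trans ((abs_apply_le_norm (u t₀) x).trans hM)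
    rw [he₀, ZeroAtInftyContinuousMap.add_apply] at h2
    linarith [fracP_nonneg hγ₁ t₀ hu₀ x]
  have hint : ∫ τ in t₀..t, (t - τ) ^ (γ₁ - 1) * ‖F τ‖ ≤
      ∫ τ in t₀..t, (t - τ) ^ (γ₁ - 1) * ‖v τ‖ ^ p := by
    have hpow : IntervalIntegrable (fun s => (t - s) ^ (γ₁ - 1)) volume t₀ t := by
      have := (intervalIntegral.intervalIntegrable_rpow' (a := 0) (b := t - t₀)
        (by linarith [hγ₁.1] : -1 < γ₁ - 1)).comp_sub_left t
      simp only [sub_zero, sub_sub_cancel] at this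
      exact this.symm
    have hsub : uIcc t₀ t ⊆ Icc 0 t := by
      rw [uIcc_of_le htt.le]; exact Icc_subset_Icc_left ht₀
    refine intervalIntegral.integral_mono_on htt.le
      (hpow.mul_continuousOn (hF.mono hsub).norm)
      (hpow.mul_continuousOn ((h.2.mono hsub).norm.rpow_const fun _ _ => Or.inr (by linarith)))
      fun τ hτ => mul_le_mul_of_nonneg_left (norm_postComp_abs_rpow_le hp _)
        (Real.rpow_nonneg (by linarith [hτ.2]) _)
  have hint' := mul_le_mul_of_nonneg_left hint (fracSBound_nonneg γ₁)
  have hI0 : 0 ≤ fracSBound γ₁ * ∫ τ in t₀..t, (t - τ) ^ (γ₁ - 1) * ‖F τ‖ :=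
    mul_nonneg (fracSBound_nonneg γ₁) (intervalIntegral.integral_nonneg htt.le fun τ hτ =>
      mul_nonneg (Real.rpow_nonneg (by linarith [hτ.2]) _) (norm_nonneg _))
  have hkey : ∀ x, u t x ≤ (fracPBound γ₁ * ‖u₀‖ + C * M) * (t - t₀) ^ (-(γ₁ * κ)) +
      fracSBound γ₁ * ∫ τ in t₀..t, (t - τ) ^ (γ₁ - 1) * ‖v τ‖ ^ p := fun x => by
    have h2 := H F t₀ t M ht₀ htt ht1 htT hF (fun s _ => hF0 s) hM0 hW x
    have h3 := (le_abs_self _).trans ((abs_apply_le_norm (fracP hγ₁ t u₀) x).trans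
      (norm_fracP_le hγ₁ t u₀))
    rw [he, ZeroAtInftyContinuousMap.add_apply]
    nlinarith
  refine norm_le_of_forall_abs_le ?_ fun x => ?_
  · have : 0 ≤ (fracPBound γ₁ * ‖u₀‖ + C * M) * (t - t₀) ^ (-(γ₁ * κ)) := by positivity
    linarith
  · rw [abs_of_nonneg (h.nonneg hγ₁ hp hu₀ htI x)]
    exact hkey x

section

variable {γ₁ γ₂ p q : ℝ} (hγ₁ : 0 < γ₁ ∧ γ₁ < 1) (hγ₂ : 0 < γ₂ ∧ γ₂ < 1)
  (hp : 1 ≤ p) (hq : 1 ≤ q) {u₀ v₀ : C₀(EuclideanSpace ℝ (Fin N), ℝ)}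
  {u v : ℝ → C₀(EuclideanSpace ℝ (Fin N), ℝ)}

include hγ₁ hγ₂ hp hq

/-- A nonnegative mild solution that stays bounded along a sequence of times is bounded. -/
lemma exists_bound_of_frequently_le {Tm M : ℝ} (hTm : 0 < Tm)
    (hu₀ : ∀ x, 0 ≤ u₀ x) (hv₀ : ∀ x, 0 ≤ v₀ x)
    (hsol : ∀ T, 0 < T → T < Tm →
      IsMildSolution γ₁ γ₂ (fun s => |s| ^ p) (fun s => |s| ^ q) u₀ v₀ T u v)
    (hfreq : ∃ᶠ t in 𝓝[<] Tm, ‖u t‖ + ‖v t‖ ≤ M) :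
    ∃ R, 0 ≤ R ∧ ∀ t ∈ Ico 0 Tm, ‖u t‖ ≤ R ∧ ‖v t‖ ≤ R := by
  have hg1 := hγ₁.1
  have hg2 := hγ₂.1
  have hM0 : 0 ≤ M := by
    obtain ⟨t, ht⟩ := hfreq.exists
    linarith [norm_nonneg (u t), norm_nonneg (v t)]
  -- Small enough that `(τ - t₀)^{-ε p}` and `(τ - t₀)^{-ε q}` remain integrable against the
  -- kernels, and that `κ = ε / γᵢ ≤ 1`.
  set ε := min γ₁ γ₂ / (2 * (p + q)) with hε
  have hε0 : 0 < ε := by positivity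
  have hεm : ε * (2 * (p + q)) = min γ₁ γ₂ := div_mul_cancel₀ _ (by positivity)
  have hε1 : ε * p < γ₁ := by nlinarith [min_le_left γ₁ γ₂]
  have hε2 : ε * q < γ₂ := by nlinarith [min_le_right γ₁ γ₂]
  have hε3 : ε ≤ γ₁ := by nlinarith
  have hε4 : ε ≤ γ₂ := by nlinarith
  obtain ⟨C₁, hC₁, H₁⟩ := exists_norm_le_of_isMildSolution (κ := ε / γ₁) hγ₁ (by positivity)
    ((div_le_one hg1).2 hε3) hp N Tm
  obtain ⟨C₂, hC₂, H₂⟩ := exists_norm_le_of_isMildSolution (κ := ε / γ₂) hγ₂ (by positivity)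
    ((div_le_one hg2).2 hε4) hq N Tm
  rw [mul_div_cancel₀ _ hg1.ne'] at H₁
  rw [mul_div_cancel₀ _ hg2.ne'] at H₂
  have hP₁ := mul_nonneg (fracPBound_nonneg γ₁) (norm_nonneg u₀)
  have hP₂ := mul_nonneg (fracPBound_nonneg γ₂) (norm_nonneg v₀)
  have hS₁ := fracSBound_nonneg γ₁
  have hS₂ := fracSBound_nonneg γ₂
  set A := fracPBound γ₁ * ‖u₀‖ + C₁ * M + (fracPBound γ₂ * ‖v₀‖ + C₂ * M) + 1 with hA
  have hA0 : 0 < A := by positivity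
  obtain ⟨d, hd0, hd1, hboot⟩ := exists_singular_bootstrap (A := A)
    (B := fracSBound γ₁ + fracSBound γ₂) hγ₁.2.le hγ₂.2.le
    (by linarith : 0 ≤ p) (by linarith : 0 ≤ q) hε0 hε1 hε2 hA0 (by positivity)
  obtain ⟨t₀, hb, ht₀⟩ := (hfreq.and_eventually
    (Ioo_mem_nhdsLT (max_lt hTm (by linarith : Tm - d < Tm)))).exists
  have ht₀0 : 0 < t₀ := (le_max_left _ _).trans_lt ht₀.1
  have ht₀d : Tm - d < t₀ := (le_max_right _ _).trans_lt ht₀.1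
  have hlate : ∀ t ∈ Ioo t₀ Tm,
      ‖u t‖ ≤ 2 * A * (t - t₀) ^ (-ε) ∧ ‖v t‖ ≤ 2 * A * (t - t₀) ^ (-ε) := by
    intro T hT
    have hsT := hsol T (ht₀0.trans hT.1) hT.2
    have hsub : Icc t₀ T ⊆ Icc 0 T := Icc_subset_Icc_left ht₀0.le
    refine hboot t₀ T (fun t => ‖u t‖) (fun t => ‖v t‖) hT.1.le (by linarith [hT.2])
      (hsT.1.mono hsub).norm (hsT.2.mono hsub).norm (fun _ _ => norm_nonneg _)
      (fun _ _ => norm_nonneg _) (fun t ht => ?_) (fun t ht => ?_) T ⟨hT.1, le_rfl⟩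
    · have hst := hsT.mono ht.2
      have h1 := H₁ γ₂ q u₀ v₀ u v t₀ t M hu₀ ht₀0.le ht.1 (by linarith [ht.2, hT.2])
        (ht.2.trans hT.2.le) hst (by linarith [norm_nonneg (v t₀)])
      have h2 : 0 ≤ ∫ τ in t₀..t, (t - τ) ^ (γ₁ - 1) * ‖v τ‖ ^ p :=
        intervalIntegral.integral_nonneg ht.1.le fun τ hτ =>
          mul_nonneg (Real.rpow_nonneg (by linarith [hτ.2]) _) (by positivity)
      have h3 : 0 ≤ (t - t₀) ^ (-ε) := Real.rpow_nonneg (by linarith [ht.1]) _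
      refine h1.trans (add_le_add (mul_le_mul_of_nonneg_right ?_ h3)
        (mul_le_mul_of_nonneg_right (by linarith) h2))
      nlinarith
    · have hst := (hsT.mono ht.2).swap
      have h1 := H₂ γ₁ p v₀ u₀ v u t₀ t M hv₀ ht₀0.le ht.1 (by linarith [ht.2, hT.2])
        (ht.2.trans hT.2.le) hst (by linarith [norm_nonneg (u t₀)])
      have h2 : 0 ≤ ∫ τ in t₀..t, (t - τ) ^ (γ₂ - 1) * ‖u τ‖ ^ q :=
        intervalIntegral.integral_nonneg ht.1.le fun τ hτ =>
          mul_nonneg (Real.rpow_nonneg (by linarith [hτ.2]) _) (by positivity)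
      have h3 : 0 ≤ (t - t₀) ^ (-ε) := Real.rpow_nonneg (by linarith [ht.1]) _
      refine h1.trans (add_le_add (mul_le_mul_of_nonneg_right ?_ h3)
        (mul_le_mul_of_nonneg_right (by linarith) h2))
      nlinarith
  set t₁ := (t₀ + Tm) / 2 with ht₁
  have h01 : t₀ < t₁ := by linarith [ht₀.2]
  -- The late bound is singular at `t₀`; compactness covers `[0, t₁]`, and beyond `t₁` the singular
  -- factor is at most its value there.
  have h1m : t₁ < Tm := by linarith [ht₀.2]
  obtain ⟨R, hR, hRb⟩ := (hsol t₁ (by linarith) h1m).exists_bound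
  refine ⟨max R (2 * A * (t₁ - t₀) ^ (-ε)), le_max_of_le_left hR, fun t ht => ?_⟩
  rcases le_total t t₁ with h | h
  · exact ⟨(hRb t ⟨ht.1, h⟩).1.trans (le_max_left _ _),
      (hRb t ⟨ht.1, h⟩).2.trans (le_max_left _ _)⟩
  · have h3 : 2 * A * (t - t₀) ^ (-ε) ≤ 2 * A * (t₁ - t₀) ^ (-ε) :=
      mul_le_mul_of_nonneg_left (Real.rpow_le_rpow_of_nonpos (by linarith) (by linarith)
        (by linarith)) (by positivity)
    have h4 := hlate t ⟨h01.trans_le h, ht.2⟩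
    exact ⟨(h4.1.trans h3).trans (le_max_right _ _), (h4.2.trans h3).trans (le_max_right _ _)⟩

omit hγ₁ hγ₂ hp hq in
-- A truncated solution strictly below the truncation height on `[0, t₁]` stays below it a little
-- longer, and there it solves the original system.
lemma IsMildSolution.exists_extension {R t₁ T : ℝ} (hu : Continuous u) (hv : Continuous v)
    (h : IsMildSolution γ₁ γ₂ (FracDiffusion.truncPow p R) (FracDiffusion.truncPow q R) u₀ v₀ T u v)
    (hT : t₁ < T) (hb : ∀ t ∈ Icc 0 t₁, ‖u t‖ < R ∧ ‖v t‖ < R) (ht₁ : 0 ≤ t₁) :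
    ∃ T', t₁ < T' ∧ IsMildSolution γ₁ γ₂ (fun s => |s| ^ p) (fun s => |s| ^ q) u₀ v₀ T' u v := by
  have hopen : IsOpen {t | ‖u t‖ < R ∧ ‖v t‖ < R} :=
    (isOpen_lt hu.norm continuous_const).inter (isOpen_lt hv.norm continuous_const)
  obtain ⟨r, hr, hball⟩ := Metric.isOpen_iff.1 hopen t₁ (hb t₁ ⟨ht₁, le_rfl⟩)
  have hall : ∀ t ∈ Icc 0 (min (t₁ + r / 2) T), ‖u t‖ < R ∧ ‖v t‖ < R := by
    intro t ht
    rcases le_total t t₁ with h1 | h1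
    · exact hb t ⟨ht.1, h1⟩
    · refine hball ?_
      rw [Metric.mem_ball, Real.dist_eq, abs_of_nonneg (by linarith)]
      linarith [ht.2.trans (min_le_left _ _)]
  exact ⟨min (t₁ + r / 2) T, lt_min (by linarith) hT, (h.mono (min_le_right _ _)).of_truncPow
    (fun t ht => (hall t ht).1.le) (fun t ht => (hall t ht).2.le)⟩

/-- The extension argument from `t₁ = 0`, with the truncation height chosen above the norms of the
initial values. -/
lemma exists_isMildSolution (u₀ v₀ : C₀(EuclideanSpace ℝ (Fin N), ℝ)) : ∃ T, 0 < T ∧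
    ∃ u v : ℝ → C₀(EuclideanSpace ℝ (Fin N), ℝ),
      IsMildSolution γ₁ γ₂ (fun s => |s| ^ p) (fun s => |s| ^ q) u₀ v₀ T u v := by
  have hP₁ := mul_nonneg (fracPBound_nonneg γ₁) (norm_nonneg u₀)
  have hP₂ := mul_nonneg (fracPBound_nonneg γ₂) (norm_nonneg v₀)
  set R := fracPBound γ₁ * ‖u₀‖ + fracPBound γ₂ * ‖v₀‖ + 1 with hR
  obtain ⟨u, v, hu, hv, h⟩ := exists_isMildSolution_truncPow hγ₁ hγ₂ hp hq u₀ v₀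
    (by positivity : 0 ≤ R) zero_le_one
  have h0u : u 0 = fracP hγ₁ 0 u₀ := by
    ext x
    rw [h.3 0 ⟨le_rfl, zero_le_one⟩ x, intervalIntegral.integral_same, add_zero, fracP_apply]
  have h0v : v 0 = fracP hγ₂ 0 v₀ := by
    ext x
    rw [h.4 0 ⟨le_rfl, zero_le_one⟩ x, intervalIntegral.integral_same, add_zero, fracP_apply]
  obtain ⟨T, hT, hs⟩ := h.exists_extension hu hv one_pos (fun t ht => by
    rw [le_antisymm ht.2 ht.1, h0u, h0v]
    exact ⟨(norm_fracP_le hγ₁ 0 u₀).trans_lt (by linarith),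
      (norm_fracP_le hγ₂ 0 v₀).trans_lt (by linarith)⟩) le_rfl
  exact ⟨T, hT, u, v, hs⟩

/-- A bounded mild solution extends beyond its interval of existence. -/
lemma exists_isMildSolution_of_bounded {Tm R : ℝ} (hTm : 0 < Tm) (hR : 0 ≤ R)
    (hsol : ∀ T, 0 < T → T < Tm →
      IsMildSolution γ₁ γ₂ (fun s => |s| ^ p) (fun s => |s| ^ q) u₀ v₀ T u v)
    (hb : ∀ t ∈ Ico 0 Tm, ‖u t‖ ≤ R ∧ ‖v t‖ ≤ R) : ∃ T, Tm < T ∧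
    ∃ u' v' : ℝ → C₀(EuclideanSpace ℝ (Fin N), ℝ),
      IsMildSolution γ₁ γ₂ (fun s => |s| ^ p) (fun s => |s| ^ q) u₀ v₀ T u' v' := by
  obtain ⟨u', v', hu', hv', h⟩ := exists_isMildSolution_truncPow hγ₁ hγ₂ hp hq u₀ v₀
    (by linarith : 0 ≤ R + 1) (by linarith : 0 ≤ Tm + 1)
  have heq : ∀ t ∈ Ico 0 Tm, u t = u' t ∧ v t = v' t := by
    intro t ht
    have hT : (t + Tm) / 2 < Tm := by linarith [ht.2]
    have hbT : ∀ s ∈ Icc 0 ((t + Tm) / 2), ‖u s‖ ≤ R ∧ ‖v s‖ ≤ R := fun s hs =>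
      hb s ⟨hs.1, hs.2.trans_lt hT⟩
    have hT0 : 0 < (t + Tm) / 2 := by linarith [ht.1]
    have := ((hsol _ hT0 hT).truncPow (R := R + 1)
      (fun s hs => (hbT s hs).1.trans (by linarith)) (fun s hs => (hbT s hs).2.trans (by linarith))
      ).eqOn_of_truncPow hγ₁ hγ₂ hp hq (by linarith) hT0.le (h.mono (by linarith))
    have ht' : t ∈ Icc 0 ((t + Tm) / 2) := ⟨ht.1, by linarith [ht.2]⟩
    exact ⟨this.1 ht', this.2 ht'⟩
  have hclosed : IsClosed {t | ‖u' t‖ ≤ R ∧ ‖v' t‖ ≤ R} :=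
    (isClosed_le hu'.norm continuous_const).inter (isClosed_le hv'.norm continuous_const)
  have hsub : Icc 0 Tm ⊆ {t | ‖u' t‖ ≤ R ∧ ‖v' t‖ ≤ R} := by
    -- The bound `R` holds on `[0, Tm)` and passes to `Tm` by continuity of the truncated solution;
    -- truncation at `R + 1` leaves room to continue.
    rw [← closure_Ico hTm.ne]
    refine hclosed.closure_subset_iff.2 fun t ht => ?_
    have := hb t ht
    rwa [(heq t ht).1, (heq t ht).2] at this
  obtain ⟨T, hT, hs⟩ := h.exists_extension hu' hv' (by linarith : Tm < Tm + 1)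
    (fun t ht => ⟨(hsub ht).1.trans_lt (by linarith), (hsub ht).2.trans_lt (by linarith)⟩) hTm.le
  exact ⟨T, hT, u', v', hs⟩

/-- If there is no mild solution on large intervals, the mild solution blows up. -/
theorem mildSolutionBlowsUp_of_eventually (hu₀ : ∀ x, 0 ≤ u₀ x) (hv₀ : ∀ x, 0 ≤ v₀ x)
    (hno : ∀ᶠ T : ℝ in atTop, ∀ u v : ℝ → C₀(EuclideanSpace ℝ (Fin N), ℝ),
      ¬ IsMildSolution γ₁ γ₂ (fun s => |s| ^ p) (fun s => |s| ^ q) u₀ v₀ T u v) :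
    MildSolutionBlowsUp γ₁ γ₂ (fun s => |s| ^ p) (fun s => |s| ^ q) u₀ v₀ := by
  set S : Set ℝ := {T | 0 < T ∧ ∃ u v : ℝ → C₀(EuclideanSpace ℝ (Fin N), ℝ),
    IsMildSolution γ₁ γ₂ (fun s => |s| ^ p) (fun s => |s| ^ q) u₀ v₀ T u v} with hS
  obtain ⟨Tl, hTl, hTlS⟩ := exists_isMildSolution hγ₁ hγ₂ hp hq u₀ v₀
  have hne : S.Nonempty := ⟨Tl, hTl, hTlS⟩
  obtain ⟨T₁, hT₁⟩ := eventually_atTop.1 hno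
  have hbdd : BddAbove S := ⟨T₁, fun T ⟨_, u, v, h⟩ => by
    by_contra! hlt
    exact hT₁ T hlt.le u v h⟩
  set Tm := sSup S with hTm
  have hTm0 : 0 < Tm := hTl.trans_le (le_csSup hbdd ⟨hTl, hTlS⟩)
  have hex : ∀ T, ∃ u v : ℝ → C₀(EuclideanSpace ℝ (Fin N), ℝ), T < Tm →
      IsMildSolution γ₁ γ₂ (fun s => |s| ^ p) (fun s => |s| ^ q) u₀ v₀ T u v := by
    intro T
    by_cases hT : T < Tm
    · obtain ⟨T', ⟨_, u, v, h⟩, hTT'⟩ := exists_lt_of_lt_csSup hne hT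
      exact ⟨u, v, fun _ => h.mono hTT'.le⟩
    · exact ⟨fun _ => 0, fun _ => 0, fun h => absurd h hT⟩
  choose U V hUV using hex
  -- At time `t < Tm` use a solution on `[0, (t + Tm)/2]`, an interval that contains `t` and ends
  -- before `Tm`; uniqueness makes the choices compatible.
  set u : ℝ → C₀(EuclideanSpace ℝ (Fin N), ℝ) := fun t => U ((t + Tm) / 2) t with hu
  set v : ℝ → C₀(EuclideanSpace ℝ (Fin N), ℝ) := fun t => V ((t + Tm) / 2) t with hv
  have huniq : ∀ T, T < Tm → ∀ u' v' : ℝ → C₀(EuclideanSpace ℝ (Fin N), ℝ),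
      IsMildSolution γ₁ γ₂ (fun s => |s| ^ p) (fun s => |s| ^ q) u₀ v₀ T u' v' →
      EqOn u' u (Icc 0 T) ∧ EqOn v' v (Icc 0 T) := by
    intro T hT u' v' h
    have key : ∀ t ∈ Icc 0 T, u' t = u t ∧ v' t = v t := fun t ht => by
      have htm : t < Tm := ht.2.trans_lt hT
      have ht' : t ∈ Icc 0 t := ⟨ht.1, le_rfl⟩
      have := (h.mono ht.2).eqOn hγ₁ hγ₂ hp hq ht.1
        ((hUV ((t + Tm) / 2) (by linarith)).mono (by linarith))
      exact ⟨this.1 ht', this.2 ht'⟩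
    exact ⟨fun t ht => (key t ht).1, fun t ht => (key t ht).2⟩
  have hsol : ∀ T, 0 < T → T < Tm →
      IsMildSolution γ₁ γ₂ (fun s => |s| ^ p) (fun s => |s| ^ q) u₀ v₀ T u v := by
    intro T _ hT
    obtain ⟨h1, h2⟩ := huniq T hT _ _ (hUV T hT)
    exact (hUV T hT).congr h1.symm h2.symm (fun _ _ _ => rfl) (fun _ _ _ => rfl)
  have hnb : ∀ (u v : ℝ → C₀(EuclideanSpace ℝ (Fin N), ℝ)) (R : ℝ), 0 ≤ R →
      (∀ T, 0 < T → T < Tm →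
        IsMildSolution γ₁ γ₂ (fun s => |s| ^ p) (fun s => |s| ^ q) u₀ v₀ T u v) →
      ¬ ∀ t ∈ Ico 0 Tm, ‖u t‖ ≤ R ∧ ‖v t‖ ≤ R := by
    intro u v R hR hsol hb
    obtain ⟨T, hT, hTS⟩ := exists_isMildSolution_of_bounded hγ₁ hγ₂ hp hq hTm0 hR hsol hb
    exact absurd (le_csSup hbdd ⟨hTm0.trans hT, hTS⟩) (not_le.2 hT)
  refine ⟨Tm, hTm0, u, v, hsol, fun T hT u' v' h => ?_, ?_⟩
  · have hlt : T < Tm := by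
      by_contra! hle
      obtain ⟨R, hR, hb⟩ := h.exists_bound
      exact hnb u' v' R hR (fun T' _ hT' => h.mono (hT'.le.trans hle))
        fun t ht => hb t ⟨ht.1, ht.2.le.trans hle⟩
    exact ⟨hlt, huniq T hlt u' v' h⟩
  · rw [tendsto_atTop]
    by_contra! hcon
    obtain ⟨M, hM⟩ := hcon
    obtain ⟨R, hR, hb⟩ := exists_bound_of_frequently_le (M := M) hγ₁ hγ₂ hp hq hTm0 hu₀ hv₀ hsol
      (hM.mono fun _ ht => le_of_lt ht)
    exact hnb u v R hR hsol hb

end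

/-! ### Symmetry of the system and verification of the exponent condition -/

lemma MildSolutionBlowsUp.swap {γ₁ γ₂ : ℝ} {f g : ℝ → ℝ}
    {u₀ v₀ : C₀(EuclideanSpace ℝ (Fin N), ℝ)} (h : MildSolutionBlowsUp γ₁ γ₂ f g u₀ v₀) :
    MildSolutionBlowsUp γ₂ γ₁ g f v₀ u₀ := by
  obtain ⟨Tm, hTm, u, v, h1, h2, h3⟩ := h
  refine ⟨Tm, hTm, v, u, fun T hT hT' => (h1 T hT hT').swap, fun T hT u' v' h => ?_, ?_⟩
  · obtain ⟨a, b, c⟩ := h2 T hT v' u' h.swap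
    exact ⟨a, c, b⟩
  · simpa only [add_comm] using h3

/-- Blow-up below the critical dimension. -/
theorem mildSolutionBlowsUp_of_lt {γ₁ γ₂ p q : ℝ} (hγ₁ : 0 < γ₁ ∧ γ₁ < 1)
    (hγ₂ : 0 < γ₂ ∧ γ₂ < 1) (hp : 1 ≤ p) (hq : 1 ≤ q) (hpq : 1 < p * q)
    (hcrit : (N : ℝ) / 2 * γ₁ * (p * q - 1) < γ₁ + p * min γ₁ γ₂)
    {u₀ v₀ : C₀(EuclideanSpace ℝ (Fin N), ℝ)} (hu₀ : ∀ x, 0 ≤ u₀ x) (hv₀ : ∀ x, 0 ≤ v₀ x)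
    (hu₀_ne : ∃ x, u₀ x ≠ 0) :
    MildSolutionBlowsUp γ₁ γ₂ (fun s => |s| ^ p) (fun s => |s| ^ q) u₀ v₀ :=
  mildSolutionBlowsUp_of_eventually hγ₁ hγ₂ hp hq hu₀ hv₀
    (eventually_not_isMildSolution hγ₁ hγ₂ hp hq hpq hcrit hu₀ hv₀ hu₀_ne)

/-- `h₁` is the condition when the minimum is `γ₂`, and `h₂`, after multiplication by `γ₁`, when it
is `γ₁`. -/
lemma lt_of_lt_min_div {n γ₁ γ₂ p q : ℝ} (hγ₁ : 0 < γ₁) (hpq : 1 < p * q)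
    (h₁ : n < (p * γ₂ + γ₁) / (γ₁ * (p * q - 1))) (h₂ : n < (p + 1) / (p * q - 1)) :
    n * γ₁ * (p * q - 1) < γ₁ + p * min γ₁ γ₂ := by
  have h0 : 0 < p * q - 1 := by linarith
  rw [lt_div_iff₀ (by positivity)] at h₁
  rw [lt_div_iff₀ h0] at h₂
  rcases min_choice γ₁ γ₂ with h | h <;> rw [h]
  · nlinarith
  · linarith

end

end FracDiffusion

end

theorem theorem3p4 (N : ℕ) (hN : 1 ≤ N) (p q γ₁ γ₂ : ℝ)
    (hγ₁ : 0 < γ₁ ∧ γ₁ < 1) (hγ₂ : 0 < γ₂ ∧ γ₂ < 1)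
    (u₀ v₀ : C₀(EuclideanSpace ℝ (Fin N), ℝ))
    (hu₀ : ∀ x, 0 ≤ u₀ x) (hv₀ : ∀ x, 0 ≤ v₀ x)
    (hu₀_ne : ∃ x, u₀ x ≠ 0) (hv₀_ne : ∃ x, v₀ x ≠ 0)
    (h : (1 < p ∧ 1 < q ∧
          ((N : ℝ) / 2 <
              min (min ((p * γ₂ + γ₁) / (γ₁ * (p * q - 1)))
                       ((q * γ₁ + γ₂) / (γ₁ * (p * q - 1))))
                  (min ((p * q * (γ₁ - γ₂) + q * γ₁ + γ₂) / (γ₁ * (p * q - 1)))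
                       ((p + 1) / (p * q - 1))) ∨
           (N : ℝ) / 2 <
              min (min ((q * γ₁ + γ₂) / (γ₂ * (p * q - 1)))
                       ((p * γ₂ + γ₁) / (γ₂ * (p * q - 1))))
                  (min ((p * q * (γ₂ - γ₁) + p * γ₂ + γ₁) / (γ₂ * (p * q - 1)))
                       ((q + 1) / (p * q - 1))))) ∨
         (p = 1 ∧ 1 < q ∧ q < 1 + 2 / (N : ℝ)) ∨
         (1 < p ∧ p < 1 + 2 / (N : ℝ) ∧ q = 1)) :
    FracDiffusion.MildSolutionBlowsUp γ₁ γ₂ (fun s => |s| ^ p) (fun s => |s| ^ q) u₀ v₀ := by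
  have hN0 : (0 : ℝ) < N := by exact_mod_cast hN
  have hg1 := hγ₁.1
  have hg2 := hγ₂.1
  have hsub : ∀ r : ℝ, r < 1 + 2 / (N : ℝ) → (N : ℝ) / 2 * (r - 1) < 1 := fun r hr => by
    have h1 : r - 1 < 2 / (N : ℝ) := by linarith
    rw [lt_div_iff₀ hN0] at h1
    linarith
  rcases h with ⟨hp, hq, h | h⟩ | ⟨rfl, hq, hqN⟩ | ⟨hp, hpN, rfl⟩
  · have hpq : 1 < p * q := by nlinarith
    simp only [lt_min_iff] at h
    exact FracDiffusion.mildSolutionBlowsUp_of_lt hγ₁ hγ₂ hp.le hq.le hpq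
      (FracDiffusion.lt_of_lt_min_div hg1 hpq h.1.1 h.2.2) hu₀ hv₀ hu₀_ne
  · have hpq : 1 < q * p := by nlinarith
    simp only [lt_min_iff, mul_comm p q] at h
    exact (FracDiffusion.mildSolutionBlowsUp_of_lt hγ₂ hγ₁ hq.le hp.le hpq
      (FracDiffusion.lt_of_lt_min_div hg2 hpq h.1.1 h.2.2) hv₀ hu₀ hv₀_ne).swap
  · have h1 := hsub q hqN
    -- Let the equation with the smaller order play the first role. Its order then factors out of
    -- the condition, leaving `(N/2)(q - 1) < 2` or `(N/2)(q - 1) < 1 + q`, both implied by `h1`.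
    rcases le_total γ₁ γ₂ with hle | hle
    · refine FracDiffusion.mildSolutionBlowsUp_of_lt hγ₁ hγ₂ le_rfl hq.le (by linarith) ?_
        hu₀ hv₀ hu₀_ne
      rw [min_eq_left hle, one_mul, one_mul]
      nlinarith
    · refine (FracDiffusion.mildSolutionBlowsUp_of_lt hγ₂ hγ₁ hq.le le_rfl (by linarith) ?_
        hv₀ hu₀ hv₀_ne).swap
      rw [min_eq_left hle, mul_one]
      nlinarith
  · have h1 := hsub p hpN
    rcases le_total γ₂ γ₁ with hle | hle
    · refine (FracDiffusion.mildSolutionBlowsUp_of_lt hγ₂ hγ₁ le_rfl hp.le (by linarith) ?_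
        hv₀ hu₀ hv₀_ne).swap
      rw [min_eq_left hle, one_mul, one_mul]
      nlinarith
    · refine FracDiffusion.mildSolutionBlowsUp_of_lt hγ₁ hγ₂ hp.le le_rfl (by linarith) ?_
        hu₀ hv₀ hu₀_ne
      rw [min_eq_left hle, mul_one]
      nlinarith
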